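/- **Period structures.** Let $M$ be a (finite-dimensional, Hausdorff, second countable) complex manifold of complex dimension $n$ with complex structure $I$. A *special period structure* $(M,\Gamma,Z)$ consists of a bundle of lattices $\Gamma\subset TM$ of rank $2n$ with $\Gamma_p\otimes\mathbb R=T_pM$, a fibrewise integral skew pairing $\langle-,-\rangle:\Gamma_p\times\Gamma_p\to\mathbb Z$, and a holomorphic section $Z$ of $\mathrm{Hom}(\Gamma,\mathbb C)$, such that: 1. locally $\Gamma$ has smooth frames $(\gamma_i,\gamma^i)_{i=1,\dots,n}$ with $\langle\gamma_i,\gamma^j\rangle=\delta_i^j$ and $\langle\gamma_i,\gamma_j\rangle=\langle\gamma^i,\gamma^j\rangle=0$; we write $\omega$ for the 2-form on $M$ induced by the pairing ($\omega=\delta^i\wedge\delta_i$ for the dual frame $(\delta^i,\delta_i)$) and $\nabla$ for the flat connection on $TM$ whose local flat sections include those of $\Gamma$; 2. $\omega(I-,I-)=\omega(-,-)$; 3. the complex vector field $\xi^{1,0}$ with $\tfrac12 Z=\omega(\xi^{1,0},-)$ satisfies $\nabla\xi^{1,0}=\pi^{1,0}=\tfrac12(\mathrm{Id}-\mathrm iI)$.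 **Special Joyce structures.** Let $N=TM$ with projection $\pi:N\to M$, let $\mathcal H:\pi^*TM\to TN$ be the flat Ehresmann connection given by the parallel transport of $\nabla$, $\nu:\pi^*TM\to V_\pi=\ker d\pi$ the canonical isomorphism, and $\omega^\nu$ the symplectic form on the vertical bundle $V_\pi$ that corresponds to $\omega$ under $\nu$; all are extended complex-(bi)linearly. For $f:N\to\mathbb C$, $\mathrm{Ham}_f$ is the section of $V_\pi\otimes\mathbb C$ with $df|_{V_\pi}=\omega^\nu(-,\mathrm{Ham}_f)$; for $V\in N$ over $p$ and $X\in T_pM\otimes\mathbb C$, $\mathrm{Ham}_{\mathcal H_XJ}$ and $\mathrm{Ham}_{\nu_XJ}$ at $V$ are computed from the functions $\mathcal H_XJ$, $\nu_XJ$ on the fibre $T_pM$. A *special Joyce structure* over $(M,\Gamma,Z)$ is a complex linear map $h:\pi^*T^{1,0}M\to TN\otimes\mathbb C$ with $d\pi\circ h_X=X$ and a complex antilinear map $v:\pi^*T^{1,0}M\to V_\pi\otimes\mathbb C$ such that: 1. $TN\otimes\mathbb C=\mathrm{Im}(h)\oplus\mathrm{Im}(\overline h)\oplus\mathrm{Im}(v)\oplus\mathrm{Im}(\overline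 v)$; 2. there is a smooth function $J:N\to\mathbb C$ with $h_X=\mathcal H_X+\mathrm{Ham}_{\mathcal H_XJ}$ and $v_X=2\pi\mathrm i(\nu_{\overline X}+\mathrm{Ham}_{\nu_{\overline X}J})$; 3. for every $\zeta\in\mathbb C^\times$ the complexified connection $\mathcal A^\zeta_X=h_X-\zeta^{-1}\overline{v_X}$, $\mathcal A^\zeta_{\overline X}=\overline{h_X}+\zeta v_X$ ($X\in\pi^*T^{1,0}M$) is flat, i.e. its image is an involutive distribution in $TN\otimes\mathbb C$; 4. $\omega^\nu$ is of type $(1,1)$ with respect to the almost complex structure $I_3$ defined next. For $\zeta\in\mathbb C$ let $I_\zeta$ be the almost complex structure of $N$ whose $(-\mathrm i)$-eigenspace is $\mathrm{Im}(\mathcal A^\zeta)$, where $\mathcal A^{0}_X=-\overline{v_X}$, $\mathcal A^0_{\overline X}=\overline{h_X}$; put $I_1=I_{\zeta=\mathrm i}$, $I_2=I_{\zeta=-1}$, $I_3=I_{\zeta=0}$. Let $\omega_3$ be the real 2-form on $N$ with $$\omega_3(v_X,\overline{v_Y})=\omega_3(h_Y,\overline{h_X})=-\tfrac1{4\pi^2}\,\omega^\nu(v_X,\overline{v_Y}),\qquad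 X,Y\in\pi^*T^{1,0}M,$$ all other pairings being $0$, and $g=\omega_3(-,I_3-)$. The special Joyce structure is *compatible* with $(M,\Gamma,Z)$ if $(g,I_1,I_2,I_3)$ is invariant under the fibrewise translations of $TM$ by the local sections of $2\pi\Gamma$. **Integrable systems.** A *hyperkähler (HK) structure*, possibly of indefinite signature, on a manifold $X$ is a pseudo-Riemannian metric $g$ with integrable complex structures $I_1,I_2,I_3$ which preserve $g$ and satisfy $I_1I_2=I_3=-I_2I_1$, such that the forms $\omega_i=g(I_i-,-)$ are closed. An *algebraic integrable system* $(\pi:X\to M,\Omega,[\rho])$ consists of a complex structure on $X$, a holomorphic submersion $\pi:X\to M$, a holomorphic symplectic form $\Omega$ on $X$ such that the fibres $X_p=\pi^{-1}(p)$ are compact, connected and Lagrangian (hence tori), and smoothly varying classes $[\rho_p]\in H^{1,1}(X_p)\cap H^2(X_p,\mathbb Z)$ which define possibly indefinite (non-degenerate) polarizations of the $X_p$. It is *compatible* with an HK structure on $X$ if its complex structure is $I_3$ (so that $\pi$ is $I_3$-holomorphic), $\Omega=\omega_1+\mathrm i\omega_2$, and $[\omega_3|_{X_p}]=[\rho_p]$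 for all $p\in M$. **Proposition.** Let $(M,\Gamma,Z)$ be a special period structure with a compatible special Joyce structure over it. Then the quotient manifold $X=TM/2\pi\Gamma$ is Hausdorff and second countable, the structure $(g,I_1,I_2,I_3)$ on $TM$ is the pullback of an HK structure on $X$ under the quotient map, and there is an algebraic integrable system on $X$, with the canonical projection $\pi:X\to M$ as its projection, which is compatible with this HK structure. -/

import Mathlib

open scoped Manifold ContDiff Topology

namespace SpecialJoyce

noncomputable section

/-! ### Complexification of a real vector space -/

/-- The complexification `V ⊗ ℂ` of a real vector space `V`; the pair `⟨a, b⟩` is `a + i b`. -/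
@[ext]
structure Cx (V : Type*) where
  re : V
  im : V

namespace Cx

/-- The real vector space underlying `V ⊗ ℂ` is `V × V`. -/
def equivProd (V : Type*) : Cx V ≃ V × V where
  toFun w := (w.re, w.im)
  invFun q := ⟨q.1, q.2⟩
  left_inv _ := rfl
  right_inv _ := rfl

variable {V W : Type*} [AddCommGroup V]

instance : AddCommGroup (Cx V) := (equivProd V).addCommGroup

@[simp] theorem re_add (u w : Cx V) : (u + w).re = u.re + w.re := rfl
@[simp] theorem im_add (u w : Cx V) : (u + w).im = u.im + w.im := rfl
@[simp] theorem re_zero : (0 : Cx V).re = 0 := rfl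
@[simp] theorem im_zero : (0 : Cx V).im = 0 := rfl
@[simp] theorem re_neg (u : Cx V) : (-u).re = -u.re := rfl
@[simp] theorem im_neg (u : Cx V) : (-u).im = -u.im := rfl
@[simp] theorem re_sub (u w : Cx V) : (u - w).re = u.re - w.re := rfl
@[simp] theorem im_sub (u w : Cx V) : (u - w).im = u.im - w.im := rfl

variable [Module ℝ V] [AddCommGroup W] [Module ℝ W]

instance : SMul ℂ (Cx V) where
  smul c w := ⟨c.re • w.re - c.im • w.im, c.re • w.im + c.im • w.re⟩

@[simp] theorem re_smul (c : ℂ) (w : Cx V) : (c • w).re = c.re • w.re - c.im • w.im := rfl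
@[simp] theorem im_smul (c : ℂ) (w : Cx V) : (c • w).im = c.re • w.im + c.im • w.re := rfl

instance : Module ℂ (Cx V) where
  one_smul w := by ext <;> simp
  mul_smul c d w := by ext <;> simp <;> module
  smul_zero c := by ext <;> simp
  smul_add c u w := by ext <;> simp <;> module
  add_smul c d w := by ext <;> simp <;> module
  zero_smul w := by ext <;> simp

/-- Complex conjugation. -/
def conj : Cx V →ₛₗ[starRingEnd ℂ] Cx V where
  toFun w := ⟨w.re, -w.im⟩
  map_add' u w := by ext <;> simp [add_comm]
  map_smul' c w := by
    ext
    · simp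
    · simp
      module

/-- The complex-linear extension of a real-linear map. -/
def map (f : V →ₗ[ℝ] W) : Cx V →ₗ[ℂ] Cx W where
  toFun w := ⟨f w.re, f w.im⟩
  map_add' u w := by ext <;> simp
  map_smul' c w := by ext <;> simp

/-- The complex-linear extension of a real-linear map `V → ℂ`. -/
def eval (f : V →ₗ[ℝ] ℂ) (w : Cx V) : ℂ := f w.re + Complex.I * f w.im

/-- The complex-bilinear extension of a real bilinear form. -/
def bilin (s : V → V → ℝ) (u w : Cx V) : ℂ :=
  ⟨s u.re w.re - s u.im w.im, s u.re w.im + s u.im w.re⟩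

end Cx

/-! ### Calculus on real manifolds -/

section Calculus

variable {F : Type*} [NormedAddCommGroup F] [NormedSpace ℝ F] {H : Type*} [TopologicalSpace H]
  (J : ModelWithCorners ℝ F H) {X : Type*} [TopologicalSpace X] [ChartedSpace H X]
  [IsManifold J ∞ X]
  {K : Type*} [NormedAddCommGroup K] [NormedSpace ℝ K]

/-- The vector field `A` is smooth on `U`. -/
def SmoothFieldOn (A : Π x : X, TangentSpace J x) (U : Set X) : Prop :=
  ContMDiffOn J J.tangent ∞ (fun x => (⟨x, A x⟩ : TangentBundle J X)) U

/-- The complex vector field `P` is smooth on `U`. -/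
def SmoothCxFieldOn (P : Π x : X, Cx (TangentSpace J x)) (U : Set X) : Prop :=
  SmoothFieldOn J (fun x => (P x).re) U ∧ SmoothFieldOn J (fun x => (P x).im) U

/-- The complex-bilinear extension of the Lie bracket to complex vector fields. -/
def cxBracket (P Q : Π x : X, Cx (TangentSpace J x)) (x : X) : Cx (TangentSpace J x) :=
  ⟨VectorField.mlieBracket J (fun y => (P y).re) (fun y => (Q y).re) x
      - VectorField.mlieBracket J (fun y => (P y).im) (fun y => (Q y).im) x,
    VectorField.mlieBracket J (fun y => (P y).re) (fun y => (Q y).im) x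
      + VectorField.mlieBracket J (fun y => (P y).im) (fun y => (Q y).re) x⟩

/-- A complex distribution is involutive: the bracket of two of its smooth local sections is again
a section of it. -/
def IsInvolutive (D : Π x : X, Submodule ℂ (Cx (TangentSpace J x))) : Prop :=
  ∀ U : Set X, IsOpen U → ∀ P Q : Π x : X, Cx (TangentSpace J x),
    SmoothCxFieldOn J P U → SmoothCxFieldOn J Q U →
    (∀ x ∈ U, P x ∈ D x) → (∀ x ∈ U, Q x ∈ D x) → ∀ x ∈ U, cxBracket J P Q x ∈ D x

/-- The derivative of a function along a tangent vector. -/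
def dirDeriv (f : X → K) (x : X) (a : TangentSpace J x) : K :=
  (mfderiv J 𝓘(ℝ, K) f x : TangentSpace J x →L[ℝ] K) a

/-- A field of endomorphisms is smooth: it maps smooth vector fields to smooth vector fields. -/
def IsSmoothEndo (I : Π x : X, TangentSpace J x →ₗ[ℝ] TangentSpace J x) : Prop :=
  ∀ U : Set X, IsOpen U → ∀ A : Π x : X, TangentSpace J x, SmoothFieldOn J A U →
    SmoothFieldOn J (fun x => I x (A x)) U

/-- A field of linear forms is smooth: it takes smooth values on smooth vector fields. -/
def IsSmoothForm (b : Π x : X, TangentSpace J x →ₗ[ℝ] K) : Prop :=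
  ∀ U : Set X, IsOpen U → ∀ A : Π x : X, TangentSpace J x, SmoothFieldOn J A U →
    ContMDiffOn J 𝓘(ℝ, K) ∞ (fun x => b x (A x)) U

/-- A field of bilinear forms is smooth: it takes smooth values on smooth vector fields. -/
def IsSmoothBilin (s : Π x : X, TangentSpace J x →ₗ[ℝ] TangentSpace J x →ₗ[ℝ] K) : Prop :=
  ∀ U : Set X, IsOpen U → ∀ A B : Π x : X, TangentSpace J x,
    SmoothFieldOn J A U → SmoothFieldOn J B U →
    ContMDiffOn J 𝓘(ℝ, K) ∞ (fun x => s x (A x) (B x)) U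

/-- `(dβ)(A, B)` for a 1-form `β`. -/
def extDerivOne (b : Π x : X, TangentSpace J x →ₗ[ℝ] K) (A B : Π x : X, TangentSpace J x)
    (x : X) : K :=
  dirDeriv J (fun y => b y (B y)) x (A x) - dirDeriv J (fun y => b y (A y)) x (B x)
    - b x (VectorField.mlieBracket J A B x)

/-- `(dσ)(A, B, C)` for a 2-form `σ`. -/
def extDerivTwo (s : Π x : X, TangentSpace J x →ₗ[ℝ] TangentSpace J x →ₗ[ℝ] K)
    (A B C : Π x : X, TangentSpace J x) (x : X) : K :=
  dirDeriv J (fun y => s y (B y) (C y)) x (A x)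
    + dirDeriv J (fun y => s y (C y) (A y)) x (B x)
    + dirDeriv J (fun y => s y (A y) (B y)) x (C x)
    - s x (VectorField.mlieBracket J A B x) (C x)
    - s x (VectorField.mlieBracket J B C x) (A x)
    - s x (VectorField.mlieBracket J C A x) (B x)

/-- The 2-form `σ` is closed along the (integrable) distribution `D`, that is, it restricts to
closed forms on the leaves of `D`. For `D = ⊤` it is closed. -/
def IsClosedAlong (D : Π x : X, Submodule ℝ (TangentSpace J x))
    (s : Π x : X, TangentSpace J x →ₗ[ℝ] TangentSpace J x →ₗ[ℝ] K) : Prop :=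
  ∀ U : Set X, IsOpen U → ∀ A B C : Π x : X, TangentSpace J x,
    SmoothFieldOn J A U → SmoothFieldOn J B U → SmoothFieldOn J C U →
    (∀ x ∈ U, A x ∈ D x) → (∀ x ∈ U, B x ∈ D x) → (∀ x ∈ U, C x ∈ D x) →
    ∀ x ∈ U, extDerivTwo J s A B C x = 0

/-- The 2-form `σ` is closed. -/
def IsClosedTwoForm (s : Π x : X, TangentSpace J x →ₗ[ℝ] TangentSpace J x →ₗ[ℝ] K) : Prop :=
  IsClosedAlong J (fun _ => ⊤) s

/-- The `(-i)`-eigenspace in `T_x X ⊗ ℂ` of a real endomorphism. -/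
def negEigenspace {V : Type*} [AddCommGroup V] [Module ℝ V] (I : V →ₗ[ℝ] V) :
    Submodule ℂ (Cx V) :=
  LinearMap.ker (Cx.map I + Complex.I • LinearMap.id)

/-- An integrable almost complex structure: smooth, `I² = -1`, and the distribution of
`(0,1)`-vectors is involutive. -/
structure IsComplexStructure (I : Π x : X, TangentSpace J x →ₗ[ℝ] TangentSpace J x) : Prop where
  smooth : IsSmoothEndo J I
  sq : ∀ x a, I x (I x a) = -a
  involutive : IsInvolutive J (fun x => negEigenspace (I x))

variable (X) in
/-- A hyperkähler structure, possibly of indefinite signature. -/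
structure Hyperkahler where
  g : Π x : X, TangentSpace J x →ₗ[ℝ] TangentSpace J x →ₗ[ℝ] ℝ
  I₁ : Π x : X, TangentSpace J x →ₗ[ℝ] TangentSpace J x
  I₂ : Π x : X, TangentSpace J x →ₗ[ℝ] TangentSpace J x
  I₃ : Π x : X, TangentSpace J x →ₗ[ℝ] TangentSpace J x
  g_smooth : IsSmoothBilin J g
  g_symm : ∀ x a b, g x a b = g x b a
  g_nondegenerate : ∀ x a, (∀ b, g x a b = 0) → a = 0
  complex₁ : IsComplexStructure J I₁
  complex₂ : IsComplexStructure J I₂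
  complex₃ : IsComplexStructure J I₃
  I₁_I₂ : ∀ x a, I₁ x (I₂ x a) = I₃ x a
  I₂_I₁ : ∀ x a, I₂ x (I₁ x a) = -I₃ x a
  hermitian₁ : ∀ x a b, g x (I₁ x a) (I₁ x b) = g x a b
  hermitian₂ : ∀ x a b, g x (I₂ x a) (I₂ x b) = g x a b
  hermitian₃ : ∀ x a b, g x (I₃ x a) (I₃ x b) = g x a b
  closed₁ : IsClosedTwoForm J (fun x => (g x).comp (I₁ x))
  closed₂ : IsClosedTwoForm J (fun x => (g x).comp (I₂ x))
  closed₃ : IsClosedTwoForm J (fun x => (g x).comp (I₃ x))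

namespace Hyperkahler

variable {J} (S : Hyperkahler J X)

/-- The Kähler form `ω₁ = g(I₁ -, -)`. -/
def ω₁ (x : X) : TangentSpace J x →ₗ[ℝ] TangentSpace J x →ₗ[ℝ] ℝ := (S.g x).comp (S.I₁ x)

/-- The Kähler form `ω₂ = g(I₂ -, -)`. -/
def ω₂ (x : X) : TangentSpace J x →ₗ[ℝ] TangentSpace J x →ₗ[ℝ] ℝ := (S.g x).comp (S.I₂ x)

/-- The Kähler form `ω₃ = g(I₃ -, -)`. -/
def ω₃ (x : X) : TangentSpace J x →ₗ[ℝ] TangentSpace J x →ₗ[ℝ] ℝ := (S.g x).comp (S.I₃ x)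

end Hyperkahler

end Calculus

/-! ### Complex manifolds and their tangent bundles

A complex manifold is a manifold modelled on a finite-dimensional complex vector space `E`, with
holomorphic coordinate changes. -/

section ComplexManifold

variable (E : Type*) [NormedAddCommGroup E] [NormedSpace ℂ E]
  {M : Type*} [TopologicalSpace M] [ChartedSpace E M]

/-- The smooth real manifold underlying a complex manifold. -/
instance realManifold [IsManifold 𝓘(ℂ, E) ω M] : IsManifold 𝓘(ℝ, E) ∞ M := by
  apply isManifold_of_contDiffOn
  intro e e' he he'
  have h := (contDiffGroupoid ω 𝓘(ℂ, E)).compatible he he'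
  rw [contDiffGroupoid, mem_groupoid_of_pregroupoid] at h
  have h1 := h.1
  simp only [contDiffPregroupoid] at h1
  exact (h1.restrict_scalars ℝ).of_le (by simp)

/-- The complex structure `I` of a complex manifold on its real tangent spaces. -/
def cplx (p : M) : TangentSpace 𝓘(ℝ, E) p →ₗ[ℝ] TangentSpace 𝓘(ℝ, E) p where
  toFun a := (Complex.I • (show E from a) : E)
  map_add' a b := smul_add Complex.I (show E from a) (show E from b)
  map_smul' r a := smul_comm Complex.I r (show E from a)

/-- The space of `(1,0)`-vectors, `T^{1,0}_p M ⊂ T_p M ⊗ ℂ`. -/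
def T10 (p : M) : Submodule ℂ (Cx (TangentSpace 𝓘(ℝ, E) p)) :=
  LinearMap.ker (Cx.map (cplx E p) - Complex.I • LinearMap.id)

/-- The projection `π^{1,0} = (Id - i I) / 2`, restricted to real tangent vectors. -/
def proj10 (p : M) (a : TangentSpace 𝓘(ℝ, E) p) : Cx (TangentSpace 𝓘(ℝ, E) p) :=
  ⟨(1 / 2 : ℝ) • a, -((1 / 2 : ℝ) • cplx E p a)⟩

end ComplexManifold

/-! ### Algebraic integrable systems -/

section IntegrableSystem

variable {F : Type*} [NormedAddCommGroup F] [NormedSpace ℝ F] {H : Type*} [TopologicalSpace H]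
  (J : ModelWithCorners ℝ F H) {X : Type*} [TopologicalSpace X] [ChartedSpace H X]
  [IsManifold J ∞ X]
  (E : Type*) [NormedAddCommGroup E] [NormedSpace ℂ E]
  {M : Type*} [TopologicalSpace M] [ChartedSpace E M] [IsManifold 𝓘(ℂ, E) ω M]

/-- The vertical spaces of `π : X → M`. -/
def vert (π : X → M) (x : X) : Submodule ℝ (TangentSpace J x) :=
  LinearMap.ker (mfderiv J 𝓘(ℝ, E) π x : TangentSpace J x →ₗ[ℝ] TangentSpace 𝓘(ℝ, E) (π x))

/-- The restrictions of the 2-forms `σ` and `ρ` to the fibre over `p` have the same de Rham class: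
they differ there by the differential of a 1-form. (Every smooth 1-form on a compact fibre is the
restriction of a smooth 1-form on `X`.) -/
def SameClassOnFibre (π : X → M) (p : M)
    (s r : Π x : X, TangentSpace J x →ₗ[ℝ] TangentSpace J x →ₗ[ℝ] ℝ) : Prop :=
  ∃ b : Π x : X, TangentSpace J x →ₗ[ℝ] ℝ, IsSmoothForm J b ∧
    ∀ U : Set X, IsOpen U → ∀ A B : Π x : X, TangentSpace J x,
      SmoothFieldOn J A U → SmoothFieldOn J B U →
      (∀ x ∈ U, A x ∈ vert J E π x) → (∀ x ∈ U, B x ∈ vert J E π x) →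
      ∀ x ∈ U, π x = p → s x (A x) (B x) - r x (A x) (B x) = extDerivOne J b A B x

/-- The restriction of the 2-form `ρ` to the fibre of `π` over `p`, a torus, has integral periods.
As `H₂` of a torus is generated by the images of 2-tori, it is enough to consider the periods over
smooth maps from `ℝ²/ℤ²` to the fibre. -/
def IsIntegralOnFibre (π : X → M) (p : M)
    (r : Π x : X, TangentSpace J x →ₗ[ℝ] TangentSpace J x →ₗ[ℝ] ℝ) : Prop :=
  ∀ f : ℝ × ℝ → X, ContMDiff 𝓘(ℝ, ℝ × ℝ) J ∞ f → (∀ z, π (f z) = p) →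
    (∀ s t, f (s + 1, t) = f (s, t)) → (∀ s t, f (s, t + 1) = f (s, t)) →
    ∃ k : ℤ, ∫ s in (0 : ℝ)..1, ∫ t in (0 : ℝ)..1,
      r (f (s, t)) (mfderiv 𝓘(ℝ, ℝ × ℝ) J f (s, t) ((1, 0) : ℝ × ℝ))
        (mfderiv 𝓘(ℝ, ℝ × ℝ) J f (s, t) ((0, 1) : ℝ × ℝ)) = k

/-- An algebraic integrable system with projection `π : X → M`, where `M` is a complex manifold. -/
structure AlgebraicIntegrableSystem (π : X → M) where
  /-- The complex structure of `X`. -/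
  I : Π x : X, TangentSpace J x →ₗ[ℝ] TangentSpace J x
  complex : IsComplexStructure J I
  /-- `π` is a holomorphic submersion. -/
  smooth_proj : ContMDiff J 𝓘(ℝ, E) ∞ π
  submersion : ∀ x, Function.Surjective (mfderiv J 𝓘(ℝ, E) π x)
  holomorphic : ∀ x a, mfderiv J 𝓘(ℝ, E) π x (I x a) = cplx E (π x) (mfderiv J 𝓘(ℝ, E) π x a)
  /-- The holomorphic symplectic form: a closed non-degenerate form of type `(2,0)`. -/
  Ω : Π x : X, TangentSpace J x →ₗ[ℝ] TangentSpace J x →ₗ[ℝ] ℂ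
  Ω_smooth : IsSmoothBilin J Ω
  Ω_alt : ∀ x a, Ω x a a = 0
  Ω_type : ∀ x a b, Ω x (I x a) b = Complex.I * Ω x a b
  Ω_closed : IsClosedTwoForm J Ω
  Ω_nondegenerate : ∀ x a, (∀ b, Ω x a b = 0) → a = 0
  /-- The fibres are compact, connected and Lagrangian, hence they are tori. -/
  fibre_compact : ∀ p, IsCompact (π ⁻¹' {p})
  fibre_connected : ∀ p, IsConnected (π ⁻¹' {p})
  fibre_lagrangian : ∀ x a, a ∈ vert J E π x ↔ ∀ b ∈ vert J E π x, Ω x a b = 0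
  /-- A smooth 2-form whose restrictions to the fibres represent the polarizations: these
  restrictions are closed, of type `(1,1)`, non-degenerate and have integral class. -/
  ρ : Π x : X, TangentSpace J x →ₗ[ℝ] TangentSpace J x →ₗ[ℝ] ℝ
  ρ_smooth : IsSmoothBilin J ρ
  ρ_alt : ∀ x a, ρ x a a = 0
  ρ_closed : IsClosedAlong J (vert J E π) ρ
  ρ_type : ∀ x, ∀ a ∈ vert J E π x, ∀ b ∈ vert J E π x, ρ x (I x a) (I x b) = ρ x a b
  ρ_nondegenerate : ∀ x, ∀ a ∈ vert J E π x, (∀ b ∈ vert J E π x, ρ x a b = 0) → a = 0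
  ρ_integral : ∀ p, IsIntegralOnFibre J π p ρ

variable {J E} in
/-- Compatibility of a hyperkähler structure and an algebraic integrable system on `X`. -/
structure AlgebraicIntegrableSystem.IsCompatible {π : X → M}
    (L : AlgebraicIntegrableSystem J E π) (S : Hyperkahler J X) : Prop where
  complex_eq : ∀ x a, L.I x a = S.I₃ x a
  symplectic_eq : ∀ x a b, L.Ω x a b = (S.ω₁ x a b : ℂ) + Complex.I * (S.ω₂ x a b : ℂ)
  polarization_eq : ∀ p, SameClassOnFibre J E π p S.ω₃ L.ρ

end IntegrableSystem

/-! ### Special period structures -/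

section Period

variable (E : Type*) [NormedAddCommGroup E] [NormedSpace ℂ E]
  (M : Type*) [TopologicalSpace M] [ChartedSpace E M] [IsManifold 𝓘(ℂ, E) ω M]

/-- The indices of a Darboux frame `(γ_i, γ^i)`: `inl i` stands for `γ_i` and `inr i` for `γ^i`. -/
abbrev FrameIdx : Type := Fin (Module.finrank ℂ E) ⊕ Fin (Module.finrank ℂ E)

/-- The integral skew pairing of the members of a Darboux frame. -/
def darboux : FrameIdx E → FrameIdx E → ℤ
  | .inl i, .inr j => if i = j then 1 else 0
  | .inr i, .inl j => if i = j then -1 else 0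
  | .inl _, .inl _ => 0
  | .inr _, .inr _ => 0

variable {E M} in
/-- The sections `γ` form a Darboux frame of `Γ` over the open set `U`: they are smooth sections of
`TM` with values in `Γ`, they are a `ℤ`-basis of `Γ_q` and an `ℝ`-basis of `T_q M` for `q ∈ U`, and
the pairing takes the standard form. -/
structure IsDarbouxFrame (Γ : Π p : M, AddSubgroup (TangentSpace 𝓘(ℝ, E) p))
    (pairing : Π p : M, Γ p →+ Γ p →+ ℤ) (U : Set M) (γ : FrameIdx E → Π q : M, Γ q) : Prop where
  isOpen : IsOpen U
  isFrame : IsLocalFrameOn 𝓘(ℝ, E) E ∞ (fun a q => (γ a q : TangentSpace 𝓘(ℝ, E) q)) U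
  span : ∀ q ∈ U, AddSubgroup.closure
    (Set.range fun a => (γ a q : TangentSpace 𝓘(ℝ, E) q)) = Γ q
  pairing_eq : ∀ q ∈ U, ∀ a b, pairing q (γ a q) (γ b q) = darboux E a b

/-- A period structure `(M, Γ, Z)` for which `Γ ⊂ TM` is a bundle of lattices of full rank which
has local Darboux frames. -/
structure LatticePeriodStructure where
  /-- The bundle of lattices. -/
  Γ : Π p : M, AddSubgroup (TangentSpace 𝓘(ℝ, E) p)
  /-- The integral skew pairing. -/
  pairing : Π p : M, Γ p →+ Γ p →+ ℤ
  pairing_skew : ∀ p a b, pairing p a b = -pairing p b a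
  exists_frame : ∀ p : M, ∃ (U : Set M) (γ : FrameIdx E → Π q : M, Γ q),
    p ∈ U ∧ IsDarbouxFrame Γ pairing U γ
  /-- The section of `Hom(Γ, ℂ)`, which is holomorphic. -/
  Z : Π p : M, Γ p →+ ℂ
  holomorphic : ∀ U : Set M, IsOpen U → ∀ γ : Π q : M, Γ q,
    ContMDiffOn 𝓘(ℝ, E) 𝓘(ℝ, E).tangent ∞
      (fun q => (⟨q, (γ q : TangentSpace 𝓘(ℝ, E) q)⟩ : TangentBundle 𝓘(ℝ, E) M)) U →
    MDifferentiableOn 𝓘(ℂ, E) 𝓘(ℂ, ℂ) (fun q => Z q (γ q)) U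

namespace LatticePeriodStructure

variable {E M} (P : LatticePeriodStructure E M)

/-- The domain of a Darboux frame around `p`. -/
def frameDom (p : M) : Set M := (P.exists_frame p).choose

/-- A Darboux frame around `p`. -/
def frame (p : M) : FrameIdx E → Π q : M, P.Γ q := (P.exists_frame p).choose_spec.choose

theorem mem_frameDom (p : M) : p ∈ P.frameDom p := (P.exists_frame p).choose_spec.choose_spec.1

theorem isDarbouxFrame (p : M) : IsDarbouxFrame P.Γ P.pairing (P.frameDom p) (P.frame p) :=
  (P.exists_frame p).choose_spec.choose_spec.2

/-- The members of the Darboux frame around `p`, as vector fields. -/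
def frameField (p : M) (a : FrameIdx E) (q : M) : TangentSpace 𝓘(ℝ, E) q := P.frame p a q

/-- The dual frame: the coefficients of tangent vectors at `q` in the Darboux frame around `p`. -/
def coeff (p : M) (a : FrameIdx E) (q : M) : TangentSpace 𝓘(ℝ, E) q →ₗ[ℝ] ℝ :=
  (P.isDarbouxFrame p).isFrame.coeff a q

/-- The 2-form `ω` induced by the pairing, that is, `ω = δ^i ∧ δ_i` for the frame `(δ^i, δ_i)` dual
to a Darboux frame `(γ_i, γ^i)`. -/
def omega (p : M) : TangentSpace 𝓘(ℝ, E) p →ₗ[ℝ] TangentSpace 𝓘(ℝ, E) p →ₗ[ℝ] ℝ :=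
  ∑ i, ((P.coeff p (.inl i) p).smulRight (P.coeff p (.inr i) p)
    - (P.coeff p (.inr i) p).smulRight (P.coeff p (.inl i) p))

/-- The flat connection `∇` for which the local sections of `Γ` are flat: `(∇_a σ)(p)`. -/
def nabla (σ : Π q : M, TangentSpace 𝓘(ℝ, E) q) (p : M) (a : TangentSpace 𝓘(ℝ, E) p) :
    TangentSpace 𝓘(ℝ, E) p :=
  ∑ c, dirDeriv 𝓘(ℝ, E) (fun q => P.coeff p c q (σ q)) p a • P.frameField p c p

/-- The flat connection `∇` on complex vector fields. -/
def nablaCx (ξ : Π q : M, Cx (TangentSpace 𝓘(ℝ, E) q)) (p : M) (a : TangentSpace 𝓘(ℝ, E) p) :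
    Cx (TangentSpace 𝓘(ℝ, E) p) :=
  ⟨P.nabla (fun q => (ξ q).re) p a, P.nabla (fun q => (ξ q).im) p a⟩

/-- The complex vector field `ξ` is the one with `Z / 2 = ω(ξ, -)`. -/
def IsXi (ξ : Π q : M, Cx (TangentSpace 𝓘(ℝ, E) q)) : Prop :=
  ∀ q (γ : P.Γ q), (1 / 2 : ℂ) * P.Z q γ
    = (P.omega q (ξ q).re γ : ℂ) + Complex.I * (P.omega q (ξ q).im γ : ℂ)

end LatticePeriodStructure

/-- A special period structure. -/
structure SpecialPeriodStructure extends LatticePeriodStructure E M where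
  omega_cplx : ∀ p a b, toLatticePeriodStructure.omega p (cplx E p a) (cplx E p b)
    = toLatticePeriodStructure.omega p a b
  nabla_xi : ∃ ξ : Π q : M, Cx (TangentSpace 𝓘(ℝ, E) q), toLatticePeriodStructure.IsXi ξ ∧
    ∀ p a, toLatticePeriodStructure.nablaCx ξ p a = proj10 E p a

end Period

/-! ### Special Joyce structures -/

section Joyce

variable {E : Type*} [NormedAddCommGroup E] [NormedSpace ℂ E]
  {M : Type*} [TopologicalSpace M] [ChartedSpace E M] [IsManifold 𝓘(ℂ, E) ω M]

variable (E M) in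
/-- The real tangent bundle `N = TM` of the complex manifold `M`. -/
abbrev TB : Type _ := TangentBundle 𝓘(ℝ, E) M

/-- The tangent space `T_V N` of the manifold `N = TM`. -/
abbrev TN (V : TB E M) : Type _ := TangentSpace 𝓘(ℝ, E).tangent V

/-- The differential of the projection `N = TM → M`. -/
def dproj (V : TB E M) : TN V →ₗ[ℝ] TangentSpace 𝓘(ℝ, E) V.proj :=
  (mfderiv 𝓘(ℝ, E).tangent 𝓘(ℝ, E) (fun W : TB E M => W.proj) V :
    TN V →L[ℝ] TangentSpace 𝓘(ℝ, E) V.proj)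

/-- The inclusion of the fibre `T_p M` into `N`. -/
abbrev fibreIncl (p : M) (u : TangentSpace 𝓘(ℝ, E) p) : TB E M := ⟨p, u⟩

/-- The canonical identification `ν : T_p M → T_V (T_p M) ⊂ T_V N`, where `V ∈ T_p M`: the
differential at `V` of the inclusion of the fibre, `ν_W = d/dt (V + t W)` at `t = 0`. -/
def nu (V : TB E M) : TangentSpace 𝓘(ℝ, E) V.proj →ₗ[ℝ] TN V where
  toFun a := mfderiv 𝓘(ℝ, E) 𝓘(ℝ, E).tangent (fun u : E => fibreIncl V.proj u) (show E from V.2) a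
  map_add' a b := map_add
    (mfderiv 𝓘(ℝ, E) 𝓘(ℝ, E).tangent (fun u : E => fibreIncl V.proj u) (show E from V.2)) a b
  map_smul' r a := map_smul
    (mfderiv 𝓘(ℝ, E) 𝓘(ℝ, E).tangent (fun u : E => fibreIncl V.proj u) (show E from V.2)) r a

/-- The derivative of a complex function on `N` along a complex tangent vector. -/
def cxDeriv (f : TB E M → ℂ) (V : TB E M) (w : Cx (TN V)) : ℂ :=
  dirDeriv 𝓘(ℝ, E).tangent f V w.re + Complex.I * dirDeriv 𝓘(ℝ, E).tangent f V w.im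

namespace LatticePeriodStructure

variable (P : LatticePeriodStructure E M)

/-- The `∇`-flat extension of the tangent vector `V` to a vector field near its base point. -/
def flatExt (V : TB E M) (q : M) : TangentSpace 𝓘(ℝ, E) q :=
  ∑ c, P.coeff V.proj c V.proj V.2 • P.frameField V.proj c q

/-- The flat Ehresmann connection `H` on `TM → M` given by the parallel transport of `∇`: the
horizontal lift of a vector at the base point of `V` is its image under the differential of the
flat section through `V`. -/
def horiz (V : TB E M) : TangentSpace 𝓘(ℝ, E) V.proj →ₗ[ℝ] TN V where
  toFun a := mfderiv 𝓘(ℝ, E) 𝓘(ℝ, E).tangent (fun q => (⟨q, P.flatExt V q⟩ : TB E M)) V.proj a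
  map_add' a b := map_add
    (mfderiv 𝓘(ℝ, E) 𝓘(ℝ, E).tangent (fun q => (⟨q, P.flatExt V q⟩ : TB E M)) V.proj) a b
  map_smul' r a := map_smul
    (mfderiv 𝓘(ℝ, E) 𝓘(ℝ, E).tangent (fun q => (⟨q, P.flatExt V q⟩ : TB E M)) V.proj) r a

/-- The symplectic structure `ω^ν` on the vertical bundle of `N`. -/
def omegaNu (V : TB E M) (a b : TN V) : ℝ :=
  P.omega V.proj (Function.invFun (nu V) a) (Function.invFun (nu V) b)

/-- The Hamiltonian vector of `f : T_p M → ℂ` at `V ∈ T_p M`: the complex vertical vector `Ham_f`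
with `df(V)(W) = ω^ν(ν_W, Ham_f)` for all `W ∈ T_p M`. -/
def ham (V : TB E M) (f : TangentSpace 𝓘(ℝ, E) V.proj → ℂ) : Cx (TN V) :=
  Cx.map (nu V) (Classical.epsilon fun U : Cx (TangentSpace 𝓘(ℝ, E) V.proj) =>
    ∀ W, fderiv ℝ f V.2 W
      = (P.omega V.proj W U.re : ℂ) + Complex.I * (P.omega V.proj W U.im : ℂ))

end LatticePeriodStructure

variable (P : SpecialPeriodStructure E M)

/-- An almost special Joyce structure over the affine special Kähler manifold defined by a special
period structure, given by the coefficients `h` and `v` of the family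
`A^ζ_X = h_X - ζ⁻¹ conj(v_X)`, `A^ζ_{conj X} = conj(h_X) + ζ v_X` of complexified Ehresmann
connections. -/
structure AlmostSpecialJoyceStructure where
  h : Π V : TB E M, T10 E V.proj →ₗ[ℂ] Cx (TN V)
  v : Π V : TB E M, T10 E V.proj →ₛₗ[starRingEnd ℂ] Cx (TN V)
  dproj_h : ∀ V (X : T10 E V.proj), Cx.map (dproj V) (h V X) = X
  dproj_v : ∀ V (X : T10 E V.proj), Cx.map (dproj V) (v V X) = 0
  /-- `T_V N ⊗ ℂ` is the direct sum of the images of `h`, `conj h`, `v` and `conj v`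
  (by a count of dimensions these maps are then injective). -/
  nondegenerate : ∀ V (w : Cx (TN V)), ∃! q : (T10 E V.proj × T10 E V.proj) ×
      (T10 E V.proj × T10 E V.proj),
    w = h V q.1.1 + Cx.conj (h V q.1.2) + v V q.2.1 + Cx.conj (v V q.2.2)
  /-- `h_X = H_X + Ham_{H_X J}` and `v_X = 2πi (ν_{conj X} + Ham_{ν_{conj X} J})`. -/
  exists_J : ∃ J : TB E M → ℂ, ContMDiff 𝓘(ℝ, E).tangent 𝓘(ℝ, ℂ) ∞ J ∧
    (∀ V (X : T10 E V.proj), h V X = Cx.map (P.horiz V) X.1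
      + P.ham V fun u => cxDeriv J (fibreIncl V.proj u)
          (Cx.map (P.horiz (fibreIncl V.proj u)) X.1)) ∧
    ∀ V (X : T10 E V.proj), v V X = (2 * Real.pi * Complex.I : ℂ) •
      (Cx.map (nu V) (Cx.conj X.1)
        + P.ham V fun u => cxDeriv J (fibreIncl V.proj u)
            (Cx.map (nu (fibreIncl V.proj u)) (Cx.conj X.1)))

namespace AlmostSpecialJoyceStructure

variable {P} (A : AlmostSpecialJoyceStructure P)

/-- `A^ζ_X` for `X ∈ T^{1,0}M`; for `ζ = 0` this means `(ζ A^ζ_X)|_{ζ = 0} = -conj(v_X)`. -/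
def conn10 (ζ : ℂ) (V : TB E M) : T10 E V.proj →ₗ[ℂ] Cx (TN V) :=
  if ζ = 0 then -Cx.conj.comp (A.v V) else A.h V - ζ⁻¹ • Cx.conj.comp (A.v V)

/-- `A^ζ_{conj X}` for `X ∈ T^{1,0}M`, as an antilinear map of `X`. -/
def conn01 (ζ : ℂ) (V : TB E M) : T10 E V.proj →ₛₗ[starRingEnd ℂ] Cx (TN V) :=
  Cx.conj.comp (A.h V) + ζ • A.v V

/-- The image of `A^ζ`. -/
def im (ζ : ℂ) (V : TB E M) : Submodule ℂ (Cx (TN V)) :=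
  LinearMap.range (A.conn10 ζ V) ⊔ LinearMap.range (A.conn01 ζ V)

/-- The almost complex structure `I_ζ` of `N` whose `(-i)`-eigenspace is the image of `A^ζ`. -/
def acs (ζ : ℂ) (V : TB E M) : TN V →ₗ[ℝ] TN V :=
  Classical.epsilon fun I : TN V →ₗ[ℝ] TN V => negEigenspace I = A.im ζ V

/-- `I₁ = I_ζ` for `ζ = i`. -/
def I₁ (V : TB E M) : TN V →ₗ[ℝ] TN V := A.acs Complex.I V

/-- `I₂ = I_ζ` for `ζ = -1`. -/
def I₂ (V : TB E M) : TN V →ₗ[ℝ] TN V := A.acs (-1) V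

/-- `I₃ = I_ζ` for `ζ = 0`. -/
def I₃ (V : TB E M) : TN V →ₗ[ℝ] TN V := A.acs 0 V

/-- The conditions which determine the real 2-form `ω₃` on `T_V N`:
`ω₃(v_X, conj v_Y) = ω₃(h_Y, conj h_X) = -ω^ν(v_X, conj v_Y) / 4π²`, and all other pairings of the
images of `h`, `conj h`, `v`, `conj v` are zero. -/
structure IsOmega₃ (V : TB E M) (s : TN V →ₗ[ℝ] TN V →ₗ[ℝ] ℝ) : Prop where
  alt : ∀ a, s a a = 0
  v_conj_v : ∀ X Y, Cx.bilin (s · ·) (A.v V X) (Cx.conj (A.v V Y))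
    = -(1 / (4 * Real.pi ^ 2) : ℂ) * Cx.bilin (P.omegaNu V) (A.v V X) (Cx.conj (A.v V Y))
  h_conj_h : ∀ X Y, Cx.bilin (s · ·) (A.h V Y) (Cx.conj (A.h V X))
    = -(1 / (4 * Real.pi ^ 2) : ℂ) * Cx.bilin (P.omegaNu V) (A.v V X) (Cx.conj (A.v V Y))
  h_h : ∀ X Y, Cx.bilin (s · ·) (A.h V X) (A.h V Y) = 0
  v_v : ∀ X Y, Cx.bilin (s · ·) (A.v V X) (A.v V Y) = 0
  h_v : ∀ X Y, Cx.bilin (s · ·) (A.h V X) (A.v V Y) = 0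
  h_conj_v : ∀ X Y, Cx.bilin (s · ·) (A.h V X) (Cx.conj (A.v V Y)) = 0

/-- The 2-form `ω₃` on `N`. -/
def ω₃ (V : TB E M) : TN V →ₗ[ℝ] TN V →ₗ[ℝ] ℝ := Classical.epsilon (A.IsOmega₃ V)

/-- The metric `g = ω₃(-, I₃ -)` on `N`. -/
def g (V : TB E M) (a b : TN V) : ℝ := A.ω₃ V a (A.I₃ V b)

end AlmostSpecialJoyceStructure

/-- A special Joyce structure: the connections `A^ζ` are flat for all `ζ ≠ 0`, and the symplectic
structure `ω^ν` on the vertical bundle is of type `(1,1)` with respect to `I₃`. -/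
structure SpecialJoyceStructure extends AlmostSpecialJoyceStructure P where
  flat : ∀ ζ : ℂ, ζ ≠ 0 →
    IsInvolutive 𝓘(ℝ, E).tangent (fun V => toAlmostSpecialJoyceStructure.im ζ V)
  type11 : ∀ V a b, dproj V a = 0 → dproj V b = 0 →
    P.omegaNu V (toAlmostSpecialJoyceStructure.I₃ V a) (toAlmostSpecialJoyceStructure.I₃ V b)
      = P.omegaNu V a b

/-- The fibrewise translation of `TM` by `2π γ`, for a section `γ` of `Γ`. -/
def LatticePeriodStructure.translate (P : LatticePeriodStructure E M) (γ : Π q : M, P.Γ q)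
    (V : TB E M) : TB E M :=
  ⟨V.proj, V.2 + (2 * Real.pi) • (γ V.proj : TangentSpace 𝓘(ℝ, E) V.proj)⟩

variable {P} in
/-- Compatibility of the special Joyce structure with the period structure: the hyperkähler
structure on `TM` is invariant under the fibrewise translations by the smooth local sections of
`2π Γ`. -/
def SpecialJoyceStructure.IsCompatible (A : SpecialJoyceStructure P) : Prop :=
  ∀ U : Set M, IsOpen U → ∀ γ : Π q : M, P.Γ q,
    SmoothFieldOn 𝓘(ℝ, E) (fun q => (γ q : TangentSpace 𝓘(ℝ, E) q)) U →
    ∀ V : TB E M, V.proj ∈ U →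
      let T : TB E M → TB E M := P.translate γ
      let dT : TN V →L[ℝ] TN (T V) := mfderiv 𝓘(ℝ, E).tangent 𝓘(ℝ, E).tangent T V
      (∀ a, A.I₁ (T V) (dT a) = dT (A.I₁ V a)) ∧ (∀ a, A.I₂ (T V) (dT a) = dT (A.I₂ V a)) ∧
      (∀ a, A.I₃ (T V) (dT a) = dT (A.I₃ V a)) ∧ ∀ a b, A.g (T V) (dT a) (dT b) = A.g V a b

namespace LatticePeriodStructure

variable (P : LatticePeriodStructure E M)

theorem translate_smooth {γ : Π q : M, P.Γ q} {U : Set M}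
    (hγ : SmoothFieldOn 𝓘(ℝ, E) (fun q => (γ q : TangentSpace 𝓘(ℝ, E) q)) U) (hU : IsOpen U)
    {V : TB E M} (hV : V.proj ∈ U) :
    ContMDiffAt 𝓘(ℝ, E).tangent 𝓘(ℝ, E).tangent ∞ (P.translate γ) V := by
  set e := trivializationAt E (TangentSpace 𝓘(ℝ, E)) V.proj with he
  have hp : ContMDiffAt 𝓘(ℝ, E).tangent 𝓘(ℝ, E) ∞ (fun W : TB E M => W.proj) V :=
    Bundle.contMDiff_proj (TangentSpace 𝓘(ℝ, E)) V
  have h1 : ContMDiffAt 𝓘(ℝ, E).tangent 𝓘(ℝ, E) ∞ (fun W : TB E M => (e W).2) V :=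
    (Bundle.contMDiffAt_totalSpace.1 (contMDiffAt_id (x := V))).2
  have h2 : ContMDiffAt 𝓘(ℝ, E) 𝓘(ℝ, E) ∞
      (fun q => (e ⟨q, (γ q : TangentSpace 𝓘(ℝ, E) q)⟩).2) V.proj :=
    (Bundle.contMDiffAt_totalSpace.1 ((hγ V.proj hV).contMDiffAt (hU.mem_nhds hV))).2
  refine Bundle.contMDiffAt_totalSpace.2 ⟨hp, ?_⟩
  have hc : ContMDiffAt 𝓘(ℝ, E).tangent 𝓘(ℝ, ℝ) ∞ (fun _ : TB E M => 2 * Real.pi) V :=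
    contMDiffAt_const
  have h3 := h1.add (hc.smul (h2.comp V hp))
  refine h3.congr_of_eventuallyEq ?_
  have hb : ∀ᶠ W : TB E M in 𝓝 V, W.proj ∈ e.baseSet :=
    hp.continuousAt.eventually (e.open_baseSet.mem_nhds
      (FiberBundle.mem_baseSet_trivializationAt' V.proj))
  filter_upwards [hb] with W hW
  have hl := e.linear ℝ hW
  show (e ⟨W.proj, W.2 + (2 * Real.pi) • (γ W.proj : TangentSpace 𝓘(ℝ, E) W.proj)⟩).2 = _
  rw [hl.map_add, hl.map_smul]
  rfl

/-- Two points of `TM` are equivalent if they differ by an element of `2π Γ`. -/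
def setoid : Setoid (TB E M) where
  r V W := ∃ γ : P.Γ V.proj, W = ⟨V.proj, V.2 + (2 * Real.pi) • (γ : TangentSpace 𝓘(ℝ, E) V.proj)⟩
  iseqv :=
    { refl := fun V => ⟨0, by simp⟩
      symm := by
        rintro V W ⟨γ, rfl⟩
        exact ⟨-γ, by simp⟩
      trans := by
        rintro V W T ⟨γ, rfl⟩ ⟨δ, rfl⟩
        exact ⟨γ + δ, by simp [add_assoc]⟩ }

/-- The quotient `X = TM / 2π Γ`. -/
def X : Type _ := Quotient P.setoid

/-- The quotient map `TM → X`. -/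
def quot (V : TB E M) : P.X := Quotient.mk P.setoid V

/-- The projection `π : X → M`. -/
def proj : P.X → M :=
  Quotient.lift (fun V : TB E M => V.proj) (by rintro V W ⟨γ, rfl⟩; rfl)

/-- The quotient topology. -/
instance : TopologicalSpace P.X := inferInstanceAs (TopologicalSpace (Quotient P.setoid))

theorem quot_surjective : Function.Surjective P.quot := Quotient.mk_surjective

theorem quot_translate (γ : Π q : M, P.Γ q) (V : TB E M) : P.quot (P.translate γ V) = P.quot V :=
  (Quotient.sound (s := P.setoid) ⟨γ V.proj, rfl⟩).symm

theorem exists_of_quot_eq {V W : TB E M} (h : P.quot V = P.quot W) :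
    ∃ γ : P.Γ V.proj, W = ⟨V.proj, V.2 + (2 * Real.pi) • (γ : TangentSpace 𝓘(ℝ, E) V.proj)⟩ :=
  Quotient.exact (s := P.setoid) h

/-- Elements of `Γ` extend to smooth local sections. -/
theorem exists_section (p : M) (γ₀ : P.Γ p) : ∃ γ : Π q : M, P.Γ q, γ p = γ₀ ∧
    SmoothFieldOn 𝓘(ℝ, E) (fun q => (γ q : TangentSpace 𝓘(ℝ, E) q)) (P.frameDom p) := by
  have hF := P.isDarbouxFrame p
  suffices H : ∀ x ∈ AddSubgroup.closure (Set.range fun a =>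
      (P.frame p a p : TangentSpace 𝓘(ℝ, E) p)), ∃ γ : Π q : M, P.Γ q,
      (γ p : TangentSpace 𝓘(ℝ, E) p) = x ∧
      SmoothFieldOn 𝓘(ℝ, E) (fun q => (γ q : TangentSpace 𝓘(ℝ, E) q)) (P.frameDom p) by
    obtain ⟨γ, h1, h2⟩ := H γ₀ (by rw [hF.span p (P.mem_frameDom p)]; exact γ₀.2)
    exact ⟨γ, Subtype.ext h1, h2⟩
  intro x hx
  induction hx using AddSubgroup.closure_induction with
  | mem x hx =>
    obtain ⟨a, rfl⟩ := hx
    exact ⟨P.frame p a, rfl, hF.isFrame.contMDiffOn a⟩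
  | zero =>
    exact ⟨fun _ => 0, rfl, (Bundle.contMDiff_zeroSection ℝ (TangentSpace 𝓘(ℝ, E))).contMDiffOn⟩
  | add x y _ _ hx hy =>
    obtain ⟨γ, rfl, h1⟩ := hx
    obtain ⟨δ, rfl, h2⟩ := hy
    exact ⟨fun q => γ q + δ q, rfl, ContMDiffOn.add_section h1 h2⟩
  | neg x _ hx =>
    obtain ⟨γ, rfl, h1⟩ := hx
    exact ⟨fun q => -γ q, rfl, ContMDiffOn.neg_section h1⟩

theorem continuous_quot : Continuous P.quot := continuous_quotient_mk'

theorem isOpenMap_quot : IsOpenMap P.quot := by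
  intro W hW
  have hq : IsOpen (P.quot ⁻¹' (P.quot '' W)) := by
    rw [isOpen_iff_mem_nhds]
    rintro V ⟨T, hT, hTV⟩
    obtain ⟨γ₀, h0⟩ := P.exists_of_quot_eq hTV.symm
    obtain ⟨γ, h1, h2⟩ := P.exists_section V.proj γ₀
    have hc := (P.translate_smooth h2 (P.isDarbouxFrame V.proj).isOpen
      (P.mem_frameDom V.proj)).continuousAt
    have hTt : P.translate γ V = T := by rw [h0, translate, h1]
    filter_upwards [hc (hW.mem_nhds (by rw [hTt]; exact hT))] with V' hV'
    exact ⟨_, hV', P.quot_translate γ V'⟩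
  exact hq

/-- The coefficients of lattice vectors in a Darboux frame are integers. -/
theorem coeff_int (p q : M) (hq : q ∈ P.frameDom p) (γ : P.Γ q) (a : FrameIdx E) :
    ∃ m : ℤ, P.coeff p a q γ = m := by
  have hF := P.isDarbouxFrame p
  suffices H : ∀ x ∈ AddSubgroup.closure (Set.range fun a =>
      (P.frame p a q : TangentSpace 𝓘(ℝ, E) q)), ∃ m : ℤ, P.coeff p a q x = m from
    H γ (by rw [hF.span q hq]; exact γ.2)
  intro x hx
  induction hx using AddSubgroup.closure_induction with
  | mem x hx =>
    obtain ⟨b, rfl⟩ := hx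
    have h := hF.isFrame.toBasisAt_coe hq b
    refine ⟨if b = a then 1 else 0, ?_⟩
    have h' := (hF.isFrame.toBasisAt hq).repr_self b
    rw [h] at h'
    simp only [coeff, IsLocalFrameOn.coeff, hq, dif_pos, Module.Basis.coord_apply, h',
      Finsupp.single_apply]
    split_ifs <;> simp
  | zero => exact ⟨0, by simp⟩
  | add x y _ _ hx hy =>
    obtain ⟨m, h1⟩ := hx
    obtain ⟨k, h2⟩ := hy
    exact ⟨m + k, by simp [h1, h2]⟩
  | neg x _ hx =>
    obtain ⟨m, h1⟩ := hx
    exact ⟨-m, by simp [h1]⟩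

variable [FiniteDimensional ℂ E]

/-- The coefficients in a Darboux frame are continuous functions on `TM`. -/
theorem continuousAt_coeff (V : TB E M) :
    ContinuousAt (fun W : TB E M => fun a => P.coeff V.proj a W.proj W.2) V := by
  have : CompleteSpace E := FiniteDimensional.complete ℝ E
  set p := V.proj with hp
  have hF := P.isDarbouxFrame p
  set e := trivializationAt E (TangentSpace 𝓘(ℝ, E)) p with he
  have hpb : p ∈ e.baseSet := FiberBundle.mem_baseSet_trivializationAt' p
  have hpU : p ∈ P.frameDom p := P.mem_frameDom p
  let L : M → ((FrameIdx E → ℝ) →L[ℝ] E) := fun q =>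
    ∑ a, (ContinuousLinearMap.proj a : (FrameIdx E → ℝ) →L[ℝ] ℝ).smulRight
      ((e ⟨q, P.frameField p a q⟩).2)
  have hL : ContinuousAt L p := by
    refine tendsto_finsetSum _ fun a _ => ?_
    have h2 : ContMDiffAt 𝓘(ℝ, E) 𝓘(ℝ, E) ∞ (fun q => (e ⟨q, P.frameField p a q⟩).2) p :=
      (Bundle.contMDiffAt_totalSpace.1 (hF.isFrame.contMDiffAt hF.isOpen hpU a)).2
    exact ((ContinuousLinearMap.smulRightL ℝ (FrameIdx E → ℝ) E
      (ContinuousLinearMap.proj a)).continuous.continuousAt).comp h2.continuousAt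
  have hequiv : ∀ q, q ∈ P.frameDom p → q ∈ e.baseSet → ∃ l : (FrameIdx E → ℝ) ≃L[ℝ] E,
      L q = l ∧ ∀ t : TangentSpace 𝓘(ℝ, E) q, l (fun a => P.coeff p a q t) = (e ⟨q, t⟩).2 := by
    intro q hq hqb
    let B := hF.isFrame.toBasisAt hq
    let l := (B.equivFun.symm.trans (e.linearEquivAt ℝ q hqb)).toContinuousLinearEquiv
    have key : ∀ t : TangentSpace 𝓘(ℝ, E) q, l (fun a => P.coeff p a q t) = (e ⟨q, t⟩).2 := by
      intro t
      have : (fun a => P.coeff p a q t) = B.equivFun t := by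
        ext a
        simp [coeff, IsLocalFrameOn.coeff, hq, B]
      rw [this]
      show (e.linearEquivAt ℝ q hqb) (B.equivFun.symm (B.equivFun t)) = _
      rw [LinearEquiv.symm_apply_apply]
      rfl
    refine ⟨l, ?_, key⟩
    refine ContinuousLinearMap.ext fun x => ?_
    show L q x = (e.linearEquivAt ℝ q hqb) (B.equivFun.symm x)
    rw [Module.Basis.equivFun_symm_apply, map_sum, sum_apply]
    refine Finset.sum_congr rfl fun a _ => ?_
    rw [map_smul, hF.isFrame.toBasisAt_coe hq a]
    rfl
  have hev : ∀ᶠ W : TB E M in 𝓝 V, W.proj ∈ P.frameDom p ∧ W.proj ∈ e.baseSet :=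
    (FiberBundle.continuous_proj E (TangentSpace 𝓘(ℝ, E))).continuousAt.eventually
      ((hF.isOpen.inter e.open_baseSet).mem_nhds ⟨hpU, hpb⟩)
  have h1 : ContinuousAt (fun W : TB E M => (e W).2) V :=
    (Bundle.contMDiffAt_totalSpace.1 (contMDiffAt_id (I := 𝓘(ℝ, E).tangent) (n := ∞)
      (x := V))).2.continuousAt
  obtain ⟨l, hl, -⟩ := hequiv p hpU hpb
  have h2 : ContinuousAt (fun W : TB E M => (L W.proj).inverse) V := by
    have h3 : ContinuousAt (ContinuousLinearMap.inverse (R := ℝ) (M := FrameIdx E → ℝ) (M₂ := E))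
        (L V.proj) := by
      rw [← hp, hl]
      exact (contDiffAt_map_inverse (n := 0) l).continuousAt
    exact ContinuousAt.comp (f := fun W : TB E M => L W.proj) h3 (ContinuousAt.comp (g := L) hL
      (FiberBundle.continuous_proj E (TangentSpace 𝓘(ℝ, E))).continuousAt)
  refine (h2.clm_apply h1).congr ?_
  filter_upwards [hev] with W hW
  obtain ⟨l', hl', hl''⟩ := hequiv W.proj hW.1 hW.2
  rw [hl', ContinuousLinearMap.inverse_equiv]
  exact (l'.symm_apply_eq).2 (hl'' W.2).symm

theorem exists_injOn_quot (V : TB E M) : ∃ W ∈ 𝓝 V, Set.InjOn P.quot W := by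
  have hF := P.isDarbouxFrame V.proj
  have hc := P.continuousAt_coeff V
  have h1 : ∀ᶠ W : TB E M in 𝓝 V, dist (fun a => P.coeff V.proj a W.proj W.2)
      (fun a => P.coeff V.proj a V.proj V.2) < 1 := hc (Metric.ball_mem_nhds _ one_pos)
  have h2 : ∀ᶠ W : TB E M in 𝓝 V, W.proj ∈ P.frameDom V.proj :=
    (FiberBundle.continuous_proj E (TangentSpace 𝓘(ℝ, E))).continuousAt.eventually
      (hF.isOpen.mem_nhds (P.mem_frameDom V.proj))
  refine ⟨_, h1.and h2, ?_⟩
  rintro W ⟨hW1, hW2⟩ T ⟨hT1, hT2⟩ hWT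
  obtain ⟨γ, rfl⟩ := P.exists_of_quot_eq hWT
  have hz : ∀ a, P.coeff V.proj a W.proj (γ : TangentSpace 𝓘(ℝ, E) W.proj) = 0 := by
    intro a
    obtain ⟨m, hm⟩ := P.coeff_int V.proj W.proj hW2 γ a
    have ha := (dist_le_pi_dist _ _ a).trans_lt hW1
    have hb := (dist_le_pi_dist _ _ a).trans_lt hT1
    simp only [map_add, map_smul, hm, Real.dist_eq, smul_eq_mul] at ha hb
    rw [abs_lt] at ha hb
    have hpi := Real.pi_gt_three
    have h3 : m < 1 := by
      have : (m : ℝ) < 1 := by nlinarith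
      exact_mod_cast this
    have h4 : -1 < m := by
      have : (-1 : ℝ) < m := by nlinarith
      exact_mod_cast this
    have h5 : m = 0 := by omega
    rw [hm, h5, Int.cast_zero]
  have h0 : (γ : TangentSpace 𝓘(ℝ, E) W.proj) = 0 := by
    refine (hF.isFrame.toBasisAt hW2).ext_elem fun a => ?_
    have := hz a
    simp only [coeff, IsLocalFrameOn.coeff, hW2, dif_pos, Module.Basis.coord_apply] at this
    simpa using this
  simp [h0]

theorem isLocalHomeomorph_quot : IsLocalHomeomorph P.quot := by
  rw [isLocalHomeomorph_iff_isOpenEmbedding_restrict]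
  intro V
  obtain ⟨W, hW, hi⟩ := P.exists_injOn_quot V
  obtain ⟨U, hU, hUo, hVU⟩ := mem_nhds_iff.1 hW
  refine ⟨U, hUo.mem_nhds hVU, ?_⟩
  exact Topology.IsOpenEmbedding.of_continuous_injective_isOpenMap
    (P.continuous_quot.comp continuous_subtype_val) ((hi.mono hU).injective)
    (P.isOpenMap_quot.comp hUo.isOpenMap_subtype_val)

/-- The manifold structure of `X`: its charts are the local inverses of the quotient map followed
by charts of `TM`. -/
instance : ChartedSpace (ModelProd E E) P.X :=
  P.isLocalHomeomorph_quot.chartedSpace P.quot_surjective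

instance : IsManifold 𝓘(ℝ, E).tangent ∞ P.X := by
  have hF := P.isLocalHomeomorph_quot
  -- the composition of the quotient map with a local inverse of it is smooth
  have key : ∀ (V T : TB E M), P.quot V ∈ (hF.localInverseAt T).source →
      ContMDiffAt 𝓘(ℝ, E).tangent 𝓘(ℝ, E).tangent ∞
        (fun V' => hF.localInverseAt T (P.quot V')) V := by
    intro V T hV
    set s := hF.localInverseAt T with hs
    have h1 : P.quot (s (P.quot V)) = P.quot V := hF.apply_localInverseAt_of_mem hV
    obtain ⟨γ₀, h0⟩ := P.exists_of_quot_eq h1.symm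
    obtain ⟨γ, hγ, h2⟩ := P.exists_section V.proj γ₀
    have h3 := P.translate_smooth h2 (P.isDarbouxFrame V.proj).isOpen (P.mem_frameDom V.proj)
    refine h3.congr_of_eventuallyEq ?_
    have hT : P.translate γ V = s (P.quot V) := by rw [h0, translate, hγ]
    have hev : ∀ᶠ V' in 𝓝 V, P.translate γ V' ∈ s.target :=
      h3.continuousAt (s.open_target.mem_nhds (by rw [hT]; exact s.map_source hV))
    filter_upwards [hev] with V' hV'
    rw [← P.quot_translate γ V']
    have h4 := s.right_inv hV'
    rw [hs, hF.localInverseAt_symm] at h4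
    exact h4
  refine isManifold_of_contDiffOn _ _ _ ?_
  rintro _ _ ⟨x, rfl⟩ ⟨y, rfl⟩
  set g := P.quot_surjective.hasRightInverse.choose with hg
  set s := hF.localInverseAt (g x) with hs
  set t := hF.localInverseAt (g y) with ht
  rw [← contMDiffOn_iff_contDiffOn]
  set J := 𝓘(ℝ, E).tangent with hJ
  set c := chartAt (ModelProd E E) (g x) with hc
  set d := chartAt (ModelProd E E) (g y) with hd
  have hc1 : ContMDiffOn J J ∞ c.symm c.target := contMDiffOn_chart_symm
  have hd1 : ContMDiffOn J J ∞ d d.source := contMDiffOn_chart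
  have hs' : ∀ V, s.symm V = P.quot V := fun V => by rw [hs, hF.localInverseAt_symm]
  have hmid : ContMDiffOn J J ∞ (fun V => t (s.symm V)) (s.symm ⁻¹' t.source) := by
    intro V hV
    simp only [hs'] at hV ⊢
    exact (key V (g y) (by simpa [hs'] using hV)).contMDiffWithinAt
  apply J.contMDiff.comp_contMDiffOn
  have h5 : ContMDiffOn J J ∞ (fun w => d (t (s.symm (c.symm w))))
      (((s.trans c).symm.trans (t.trans d)).source) := by
    refine hd1.comp (hmid.comp (hc1.mono ?_) ?_) ?_
    · intro w hw
      simp only [mfld_simps] at hw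
      tauto
    · intro w hw
      simp only [mfld_simps] at hw
      simp only [mfld_simps]
      tauto
    · intro w hw
      simp only [mfld_simps] at hw
      tauto
  exact h5.comp (J.contMDiffOn_symm.mono Set.inter_subset_right) (fun w hw => hw.1)

end LatticePeriodStructure

/-- The hyperkähler structure `S` on `X = TM / 2π Γ` is the one induced by the structure on `TM`:
the structure on `TM` is the pullback of `S` under the quotient map. -/
def SpecialJoyceStructure.Induces {P : SpecialPeriodStructure E M} [FiniteDimensional ℂ E]
    (A : SpecialJoyceStructure P)
    (S : Hyperkahler 𝓘(ℝ, E).tangent P.X) : Prop :=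
  ∀ V : TB E M,
    let dq : TN V →L[ℝ] TangentSpace 𝓘(ℝ, E).tangent (P.quot V) :=
      mfderiv 𝓘(ℝ, E).tangent 𝓘(ℝ, E).tangent P.quot V
    (∀ a, S.I₁ (P.quot V) (dq a) = dq (A.I₁ V a)) ∧
    (∀ a, S.I₂ (P.quot V) (dq a) = dq (A.I₂ V a)) ∧
    (∀ a, S.I₃ (P.quot V) (dq a) = dq (A.I₃ V a)) ∧
    ∀ a b, S.g (P.quot V) (dq a) (dq b) = A.g V a b

end Joyce

end

end SpecialJoyce

/-!
The argument takes place in adapted charts of `N = TM`: a holomorphic chart of `M`, together with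
the coefficients in a Darboux frame of the lattices, gives coordinates in `E × ℝ^{2n}` in which the
flat connection `𝓗` is trivial, `ω^ν` is the standard symplectic form and the translations by
sections of `2π Γ` are constant on the fibres.

**The closed forms.** In these coordinates the horizontal lifts of `A^ζ` are
`(e, 0) ↦ (e, K^ζ_e)`, where `K^ζ_e` is, on each fibre, the sum of a constant vector and a
Hamiltonian vector field (`isHamiltonianAt_connCoord`). Let `Ω_ζ` be the complex 2-form with kernel
`Im (A^ζ)` which restricts to the symplectic form on the fibres (`connForm`). Its exterior
derivative vanishes on two horizontal vectors since `A^ζ` is flat (`connCoord_flat`), and on two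
vertical vectors since its parallel transport is symplectic; so `Ω_ζ` is closed
(`connForm_closed`). As `ω^ν` is of type `(1,1)`, an evaluation on the vectors `h_X` and `v_Y` gives
`ω₃ = -Re Ω_1 / 4π²`, `ω₁ = Im Ω_1 / 4π²` and `ω₂ = Im Ω_i / 4π²` (`forms_adapted`). Thus the three
forms are smooth and closed.

**The hyperkähler structure of `TM`.** The algebraic conditions are verified at a point: every real
tangent vector is `Re h_X + Re v_Y` for unique `X` and `Y` (`IsSplitting.bijective`), and in these
terms `g`, the `I_k` and the `ω_k` have simple expressions in the skew-hermitian form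
`κ(X, Y) = ω^ν(v_X, conj v_Y)`, which is non-degenerate (`eq_zero_of_kappa`). The complex structures
are smooth because each of them relates two of the smooth non-degenerate forms `ω_k`
(`isSmoothEndo_of_forms`). `I₁` and `I₂` are integrable since their `(-i)`-eigenspaces are the
images of the flat connections `A^i` and `A^{-1}`. For `I₃`, which belongs to the limit `ζ = 0`, the
integrability follows from the fact that `ω₁ + i ω₂` is closed, non-degenerate and of type `(2,0)`
(`isInvolutiveAt_of_closed`).

**Descent.** The quotient map `TM → X` is a local diffeomorphism, and two points with the same image
are related by a local translation, so that invariant tensor fields descend to `X`, together with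
all conditions of a local nature (`quotHyperkahler`). The coefficients in a Darboux frame modulo
`2π` are continuous on `X` and separate the points of a fibre; this shows that `X` is Hausdorff
(`t2Space_X`), and that each fibre is the image of a cube (`fibre_eq_image`).

**The integrable system.** The vertical spaces are the vectors `Re v_Y`, on which `ω₁` and `ω₂`
vanish (`dproj_eq_zero_iff_forall`). On a fibre, `ω₃` is `-1/4π²` times the standard symplectic form
of the coordinates modulo `2π`. Hence its integral over a torus is an integer: a map from `ℝ²` to
the fibre which is invariant under `ℤ²` lifts to `ℝ^{2n}` (`exists_lift`), the lift is periodic up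
to constants in `2π ℤ^{2n}` (`exists_period`), and by the divergence theorem these constants
determine the integral (`integral_sum_wedge`).
-/

set_option linter.unusedSectionVars false

open scoped Manifold ContDiff Topology

namespace SpecialJoyce

noncomputable section

/-! ### Complex linear algebra of the coefficients `h` and `v` -/

namespace Cx

variable {T V : Type*} [AddCommGroup T] [Module ℝ T] [AddCommGroup V] [Module ℝ V]

@[simp] theorem conj_re (w : Cx T) : (conj w).re = w.re := rfl

@[simp] theorem conj_im (w : Cx T) : (conj w).im = -w.im := rfl

@[simp] theorem map_re (f : T →ₗ[ℝ] V) (w : Cx T) : (map f w).re = f w.re := rfl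

@[simp] theorem map_im (f : T →ₗ[ℝ] V) (w : Cx T) : (map f w).im = f w.im := rfl

@[simp] theorem conj_conj (w : Cx T) : conj (conj w) = w := by ext <;> simp

theorem map_conj (f : T →ₗ[ℝ] V) (w : Cx T) : map f (conj w) = conj (map f w) := by
  ext <;> simp

/-- The complex-bilinear extension of a real bilinear form, as a bilinear map. -/
def bilinₗ (s : T →ₗ[ℝ] T →ₗ[ℝ] ℝ) : Cx T →ₗ[ℂ] Cx T →ₗ[ℂ] ℂ :=
  LinearMap.mk₂ ℂ (bilin (s · ·))
    (fun u u' w => by apply Complex.ext <;> simp [bilin] <;> ring)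
    (fun c u w => by apply Complex.ext <;> simp [bilin] <;> ring)
    (fun u w w' => by apply Complex.ext <;> simp [bilin] <;> ring)
    (fun c u w => by apply Complex.ext <;> simp [bilin] <;> ring)

theorem bilinₗ_apply (s : T →ₗ[ℝ] T →ₗ[ℝ] ℝ) (u w : Cx T) :
    bilinₗ s u w = bilin (s · ·) u w := rfl

theorem bilinₗ_conj (s : T →ₗ[ℝ] T →ₗ[ℝ] ℝ) (u w : Cx T) :
    bilinₗ s (conj u) (conj w) = starRingEnd ℂ (bilinₗ s u w) := by
  apply Complex.ext <;> simp [bilinₗ_apply, bilin, add_comm]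

theorem bilinₗ_neg_flip (s : T →ₗ[ℝ] T →ₗ[ℝ] ℝ) (hs : ∀ a b, s a b = -s b a) (u w : Cx T) :
    bilinₗ s u w = -bilinₗ s w u := by
  apply Complex.ext <;>
    simp only [bilinₗ_apply, bilin, Complex.neg_re, Complex.neg_im, hs u.re, hs u.im] <;> ring

end Cx

section Eigenspaces

variable {T : Type*} [AddCommGroup T] [Module ℝ T]

theorem mem_negEigenspace {I : T →ₗ[ℝ] T} {w : Cx T} :
    w ∈ negEigenspace I ↔ I w.re = w.im ∧ I w.im = -w.re := by
  rw [negEigenspace, LinearMap.mem_ker, Cx.ext_iff]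
  simp [sub_eq_zero, add_eq_zero_iff_eq_neg, ← sub_eq_add_neg]

/-- An endomorphism whose `(-i)`-eigenspace contains `D` has precisely `D` as its
`(-i)`-eigenspace, provided that `D` and `conj D` span the complexification. -/
theorem negEigenspace_eq {I : T →ₗ[ℝ] T} {D : Submodule ℂ (Cx T)} (h : D ≤ negEigenspace I)
    (hD : ∀ a : T, ∃ d ∈ D, d.re = a) : negEigenspace I = D := by
  refine le_antisymm (fun w hw => ?_) h
  obtain ⟨d, hd, hdw⟩ := hD w.re
  have h1 := (mem_negEigenspace.1 hw).1
  have h2 := (mem_negEigenspace.1 (h hd)).1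
  have : w = d := by
    ext
    · exact hdw.symm
    · rw [← h1, ← h2, hdw]
  rwa [this]

theorem eq_of_negEigenspace_eq {I I' : T →ₗ[ℝ] T} {D : Submodule ℂ (Cx T)}
    (h : negEigenspace I = D) (h' : negEigenspace I' = D) (hD : ∀ a : T, ∃ d ∈ D, d.re = a) :
    I = I' := by
  ext a
  obtain ⟨d, hd, rfl⟩ := hD a
  rw [(mem_negEigenspace.1 (h ▸ hd)).1, (mem_negEigenspace.1 (h' ▸ hd)).1]

end Eigenspaces

section Frame

variable {T : Type*} [AddCommGroup T] [Module ℝ T] {Q : Type*} [AddCommGroup Q] [Module ℂ Q]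

/-- The complexification of `T` is the direct sum of the images of `h`, `conj h`, `v`, `conj v`. -/
def IsSplitting (h : Q →ₗ[ℂ] Cx T) (v : Q →ₛₗ[starRingEnd ℂ] Cx T) : Prop :=
  ∀ w : Cx T, ∃! q : (Q × Q) × (Q × Q),
    w = h q.1.1 + Cx.conj (h q.1.2) + v q.2.1 + Cx.conj (v q.2.2)

/-- The real vector `Re h_X + Re v_Y`. -/
def reSum (h : Q →ₗ[ℂ] Cx T) (v : Q →ₛₗ[starRingEnd ℂ] Cx T) : Q × Q →ₗ[ℝ] T where
  toFun q := (h q.1).re + (v q.2).re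
  map_add' q q' := by simp; abel
  map_smul' r q := by simp [← Complex.coe_smul]

variable {h : Q →ₗ[ℂ] Cx T} {v : Q →ₛₗ[starRingEnd ℂ] Cx T}

theorem h_re (X : Q) : (h X).re = reSum h v (X, 0) := by simp [reSum]

theorem h_im (X : Q) : (h X).im = reSum h v (-(Complex.I • X), 0) := by simp [reSum]

theorem v_re (X : Q) : (v X).re = reSum h v (0, X) := by simp [reSum]

theorem v_im (X : Q) : (v X).im = reSum h v (0, Complex.I • X) := by simp [reSum]

theorem coe_reSum (q : Q × Q) : (⟨(2 : ℝ) • reSum h v q, 0⟩ : Cx T)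
    = h q.1 + Cx.conj (h q.1) + v q.2 + Cx.conj (v q.2) := by
  ext <;> simp [reSum]
  module

/-- Every real tangent vector is `Re h_X + Re v_Y` for unique `X` and `Y`: apply the splitting to
twice the vector, and use that it commutes with conjugation. -/
theorem IsSplitting.bijective (H : IsSplitting h v) : Function.Bijective (reSum h v) := by
  constructor
  · rw [injective_iff_map_eq_zero]
    intro q hq
    have h1 := coe_reSum (h := h) (v := v) q
    rw [hq, smul_zero] at h1
    have := (H ⟨0, 0⟩).unique (y₁ := ((q.1, q.1), (q.2, q.2))) (y₂ := 0) h1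
      (by ext <;> simp)
    simp only [Prod.ext_iff, Prod.fst_zero, Prod.snd_zero] at this
    exact Prod.ext this.1.1 this.2.1
  · intro a
    obtain ⟨q, hq, hu⟩ := H ⟨(2 : ℝ) • a, 0⟩
    have h2 := hu ((q.1.2, q.1.1), (q.2.2, q.2.1)) (by
      have := congrArg Cx.conj hq
      simp only [map_add, Cx.conj_conj] at this
      simp only
      rw [show (⟨(2 : ℝ) • a, 0⟩ : Cx T) = Cx.conj ⟨(2 : ℝ) • a, 0⟩ by ext <;> simp, this]
      abel)
    have h3 : q.1.2 = q.1.1 := congrArg (fun r => r.1.1) h2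
    have h4 : q.2.2 = q.2.1 := congrArg (fun r => r.2.1) h2
    refine ⟨(q.1.1, q.2.1), ?_⟩
    rw [h3, h4, ← coe_reSum (q.1.1, q.2.1)] at hq
    exact (smul_right_injective T (two_ne_zero' ℝ) (congrArg Cx.re hq)).symm

/-- The real isomorphism `Q × Q → T`, `(X, Y) ↦ Re h_X + Re v_Y`. -/
def IsSplitting.equiv (H : IsSplitting h v) : (Q × Q) ≃ₗ[ℝ] T :=
  LinearEquiv.ofBijective (reSum h v) H.bijective

@[simp] theorem IsSplitting.equiv_apply (H : IsSplitting h v) (q : Q × Q) :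
    H.equiv q = reSum h v q := rfl

@[simp] theorem IsSplitting.equiv_symm_reSum (H : IsSplitting h v) (q : Q × Q) :
    H.equiv.symm (reSum h v q) = q := H.equiv.symm_apply_apply q

/-- The image of `A^ζ`, in terms of `h` and `v`; for `ζ = 0` the first summand is the limit `-conj
v` of the rescaled `(1,0)`-part. -/
def connIm (h : Q →ₗ[ℂ] Cx T) (v : Q →ₛₗ[starRingEnd ℂ] Cx T) (ζ : ℂ) : Submodule ℂ (Cx T) :=
  LinearMap.range (if ζ = 0 then -Cx.conj.comp v else h - ζ⁻¹ • Cx.conj.comp v)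
    ⊔ LinearMap.range (Cx.conj.comp h + ζ • v)

theorem connIm_re {ζ : ℂ} (hζ : ζ * starRingEnd ℂ ζ = 1) (X Y : Q) :
    ((h - ζ⁻¹ • Cx.conj.comp v : Q →ₗ[ℂ] Cx T) X + (Cx.conj.comp h + ζ • v) Y).re
      = reSum h v (X + Y, starRingEnd ℂ ζ • Y - starRingEnd ℂ ζ • X) := by
  have hinv : ζ⁻¹ = starRingEnd ℂ ζ := inv_eq_of_mul_eq_one_right hζ
  simp only [hinv, reSum, LinearMap.add_apply, LinearMap.sub_apply, LinearMap.smul_apply,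
    LinearMap.comp_apply, Cx.re_add, Cx.re_sub, Cx.re_smul, Cx.conj_re, Cx.conj_im,
    LinearMap.coe_mk, AddHom.coe_mk, map_add, map_sub, LinearMap.map_smulₛₗ, Complex.conj_conj,
    Complex.conj_re, Complex.conj_im]
  module

/-- For `|ζ| = 1`, the imaginary part of a vector in the image of `A^ζ` is obtained from its real
part by `acsUnit`. -/
theorem exists_reSum_of_mem_connIm {ζ : ℂ} (hζ : ζ * starRingEnd ℂ ζ = 1) {w : Cx T}
    (hw : w ∈ connIm h v ζ) : ∃ X Y : Q,
      w.re = reSum h v (X, Y) ∧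
      w.im = reSum h v (Complex.I • ζ • Y, Complex.I • starRingEnd ℂ ζ • X) := by
  have h0 : ζ ≠ 0 := by rintro rfl; simp at hζ
  have hinv : ζ⁻¹ = starRingEnd ℂ ζ := inv_eq_of_mul_eq_one_right hζ
  obtain ⟨_, ⟨X, rfl⟩, _, ⟨Y, rfl⟩, rfl⟩ := Submodule.mem_sup.1 hw
  simp only [if_neg h0]
  refine ⟨X + Y, starRingEnd ℂ ζ • Y - starRingEnd ℂ ζ • X, connIm_re hζ X Y, ?_⟩
  have e1 : Complex.I • ζ • (starRingEnd ℂ ζ • Y - starRingEnd ℂ ζ • X)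
      = Complex.I • Y - Complex.I • X := by
    rw [smul_sub, smul_smul ζ, smul_smul ζ, hζ, one_smul, one_smul, smul_sub]
  rw [e1]
  simp [hinv, reSum]
  module

theorem exists_mem_connIm {ζ : ℂ} (hζ : ζ * starRingEnd ℂ ζ = 1) (q : Q × Q) :
    ∃ w ∈ connIm h v ζ, w.re = reSum h v q := by
  have h0 : ζ ≠ 0 := by rintro rfl; simp at hζ
  refine ⟨_, Submodule.add_mem_sup
    ⟨(1 / 2 : ℂ) • (q.1 - ζ • q.2), rfl⟩ ⟨(1 / 2 : ℂ) • (q.1 + ζ • q.2), rfl⟩, ?_⟩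
  simp only [if_neg h0]
  rw [connIm_re hζ, ← smul_sub, ← smul_sub, ← smul_add, smul_comm (starRingEnd ℂ ζ)]
  have e1 : q.1 - ζ • q.2 + (q.1 + ζ • q.2) = (2 : ℂ) • q.1 := by module
  have e2 : starRingEnd ℂ ζ • (q.1 + ζ • q.2 - (q.1 - ζ • q.2)) = (2 : ℂ) • q.2 := by
    rw [show q.1 + ζ • q.2 - (q.1 - ζ • q.2) = (2 : ℂ) • ζ • q.2 by module, smul_smul, smul_smul,
      show starRingEnd ℂ ζ * 2 * ζ = 2 by linear_combination 2 * hζ]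
  rw [e1, e2, smul_smul, smul_smul]
  norm_num

/-- The imaginary part of a vector in the image of `A^0` is obtained from its real part by
`acsZero`. -/
theorem exists_reSum_of_mem_connIm_zero {w : Cx T} (hw : w ∈ connIm h v 0) : ∃ X Y : Q,
      w.re = reSum h v (X, Y) ∧ w.im = reSum h v (Complex.I • X, -(Complex.I • Y)) := by
  obtain ⟨_, ⟨X, rfl⟩, _, ⟨Y, rfl⟩, rfl⟩ := Submodule.mem_sup.1 hw
  refine ⟨Y, -X, ?_, ?_⟩
  · simp [reSum, add_comm]
  · simp [reSum, add_comm]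

theorem exists_mem_connIm_zero (q : Q × Q) : ∃ w ∈ connIm h v 0, w.re = reSum h v q := by
  refine ⟨_, Submodule.add_mem_sup ⟨-q.2, rfl⟩ ⟨q.1, rfl⟩, ?_⟩
  simp [reSum, add_comm]

/-- A complex structure on the parameter space `Q × Q` is transported to `T`. Its `(-i)`-eigenspace
is `D` if the vectors of `D` are of the form `a + i I a`. -/
theorem IsSplitting.exists_acs (H : IsSplitting h v) {D : Submodule ℂ (Cx T)}
    (J : Q × Q →ₗ[ℝ] Q × Q) (hJ : ∀ q, J (J q) = -q)
    (h1 : ∀ w ∈ D, ∃ q, w.re = reSum h v q ∧ w.im = reSum h v (J q))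
    (h2 : ∀ q, ∃ w ∈ D, w.re = reSum h v q) :
    ∃ I : T →ₗ[ℝ] T, negEigenspace I = D ∧ ∀ q, I (reSum h v q) = reSum h v (J q) := by
  refine ⟨H.equiv.toLinearMap ∘ₗ J ∘ₗ H.equiv.symm.toLinearMap,
    negEigenspace_eq (fun w hw => mem_negEigenspace.2 ?_) (fun a => ?_), fun q => ?_⟩
  · obtain ⟨q, hq, hq'⟩ := h1 w hw
    simp [hq, hq', hJ]
  · obtain ⟨q, rfl⟩ := H.bijective.2 a
    exact h2 q
  · simp

/-- The endomorphism with `(-i)`-eigenspace `D` is unique, so that the one picked by the choice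
operator is the one of `IsSplitting.exists_acs`. -/
theorem IsSplitting.epsilon_spec (H : IsSplitting h v) {D : Submodule ℂ (Cx T)}
    (J : Q × Q →ₗ[ℝ] Q × Q) (hJ : ∀ q, J (J q) = -q)
    (h1 : ∀ w ∈ D, ∃ q, w.re = reSum h v q ∧ w.im = reSum h v (J q))
    (h2 : ∀ q, ∃ w ∈ D, w.re = reSum h v q) :
    negEigenspace (Classical.epsilon fun I : T →ₗ[ℝ] T => negEigenspace I = D) = D ∧
      ∀ q, (Classical.epsilon fun I : T →ₗ[ℝ] T => negEigenspace I = D) (reSum h v q)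
        = reSum h v (J q) := by
  obtain ⟨I, hI, hI'⟩ := H.exists_acs J hJ h1 h2
  have h3 := Classical.epsilon_spec (p := fun I : T →ₗ[ℝ] T => negEigenspace I = D) ⟨I, hI⟩
  refine ⟨h3, fun q => ?_⟩
  rw [← hI', eq_of_negEigenspace_eq h3 hI fun a => ?_]
  obtain ⟨q, rfl⟩ := H.bijective.2 a
  exact h2 q

/-- The endomorphism of `Q × Q` that corresponds to `I_ζ` for `|ζ| = 1`. -/
def acsUnit (Q : Type*) [AddCommGroup Q] [Module ℂ Q] (ζ : ℂ) : Q × Q →ₗ[ℝ] Q × Q where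
  toFun q := (Complex.I • ζ • q.2, Complex.I • starRingEnd ℂ ζ • q.1)
  map_add' q q' := by simp
  map_smul' r q := by simp [smul_comm r]

/-- The endomorphism of `Q × Q` that corresponds to `I_0`. -/
def acsZero (Q : Type*) [AddCommGroup Q] [Module ℂ Q] : Q × Q →ₗ[ℝ] Q × Q where
  toFun q := (Complex.I • q.1, -(Complex.I • q.2))
  map_add' q q' := by simp [add_comm]
  map_smul' r q := by simp [smul_comm r]

theorem IsSplitting.epsilon_unit (H : IsSplitting h v) {ζ : ℂ} (hζ : ζ * starRingEnd ℂ ζ = 1) :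
    negEigenspace (Classical.epsilon fun I : T →ₗ[ℝ] T => negEigenspace I = connIm h v ζ)
        = connIm h v ζ ∧
      ∀ q, (Classical.epsilon fun I : T →ₗ[ℝ] T => negEigenspace I = connIm h v ζ)
        (reSum h v q) = reSum h v (acsUnit Q ζ q) := by
  refine H.epsilon_spec (acsUnit Q ζ) (fun q => ?_) (fun w hw => ?_) (exists_mem_connIm hζ)
  · have h1 : Complex.I * ζ * (Complex.I * starRingEnd ℂ ζ) = -1 := by
      linear_combination Complex.I * Complex.I * hζ + Complex.I_mul_I
    have h2 : Complex.I * starRingEnd ℂ ζ * (Complex.I * ζ) = -1 := by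
      linear_combination Complex.I * Complex.I * hζ + Complex.I_mul_I
    ext <;> simp [acsUnit, smul_smul, h1, h2]
  · obtain ⟨X, Y, hX, hY⟩ := exists_reSum_of_mem_connIm hζ hw
    exact ⟨(X, Y), hX, hY⟩

theorem IsSplitting.epsilon_zero (H : IsSplitting h v) :
    negEigenspace (Classical.epsilon fun I : T →ₗ[ℝ] T => negEigenspace I = connIm h v 0)
        = connIm h v 0 ∧
      ∀ q, (Classical.epsilon fun I : T →ₗ[ℝ] T => negEigenspace I = connIm h v 0)
        (reSum h v q) = reSum h v (acsZero Q q) := by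
  refine H.epsilon_spec (acsZero Q) (fun q => ?_) (fun w hw => ?_) exists_mem_connIm_zero
  · ext <;> simp [acsZero, smul_smul]
  · obtain ⟨X, Y, hX, hY⟩ := exists_reSum_of_mem_connIm_zero hw
    exact ⟨(X, Y), hX, hY⟩

end Frame

/-! ### The two-form of a splitting -/

section Forms

variable {T : Type*} [AddCommGroup T] [Module ℝ T] {V : Type*} [AddCommGroup V] [Module ℝ V]
  {Q : Type*} [AddCommGroup Q] [Module ℂ Q]

/-- The skew-hermitian form `(X, Y) ↦ w(u_X, conj u_Y)` of an antilinear map `u`. -/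
def sesq (w : V →ₗ[ℝ] V →ₗ[ℝ] ℝ) (u : Q →ₛₗ[starRingEnd ℂ] Cx V) :
    Q →ₛₗ[starRingEnd ℂ] Q →ₗ[ℂ] ℂ :=
  LinearMap.mk₂'ₛₗ (starRingEnd ℂ) (RingHom.id ℂ) (fun X Y => Cx.bilinₗ w (u X) (Cx.conj (u Y)))
    (by simp) (by simp) (by simp) (by simp)

theorem sesq_apply (w : V →ₗ[ℝ] V →ₗ[ℝ] ℝ) (u : Q →ₛₗ[starRingEnd ℂ] Cx V) (X Y : Q) :
    sesq w u X Y = Cx.bilinₗ w (u X) (Cx.conj (u Y)) := rfl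

theorem sesq_flip {w : V →ₗ[ℝ] V →ₗ[ℝ] ℝ} (hw : ∀ a b, w a b = -w b a)
    (u : Q →ₛₗ[starRingEnd ℂ] Cx V) (X Y : Q) :
    sesq w u Y X = -starRingEnd ℂ (sesq w u X Y) := by
  rw [sesq_apply, sesq_apply, Cx.bilinₗ_neg_flip w hw, ← Cx.bilinₗ_conj, Cx.conj_conj]

variable {h : Q →ₗ[ℂ] Cx T} {v : Q →ₛₗ[starRingEnd ℂ] Cx T}

/-- The values of the form `ω₃` on real vectors `Re h_X + Re v_Y` are determined by its defining
properties. -/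
theorem form_reSum {s : T →ₗ[ℝ] T →ₗ[ℝ] ℝ} (hs : ∀ a, s a a = 0)
    (κ : Q →ₛₗ[starRingEnd ℂ] Q →ₗ[ℂ] ℂ)
    (hκ : ∀ X Y, κ Y X = -starRingEnd ℂ (κ X Y))
    (h1 : ∀ X Y, Cx.bilinₗ s (v X) (Cx.conj (v Y)) = κ X Y)
    (h2 : ∀ X Y, Cx.bilinₗ s (h Y) (Cx.conj (h X)) = κ X Y)
    (h3 : ∀ X Y, Cx.bilinₗ s (h X) (h Y) = 0) (h4 : ∀ X Y, Cx.bilinₗ s (v X) (v Y) = 0)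
    (h5 : ∀ X Y, Cx.bilinₗ s (h X) (v Y) = 0)
    (h6 : ∀ X Y, Cx.bilinₗ s (h X) (Cx.conj (v Y)) = 0) (q q' : Q × Q) :
    s (reSum h v q) (reSum h v q') = (1 / 2) * (κ q.2 q'.2 - κ q.1 q'.1).re := by
  have hskew : ∀ a b, s a b = -s b a := by
    intro a b
    have := hs (a + b)
    simp only [map_add, LinearMap.add_apply, hs] at this
    linarith
  have hf := Cx.bilinₗ_neg_flip s hskew
  have hc := Cx.bilinₗ_conj s
  have e1 : ((4 * s (reSum h v q) (reSum h v q') : ℝ) : ℂ)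
      = Cx.bilinₗ s ⟨(2 : ℝ) • reSum h v q, 0⟩ ⟨(2 : ℝ) • reSum h v q', 0⟩ := by
    apply Complex.ext <;> simp [Cx.bilinₗ_apply, Cx.bilin]
    ring
  have h2' : ∀ X Y, Cx.bilinₗ s (Cx.conj (h X)) (h Y) = -κ X Y := fun X Y => by rw [hf, h2]
  have h1' : ∀ X Y, Cx.bilinₗ s (Cx.conj (v X)) (v Y) = -κ Y X := fun X Y => by rw [hf, h1]
  have h3' : ∀ X Y, Cx.bilinₗ s (Cx.conj (h X)) (Cx.conj (h Y)) = 0 := fun X Y => by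
    rw [hc, h3, map_zero]
  have h4' : ∀ X Y, Cx.bilinₗ s (Cx.conj (v X)) (Cx.conj (v Y)) = 0 := fun X Y => by
    rw [hc, h4, map_zero]
  have h5' : ∀ X Y, Cx.bilinₗ s (Cx.conj (h X)) (Cx.conj (v Y)) = 0 := fun X Y => by
    rw [hc, h5, map_zero]
  have h6' : ∀ X Y, Cx.bilinₗ s (Cx.conj (h X)) (v Y) = 0 := fun X Y => by
    rw [← Cx.conj_conj (v Y), hc, h6, map_zero]
  have h7 : ∀ X Y, Cx.bilinₗ s (v X) (h Y) = 0 := fun X Y => by rw [hf, h5, neg_zero]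
  have h8 : ∀ X Y, Cx.bilinₗ s (v X) (Cx.conj (h Y)) = 0 := fun X Y => by rw [hf, h6', neg_zero]
  have h9 : ∀ X Y, Cx.bilinₗ s (Cx.conj (v X)) (h Y) = 0 := fun X Y => by rw [hf, h6, neg_zero]
  have h10 : ∀ X Y, Cx.bilinₗ s (Cx.conj (v X)) (Cx.conj (h Y)) = 0 := fun X Y => by
    rw [hf, h5', neg_zero]
  rw [coe_reSum, coe_reSum] at e1
  simp only [map_add, LinearMap.add_apply, h1, h2, h3, h4, h5, h6, h2', h1', h3', h4', h5', h6',
    h7, h8, h9, h10, hκ q.2 q'.2, hκ q.1 q'.1] at e1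
  have e2 := congrArg Complex.re e1
  simp at e2
  simp
  linarith

/-- The form with the values of `form_reSum`. -/
def IsSplitting.form (H : IsSplitting h v) (κ : Q →ₛₗ[starRingEnd ℂ] Q →ₗ[ℂ] ℂ) :
    T →ₗ[ℝ] T →ₗ[ℝ] ℝ :=
  LinearMap.mk₂ ℝ (fun a b => (1 / 2) * (κ (H.equiv.symm a).2 (H.equiv.symm b).2
      - κ (H.equiv.symm a).1 (H.equiv.symm b).1).re)
    (fun a a' b => by simp; ring) (fun r a b => by simp [← Complex.coe_smul]; ring)
    (fun a b b' => by simp; ring) (fun r a b => by simp [← Complex.coe_smul]; ring)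

theorem IsSplitting.form_apply (H : IsSplitting h v) (κ : Q →ₛₗ[starRingEnd ℂ] Q →ₗ[ℂ] ℂ)
    (q q' : Q × Q) :
    H.form κ (reSum h v q) (reSum h v q') = (1 / 2) * (κ q.2 q'.2 - κ q.1 q'.1).re := by
  simp [form]

/-- The defining properties of `ω₃` are satisfied by a unique real form: this is existence, and
`form_reSum` is uniqueness. -/
theorem IsSplitting.form_spec (H : IsSplitting h v) (κ : Q →ₛₗ[starRingEnd ℂ] Q →ₗ[ℂ] ℂ)
    (hκ : ∀ X Y, κ Y X = -starRingEnd ℂ (κ X Y)) :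
    (∀ a, H.form κ a a = 0) ∧
    (∀ X Y, Cx.bilinₗ (H.form κ) (v X) (Cx.conj (v Y)) = κ X Y) ∧
    (∀ X Y, Cx.bilinₗ (H.form κ) (h Y) (Cx.conj (h X)) = κ X Y) ∧
    (∀ X Y, Cx.bilinₗ (H.form κ) (h X) (h Y) = 0) ∧
    (∀ X Y, Cx.bilinₗ (H.form κ) (v X) (v Y) = 0) ∧
    (∀ X Y, Cx.bilinₗ (H.form κ) (h X) (v Y) = 0) ∧
    ∀ X Y, Cx.bilinₗ (H.form κ) (h X) (Cx.conj (v Y)) = 0 := by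
  have hre : ∀ X, (κ X X).re = 0 := fun X => by
    have := congrArg Complex.re (hκ X X)
    simp at this
    linarith
  refine ⟨fun a => ?_, ?_⟩
  · obtain ⟨q, rfl⟩ := H.bijective.2 a
    simp [H.form_apply, hre]
  refine ⟨fun X Y => ?_, fun X Y => ?_, fun X Y => ?_, fun X Y => ?_, fun X Y => ?_,
    fun X Y => ?_⟩ <;>
  · apply Complex.ext <;>
    simp only [Cx.bilinₗ_apply, Cx.bilin, Cx.conj_re, Cx.conj_im, v_re (h := h), v_im (h := h),
      h_re (v := v), h_im (v := v), H.form_apply, map_neg] <;>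
    simp [hκ X Y] <;> ring

end Forms

/-! ### Two-forms and Hamiltonian connections on vector spaces -/

section VectorSpace

variable {W : Type*} [NormedAddCommGroup W] [NormedSpace ℝ W]
  {K : Type*} [NormedAddCommGroup K] [NormedSpace ℝ K]

theorem dirDeriv_eq_fderiv (f : W → K) (x a : W) :
    dirDeriv 𝓘(ℝ, W) f x a = fderiv ℝ f x a :=
  congrArg (fun l : W →L[ℝ] K => l a) mfderiv_eq_fderiv

theorem mlieBracket_eq_fderiv (A B : W → W) (x : W) :
    VectorField.mlieBracket 𝓘(ℝ, W) A B x = fderiv ℝ B x (A x) - fderiv ℝ A x (B x) := by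
  have h := congrArg (fun l : W → W => l x)
    (VectorField.mlieBracketWithin_eq_lieBracketWithin (𝕜 := ℝ) (V := A) (W := B) (s := Set.univ))
  rw [VectorField.lieBracketWithin_univ] at h
  exact (congrArg (fun l : W → W => l x) VectorField.mlieBracketWithin_univ.symm).trans h

theorem dirDeriv_congr {f g : W → K} {x : W} (h : f =ᶠ[𝓝 x] g) (a : W) :
    dirDeriv 𝓘(ℝ, W) f x a = dirDeriv 𝓘(ℝ, W) g x a := by
  rw [dirDeriv_eq_fderiv, dirDeriv_eq_fderiv, h.fderiv_eq]

/-- The product rule for the evaluation of a bilinear form on two vector fields. -/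
theorem dirDeriv_apply_apply {S : W → W →L[ℝ] W →L[ℝ] K} {S' : W →L[ℝ] W →L[ℝ] W →L[ℝ] K} {x : W}
    (hS : HasFDerivAt S S' x) {B C : W → W} (hB : DifferentiableAt ℝ B x)
    (hC : DifferentiableAt ℝ C x) (a : W) :
    dirDeriv 𝓘(ℝ, W) (fun y => S y (B y) (C y)) x a
      = S' a (B x) (C x) + S x (fderiv ℝ B x a) (C x) + S x (B x) (fderiv ℝ C x a) := by
  rw [dirDeriv_eq_fderiv,
    ((hS.clm_apply hB.hasFDerivAt).clm_apply hC.hasFDerivAt).fderiv]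
  simp
  abel

/-- On a vector space, the exterior derivative of a 2-form is the cyclic sum of its derivatives. -/
theorem extDerivTwo_eq_cyclic_sum {s : W → W →ₗ[ℝ] W →ₗ[ℝ] K} {S : W → W →L[ℝ] W →L[ℝ] K}
    {S' : W →L[ℝ] W →L[ℝ] W →L[ℝ] K} {x : W} (hs : ∀ᶠ y in 𝓝 x, ∀ a b, s y a b = S y a b)
    (hS : HasFDerivAt S S' x) (halt : ∀ a b, S x a b = -S x b a) {A B C : W → W}
    (hA : DifferentiableAt ℝ A x) (hB : DifferentiableAt ℝ B x) (hC : DifferentiableAt ℝ C x) :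
    extDerivTwo 𝓘(ℝ, W) s A B C x
      = S' (A x) (B x) (C x) + S' (B x) (C x) (A x) + S' (C x) (A x) (B x) := by
  have hx : ∀ a b, s x a b = S x a b := hs.self_of_nhds
  have hd : ∀ {B C : W → W} (a : W), DifferentiableAt ℝ B x → DifferentiableAt ℝ C x →
      dirDeriv 𝓘(ℝ, W) (fun y => s y (B y) (C y)) x a
      = S' a (B x) (C x) + S x (fderiv ℝ B x a) (C x) + S x (B x) (fderiv ℝ C x a) := by
    intro B C a hB hC
    rw [← dirDeriv_apply_apply hS hB hC]
    exact dirDeriv_congr (by filter_upwards [hs] with y hy using hy _ _) a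
  have e : ∀ A B C : W → W, s x (VectorField.mlieBracket 𝓘(ℝ, W) A B x) (C x)
      = S x (fderiv ℝ B x (A x)) (C x) - S x (fderiv ℝ A x (B x)) (C x) := by
    intro A B C
    rw [mlieBracket_eq_fderiv]
    exact (hx _ _).trans (by simp)
  unfold extDerivTwo
  erw [hd _ hB hC, hd _ hC hA, hd _ hA hB, e, e, e]
  rw [halt (C x) (fderiv ℝ A x (B x)), halt (A x) (fderiv ℝ B x (C x)),
    halt (B x) (fderiv ℝ C x (A x))]
  abel

end VectorSpace

section HamiltonianConnection

variable {E : Type*} [NormedAddCommGroup E] [NormedSpace ℝ E] {F : Type*}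

/-- The inclusion of real into complex coordinate vectors. -/
def ofRealPi (F : Type*) : (F → ℝ) →L[ℝ] (F → ℂ) :=
  ContinuousLinearMap.pi fun c => Complex.ofRealCLM.comp (ContinuousLinearMap.proj c)

@[simp] theorem ofRealPi_apply (y : F → ℝ) (c : F) : ofRealPi F y c = y c := rfl

/-- The real part of a complex coordinate vector. -/
def rePi (F : Type*) : (F → ℂ) →L[ℝ] (F → ℝ) :=
  ContinuousLinearMap.pi fun c => Complex.reCLM.comp (ContinuousLinearMap.proj c)

/-- The imaginary part of a complex coordinate vector. -/
def imPi (F : Type*) : (F → ℂ) →L[ℝ] (F → ℝ) :=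
  ContinuousLinearMap.pi fun c => Complex.imCLM.comp (ContinuousLinearMap.proj c)

@[simp] theorem rePi_apply (y : F → ℂ) (c : F) : rePi F y c = (y c).re := rfl

@[simp] theorem imPi_apply (y : F → ℂ) (c : F) : imPi F y c = (y c).im := rfl

theorem rePi_add_imPi (y : F → ℂ) :
    ofRealPi F (rePi F y) + Complex.I • ofRealPi F (imPi F y) = y := by
  ext c
  simp [mul_comm Complex.I]

/-- The vertical part of a tangent vector of `E × ℝ^F`, with respect to the complexified connection
whose horizontal lift of `e` is `(e, K e)`. -/
def vertPart (K : E →L[ℝ] (F → ℂ)) : (E × (F → ℝ)) →L[ℝ] (F → ℂ) :=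
  (ofRealPi F).comp (ContinuousLinearMap.snd ℝ E (F → ℝ))
    - K.comp (ContinuousLinearMap.fst ℝ E (F → ℝ))

@[simp] theorem vertPart_apply (K : E →L[ℝ] (F → ℂ)) (a : E × (F → ℝ)) :
    vertPart K a = ofRealPi F a.2 - K a.1 := rfl

variable [Fintype F]

/-- The 2-form on the total space which restricts to `w` on the fibres and whose kernel is the
horizontal distribution of the connection `K`. -/
def connForm (w : (F → ℂ) →L[ℝ] (F → ℂ) →L[ℝ] ℂ) (K : E →L[ℝ] (F → ℂ)) :
    (E × (F → ℝ)) →L[ℝ] (E × (F → ℝ)) →L[ℝ] ℂ :=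
  ((ContinuousLinearMap.compL ℝ (E × (F → ℝ)) (F → ℂ) ℂ).flip (vertPart K)).comp
    (w.comp (vertPart K))

@[simp] theorem connForm_apply (w : (F → ℂ) →L[ℝ] (F → ℂ) →L[ℝ] ℂ) (K : E →L[ℝ] (F → ℂ))
    (a b : E × (F → ℝ)) : connForm w K a b = w (vertPart K a) (vertPart K b) := rfl

theorem contDiffAt_vertPart {X : Type*} [NormedAddCommGroup X] [NormedSpace ℝ X]
    {n : WithTop ℕ∞} {K : X → E →L[ℝ] (F → ℂ)} {x : X} (hK : ContDiffAt ℝ n K x) :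
    ContDiffAt ℝ n (fun y => vertPart (K y)) x :=
  contDiffAt_const.sub (hK.clm_comp contDiffAt_const)

theorem contDiffAt_connForm {X : Type*} [NormedAddCommGroup X] [NormedSpace ℝ X]
    {n : WithTop ℕ∞} (w : (F → ℂ) →L[ℝ] (F → ℂ) →L[ℝ] ℂ) {K : X → E →L[ℝ] (F → ℂ)} {x : X}
    (hK : ContDiffAt ℝ n K x) : ContDiffAt ℝ n (fun y => connForm w (K y)) x := by
  have h1 := contDiffAt_vertPart hK
  exact (contDiffAt_const.clm_apply h1).clm_comp (contDiffAt_const.clm_comp h1)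

/-- The form `connForm w K` is closed if the connection is flat and its parallel transport is
symplectic. -/
theorem connForm_closed {w : (F → ℂ) →L[ℝ] (F → ℂ) →L[ℝ] ℂ}
    (hw : ∀ a b, w a b = -w b a) (hwI : ∀ a b, w a (Complex.I • b) = Complex.I * w a b)
    {K : E × (F → ℝ) → E →L[ℝ] (F → ℂ)} {x : E × (F → ℝ)} (hKd : ContDiffAt ℝ 1 K x)
    (hflat : ∀ e f, fderiv ℝ K x (e, rePi F (K x e)) f
        + Complex.I • fderiv ℝ K x (0, imPi F (K x e)) f
      = fderiv ℝ K x (f, rePi F (K x f)) e + Complex.I • fderiv ℝ K x (0, imPi F (K x f)) e)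
    (hsymp : ∀ f u u', w (ofRealPi F u') (fderiv ℝ K x (0, u) f)
      = w (ofRealPi F u) (fderiv ℝ K x (0, u') f)) :
    ∃ S' : (E × (F → ℝ)) →L[ℝ] (E × (F → ℝ)) →L[ℝ] (E × (F → ℝ)) →L[ℝ] ℂ,
      HasFDerivAt (fun y => connForm w (K y)) S' x ∧
      ∀ a b c, S' a b c + S' b c a + S' c a b = 0 := by
  have hd : DifferentiableAt ℝ (fun y => connForm w (K y)) x :=
    (contDiffAt_connForm w hKd).differentiableAt one_ne_zero
  have hK : DifferentiableAt ℝ K x := hKd.differentiableAt one_ne_zero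
  refine ⟨_, hd.hasFDerivAt, ?_⟩
  -- a name for the derivative that `simp` does not unfold
  obtain ⟨K', hK'⟩ : ∃ K', K' = fderiv ℝ K x := ⟨_, rfl⟩
  have hKK : HasFDerivAt K K' x := hK' ▸ hK.hasFDerivAt
  rw [← hK'] at hflat hsymp
  have hv : ∀ b : E × (F → ℝ), HasFDerivAt (fun y => vertPart (K y) b) (-(K'.flip b.1)) x := by
    intro b
    have h1 : HasFDerivAt (fun y => K y b.1) (K'.flip b.1) x :=
      (hKK.clm_apply (hasFDerivAt_const b.1 x)).congr_fderiv
        (by apply ContinuousLinearMap.ext; intro a; simp)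
    exact (h1.const_sub (ofRealPi F b.2))
  have hS : ∀ a b c, fderiv ℝ (fun y => connForm w (K y)) x a b c
      = -w (K' a b.1) (vertPart (K x) c) - w (vertPart (K x) b) (K' a c.1) := by
    intro a b c
    have h1 := (hd.hasFDerivAt.clm_apply (hasFDerivAt_const b x)).clm_apply (hasFDerivAt_const c x)
    have h2 : HasFDerivAt (fun y => w (vertPart (K y) b) (vertPart (K y) c)) _ x :=
      (w.hasFDerivAt.comp x (hv b)).clm_apply (hv c)
    have h3 := congrArg (fun l => l a) (h1.unique h2)
    simp at h3
    rw [h3]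
    simp
    ring
  -- the complex-linear extension of the fibre derivative
  set d : (F → ℂ) → E → (F → ℂ) := fun u f => K' (0, rePi F u) f + Complex.I • K' (0, imPi F u) f
    with hdd
  set L : E → E → (F → ℂ) := fun e f => K' (e, rePi F (K x e)) f
        + Complex.I • K' (0, imPi F (K x e)) f with hL
  have hwI' : ∀ a b, w (Complex.I • a) b = Complex.I * w a b := fun a b => by
    rw [hw, hwI, hw b a]; ring
  -- `a` is the sum of the horizontal lift of `a.1` and of its vertical part; `L` is the derivative
  -- along the former, which is symmetric by flatness, and `d` the one along the latter
  have hsplit : ∀ a : E × (F → ℝ), ∀ f, K' a f = L a.1 f + d (vertPart (K x) a) f := by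
    intro a f
    have e1 : rePi F (vertPart (K x) a) = a.2 - rePi F (K x a.1) := by ext; simp
    have e2 : imPi F (vertPart (K x) a) = -imPi F (K x a.1) := by ext; simp
    have e3 : a = (a.1, rePi F (K x a.1)) + (0, a.2 - rePi F (K x a.1)) := by ext <;> simp
    have e4 : ((0 : E), -imPi F (K x a.1)) = -(0, imPi F (K x a.1)) := by ext <;> simp
    simp only [hL, hdd, e1, e2]
    conv_lhs => rw [e3]
    rw [e4]
    simp only [map_add, map_neg, add_apply, neg_apply,
      smul_neg]
    abel
  have hsym : ∀ f u u', w u' (d u f) = w u (d u' f) := by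
    intro f u u'
    conv_lhs => rw [← rePi_add_imPi u']
    conv_rhs => rw [← rePi_add_imPi u]
    simp only [hdd, map_add, add_apply, hwI, hwI']
    rw [hsymp f (rePi F u) (rePi F u'), hsymp f (imPi F u) (rePi F u'),
      hsymp f (rePi F u) (imPi F u'), hsymp f (imPi F u) (imPi F u')]
    ring
  intro a b c
  simp only [hS, hsplit, map_add, add_apply]
  have hLs : ∀ e f, L e f = L f e := hflat
  rw [hLs b.1 a.1, hLs c.1 b.1, hLs c.1 a.1,
    hw (L a.1 b.1) (vertPart (K x) c), hw (L b.1 c.1) (vertPart (K x) a),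
    hw (L a.1 c.1) (vertPart (K x) b),
    hw (d (vertPart (K x) a) b.1), hw (d (vertPart (K x) b) c.1), hw (d (vertPart (K x) c) a.1),
    hsym b.1 (vertPart (K x) a), hsym c.1 (vertPart (K x) b), hsym a.1 (vertPart (K x) c)]
  ring

end HamiltonianConnection

/-! ### Tensor fields at a point and local diffeomorphisms -/

section Local

variable {F : Type*} [NormedAddCommGroup F] [NormedSpace ℝ F] {H : Type*} [TopologicalSpace H]
  (J : ModelWithCorners ℝ F H) {X : Type*} [TopologicalSpace X] [ChartedSpace H X]
  [IsManifold J ∞ X]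
  {K : Type*} [NormedAddCommGroup K] [NormedSpace ℝ K]

/-- A field of endomorphisms maps vector fields that are smooth near `x` to vector fields that are
smooth at `x`. -/
def IsSmoothEndoAt (I : Π x : X, TangentSpace J x →ₗ[ℝ] TangentSpace J x) (x : X) : Prop :=
  ∀ U : Set X, IsOpen U → x ∈ U → ∀ A : Π x : X, TangentSpace J x, SmoothFieldOn J A U →
    ContMDiffAt J J.tangent ∞ (fun y => (⟨y, I y (A y)⟩ : TangentBundle J X)) x

/-- A field of bilinear forms takes values that are smooth at `x` on vector fields that are smooth
near `x`. -/
def IsSmoothBilinAt (s : Π x : X, TangentSpace J x →ₗ[ℝ] TangentSpace J x →ₗ[ℝ] K) (x : X) :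
    Prop :=
  ∀ U : Set X, IsOpen U → x ∈ U → ∀ A B : Π x : X, TangentSpace J x,
    SmoothFieldOn J A U → SmoothFieldOn J B U →
    ContMDiffAt J 𝓘(ℝ, K) ∞ (fun y => s y (A y) (B y)) x

/-- The exterior derivative of the 2-form `s` vanishes at `x`. -/
def IsClosedTwoFormAt (s : Π x : X, TangentSpace J x →ₗ[ℝ] TangentSpace J x →ₗ[ℝ] K) (x : X) :
    Prop :=
  ∀ U : Set X, IsOpen U → x ∈ U → ∀ A B C : Π x : X, TangentSpace J x,
    SmoothFieldOn J A U → SmoothFieldOn J B U → SmoothFieldOn J C U → extDerivTwo J s A B C x = 0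

/-- At `x`, brackets of local sections of the complex distribution `D` have values in `D`. -/
def IsInvolutiveAt (D : Π x : X, Submodule ℂ (Cx (TangentSpace J x))) (x : X) : Prop :=
  ∀ U : Set X, IsOpen U → x ∈ U → ∀ P Q : Π x : X, Cx (TangentSpace J x),
    SmoothCxFieldOn J P U → SmoothCxFieldOn J Q U →
    (∀ x ∈ U, P x ∈ D x) → (∀ x ∈ U, Q x ∈ D x) → cxBracket J P Q x ∈ D x

variable {J}

theorem IsSmoothEndo.of_at {I : Π x : X, TangentSpace J x →ₗ[ℝ] TangentSpace J x}
    (h : ∀ x, IsSmoothEndoAt J I x) : IsSmoothEndo J I :=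
  fun U hU A hA x hx => (h x U hU hx A hA).contMDiffWithinAt

theorem IsSmoothBilin.of_at {s : Π x : X, TangentSpace J x →ₗ[ℝ] TangentSpace J x →ₗ[ℝ] K}
    (h : ∀ x, IsSmoothBilinAt J s x) : IsSmoothBilin J s :=
  fun U hU A B hA hB x hx => (h x U hU hx A B hA hB).contMDiffWithinAt

theorem IsClosedTwoForm.of_at {s : Π x : X, TangentSpace J x →ₗ[ℝ] TangentSpace J x →ₗ[ℝ] K}
    (h : ∀ x, IsClosedTwoFormAt J s x) : IsClosedTwoForm J s :=
  fun U hU A B C hA hB hC _ _ _ x hx => h x U hU hx A B C hA hB hC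

theorem IsInvolutive.of_at {D : Π x : X, Submodule ℂ (Cx (TangentSpace J x))}
    (h : ∀ x, IsInvolutiveAt J D x) : IsInvolutive J D :=
  fun U hU P Q hP hQ hPD hQD x hx => h x U hU hx P Q hP hQ hPD hQD

theorem IsSmoothEndo.at {I : Π x : X, TangentSpace J x →ₗ[ℝ] TangentSpace J x}
    (h : IsSmoothEndo J I) (x : X) : IsSmoothEndoAt J I x :=
  fun U hU hx A hA => (h U hU A hA).contMDiffAt (hU.mem_nhds hx)

theorem IsSmoothBilin.at {s : Π x : X, TangentSpace J x →ₗ[ℝ] TangentSpace J x →ₗ[ℝ] K}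
    (h : IsSmoothBilin J s) (x : X) : IsSmoothBilinAt J s x :=
  fun U hU hx A B hA hB => (h U hU A B hA hB).contMDiffAt (hU.mem_nhds hx)

theorem IsClosedTwoForm.at {s : Π x : X, TangentSpace J x →ₗ[ℝ] TangentSpace J x →ₗ[ℝ] K}
    (h : IsClosedTwoForm J s) (x : X) : IsClosedTwoFormAt J s x :=
  fun U hU hx A B C hA hB hC => h U hU A B C hA hB hC (fun _ _ => trivial) (fun _ _ => trivial)
    (fun _ _ => trivial) x hx

theorem IsInvolutive.at {D : Π x : X, Submodule ℂ (Cx (TangentSpace J x))}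
    (h : IsInvolutive J D) (x : X) : IsInvolutiveAt J D x :=
  fun U hU hx P Q hP hQ hPD hQD => h U hU P Q hP hQ hPD hQD x hx

end Local

section Transfer

variable {F₁ : Type*} [NormedAddCommGroup F₁] [NormedSpace ℝ F₁]
  {H₁ : Type*} [TopologicalSpace H₁] {I : ModelWithCorners ℝ F₁ H₁}
  {Y : Type*} [TopologicalSpace Y] [ChartedSpace H₁ Y]
  {F₂ : Type*} [NormedAddCommGroup F₂] [NormedSpace ℝ F₂]
  {H₂ : Type*} [TopologicalSpace H₂] {J : ModelWithCorners ℝ F₂ H₂}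
  {X : Type*} [TopologicalSpace X] [ChartedSpace H₂ X]
  {K : Type*} [NormedAddCommGroup K] [NormedSpace ℝ K]
  (Φ : PartialDiffeomorph I J Y X ∞)

/-- The differential of a partial diffeomorphism. -/
def pdiff (y : Y) : TangentSpace I y →L[ℝ] TangentSpace J (Φ y) := mfderiv I J Φ y

theorem pdiff_isInvertible {y : Y} (hy : y ∈ Φ.source) : (pdiff Φ y).IsInvertible :=
  ⟨(PartialDiffeomorph.isLocalDiffeomorphAt I J ∞ Φ hy).mfderivToContinuousLinearEquiv (by simp),
    rfl⟩

theorem isOpen_source_inter_preimage {U : Set X} (hU : IsOpen U) :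
    IsOpen (Φ.source ∩ Φ ⁻¹' U) :=
  Φ.contMDiffOn.continuousOn.isOpen_inter_preimage Φ.open_source hU

/-- Smoothness of a function can be tested after composition with a partial diffeomorphism. -/
theorem contMDiffAt_comp_iff {f : X → K} {y : Y} (hy : y ∈ Φ.source) {n : WithTop ℕ∞}
    (hn : n ≤ ∞) :
    ContMDiffAt I 𝓘(ℝ, K) n (fun z => f (Φ z)) y ↔ ContMDiffAt J 𝓘(ℝ, K) n f (Φ y) := by
  have h1 : ContMDiffAt I J n Φ y :=
    (Φ.contMDiffOn.contMDiffAt (Φ.open_source.mem_nhds hy)).of_le hn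
  have hΦy : Φ y ∈ Φ.target := Φ.map_source' hy
  have h2 : ContMDiffAt J I n Φ.symm (Φ y) :=
    (Φ.symm.contMDiffOn.contMDiffAt (Φ.open_target.mem_nhds hΦy)).of_le hn
  have hl : Φ.symm (Φ y) = y := Φ.left_inv' hy
  refine ⟨fun h => ?_, fun h => h.comp y h1⟩
  rw [← hl] at h
  refine (h.comp (Φ y) h2).congr_of_eventuallyEq ?_
  filter_upwards [Φ.open_target.mem_nhds hΦy] with x hx
  exact congrArg f (Φ.right_inv' hx).symm

theorem dirDeriv_pdiff {f : X → K} {y : Y} (hy : y ∈ Φ.source)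
    (hf : MDifferentiableAt J 𝓘(ℝ, K) f (Φ y)) (a : TangentSpace I y) :
    dirDeriv J f (Φ y) (pdiff Φ y a) = dirDeriv I (fun z => f (Φ z)) y a := by
  have := mfderiv_comp y hf (Φ.mdifferentiableAt (by simp) hy)
  exact (congrArg (fun l : TangentSpace I y →L[ℝ] K => l a) this).symm

theorem dirDeriv_eventuallyEq {f g : Y → K} {y : Y} (h : f =ᶠ[𝓝 y] g) (a : TangentSpace I y) :
    dirDeriv I f y a = dirDeriv I g y a :=
  congrArg (fun l : TangentSpace I y →L[ℝ] K => l a) h.mfderiv_eq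

theorem mfderiv_symm_pdiff {z : Y} (hz : z ∈ Φ.source) (a : TangentSpace I z) :
    (mfderiv J I Φ.symm (Φ z) (pdiff Φ z a) : F₁) = a := by
  have hd1 : MDifferentiableAt J I Φ.symm (Φ z) :=
    Φ.symm.mdifferentiableAt (by simp) (Φ.map_source' hz)
  have hd2 : MDifferentiableAt I J Φ z := Φ.mdifferentiableAt (by simp) hz
  have h1 := mfderiv_comp (I'' := I) z hd1 hd2
  have h2 : (fun w => Φ.symm (Φ w)) =ᶠ[𝓝 z] id := by
    filter_upwards [Φ.open_source.mem_nhds hz] with w hw using Φ.left_inv' hw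
  have h3 : mfderiv I I (Φ.symm ∘ Φ) z = mfderiv I I id z := h2.mfderiv_eq
  rw [h3, mfderiv_id] at h1
  exact (congrArg (fun l : F₁ →L[ℝ] F₁ => l a) h1).symm

variable [CompleteSpace F₁] [IsManifold I ∞ Y] [CompleteSpace F₂] [IsManifold J ∞ X]

theorem pdiff_mpullback {y : Y} (hy : y ∈ Φ.source) (A : Π x : X, TangentSpace J x) :
    pdiff Φ y (VectorField.mpullback I J Φ A y) = A (Φ y) :=
  (pdiff_isInvertible Φ hy).self_apply_inverse _

theorem smoothFieldOn_mpullback {A : Π x : X, TangentSpace J x} {U : Set X} (hU : IsOpen U)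
    (hA : SmoothFieldOn J A U) :
    SmoothFieldOn I (VectorField.mpullback I J Φ A) (Φ.source ∩ Φ ⁻¹' U) := by
  rintro y ⟨hy, hyU⟩
  exact (ContMDiffAt.mpullback_vectorField_preimage (n := ∞)
    ((hA _ hyU).contMDiffAt (hU.mem_nhds hyU))
    (Φ.contMDiffOn.contMDiffAt (Φ.open_source.mem_nhds hy)) (pdiff_isInvertible Φ hy)
    (by simp)).contMDiffWithinAt

theorem IsSmoothBilinAt.of_pullback
    {s : Π x : X, TangentSpace J x →ₗ[ℝ] TangentSpace J x →ₗ[ℝ] K}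
    {s' : Π y : Y, TangentSpace I y →ₗ[ℝ] TangentSpace I y →ₗ[ℝ] K} {y : Y} (hy : y ∈ Φ.source)
    (hs : ∀ᶠ z in 𝓝 y, ∀ a b, s' z a b = s (Φ z) (pdiff Φ z a) (pdiff Φ z b))
    (h : IsSmoothBilinAt I s' y) : IsSmoothBilinAt J s (Φ y) := by
  intro U hU hyU A B hA hB
  rw [← contMDiffAt_comp_iff Φ hy le_rfl]
  refine (h _ (isOpen_source_inter_preimage Φ hU) ⟨hy, hyU⟩ _ _ (smoothFieldOn_mpullback Φ hU hA)
    (smoothFieldOn_mpullback Φ hU hB)).congr_of_eventuallyEq ?_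
  filter_upwards [hs, Φ.open_source.mem_nhds hy] with z hz hzs
  rw [hz, pdiff_mpullback Φ hzs, pdiff_mpullback Φ hzs]

theorem pdiff_mlieBracket {y : Y} (hy : y ∈ Φ.source) {U : Set X} (hU : IsOpen U) (hyU : Φ y ∈ U)
    {A B : Π x : X, TangentSpace J x} (hA : SmoothFieldOn J A U) (hB : SmoothFieldOn J B U) :
    pdiff Φ y (VectorField.mlieBracket I (VectorField.mpullback I J Φ A)
      (VectorField.mpullback I J Φ B) y) = VectorField.mlieBracket J A B (Φ y) := by
  have : IsManifold I (minSmoothness ℝ 2) Y := by simpa using inferInstanceAs (IsManifold I 2 Y)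
  have : IsManifold J (minSmoothness ℝ 2) X := by simpa using inferInstanceAs (IsManifold J 2 X)
  rw [← VectorField.mpullback_mlieBracket (n := ∞)
    (((hA _ hyU).contMDiffAt (hU.mem_nhds hyU)).mdifferentiableAt (by simp))
    (((hB _ hyU).contMDiffAt (hU.mem_nhds hyU)).mdifferentiableAt (by simp))
    (Φ.contMDiffOn.contMDiffAt (Φ.open_source.mem_nhds hy))
    (by simpa using (by exact_mod_cast le_top : ((2 : ℕ∞) : WithTop ℕ∞) ≤ ∞)),
    pdiff_mpullback Φ hy]

/-- The exterior derivative of 2-forms commutes with pullbacks by partial diffeomorphisms. -/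
theorem extDerivTwo_pullback
    {s : Π x : X, TangentSpace J x →ₗ[ℝ] TangentSpace J x →ₗ[ℝ] K}
    {s' : Π y : Y, TangentSpace I y →ₗ[ℝ] TangentSpace I y →ₗ[ℝ] K} {y : Y} (hy : y ∈ Φ.source)
    (hs : ∀ᶠ z in 𝓝 y, ∀ a b, s' z a b = s (Φ z) (pdiff Φ z a) (pdiff Φ z b))
    (h : IsSmoothBilinAt I s' y) {U : Set X} (hU : IsOpen U) (hyU : Φ y ∈ U)
    {A B C : Π x : X, TangentSpace J x} (hA : SmoothFieldOn J A U) (hB : SmoothFieldOn J B U)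
    (hC : SmoothFieldOn J C U) :
    extDerivTwo J s A B C (Φ y) = extDerivTwo I s' (VectorField.mpullback I J Φ A)
      (VectorField.mpullback I J Φ B) (VectorField.mpullback I J Φ C) y := by
  have hX := h.of_pullback Φ hy hs
  have hd : ∀ {A B C : Π x : X, TangentSpace J x}, SmoothFieldOn J A U → SmoothFieldOn J B U →
      SmoothFieldOn J C U → dirDeriv J (fun x => s x (B x) (C x)) (Φ y) (A (Φ y))
        = dirDeriv I (fun z => s' z (VectorField.mpullback I J Φ B z)
          (VectorField.mpullback I J Φ C z)) y (VectorField.mpullback I J Φ A y) := by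
    intro A B C hA hB hC
    rw [← pdiff_mpullback Φ hy A, dirDeriv_pdiff Φ hy
      ((hX U hU hyU B C hB hC).mdifferentiableAt (by simp))]
    refine dirDeriv_eventuallyEq ?_ _
    filter_upwards [hs, Φ.open_source.mem_nhds hy] with z hz hzs
    rw [hz, pdiff_mpullback Φ hzs, pdiff_mpullback Φ hzs]
  have hb : ∀ {A B : Π x : X, TangentSpace J x} (C : Π x : X, TangentSpace J x),
      SmoothFieldOn J A U → SmoothFieldOn J B U →
      s (Φ y) (VectorField.mlieBracket J A B (Φ y)) (C (Φ y))
        = s' y (VectorField.mlieBracket I (VectorField.mpullback I J Φ A)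
          (VectorField.mpullback I J Φ B) y) (VectorField.mpullback I J Φ C y) := by
    intro A B C hA hB
    rw [hs.self_of_nhds, pdiff_mlieBracket Φ hy hU hyU hA hB, pdiff_mpullback Φ hy]
  unfold extDerivTwo
  rw [hd hA hB hC, hd hB hC hA, hd hC hA hB, hb C hA hB, hb A hB hC, hb B hC hA]

theorem IsClosedTwoFormAt.of_pullback
    {s : Π x : X, TangentSpace J x →ₗ[ℝ] TangentSpace J x →ₗ[ℝ] K}
    {s' : Π y : Y, TangentSpace I y →ₗ[ℝ] TangentSpace I y →ₗ[ℝ] K} {y : Y} (hy : y ∈ Φ.source)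
    (hs : ∀ᶠ z in 𝓝 y, ∀ a b, s' z a b = s (Φ z) (pdiff Φ z a) (pdiff Φ z b))
    (h : IsSmoothBilinAt I s' y) (hc : IsClosedTwoFormAt I s' y) :
    IsClosedTwoFormAt J s (Φ y) := by
  intro U hU hyU A B C hA hB hC
  rw [extDerivTwo_pullback Φ hy hs h hU hyU hA hB hC]
  exact hc _ (isOpen_source_inter_preimage Φ hU) ⟨hy, hyU⟩ _ _ _ (smoothFieldOn_mpullback Φ hU hA)
    (smoothFieldOn_mpullback Φ hU hB) (smoothFieldOn_mpullback Φ hU hC)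

/-- Involutivity can be tested after pullback by a partial diffeomorphism, as the Lie bracket is
natural. -/
theorem IsInvolutiveAt.of_pullback {D : Π x : X, Submodule ℂ (Cx (TangentSpace J x))}
    {D' : Π y : Y, Submodule ℂ (Cx (TangentSpace I y))} {y : Y} (hy : y ∈ Φ.source)
    (hD : ∀ᶠ z in 𝓝 y, ∀ w, w ∈ D' z ↔ Cx.map (pdiff Φ z : TangentSpace I z →ₗ[ℝ] _) w ∈ D (Φ z))
    (h : IsInvolutiveAt I D' y) : IsInvolutiveAt J D (Φ y) := by
  intro U hU hyU P Q hP hQ hPD hQD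
  obtain ⟨O, hO, hOo, hyO⟩ := eventually_nhds_iff.1 hD
  have hsm : ∀ {P : Π x : X, Cx (TangentSpace J x)}, SmoothCxFieldOn J P U →
      SmoothCxFieldOn I (fun z => (⟨VectorField.mpullback I J Φ (fun x => (P x).re) z,
        VectorField.mpullback I J Φ (fun x => (P x).im) z⟩ : Cx (TangentSpace I z)))
        ((Φ.source ∩ Φ ⁻¹' U) ∩ O) := fun hP =>
    ⟨(smoothFieldOn_mpullback Φ hU hP.1).mono Set.inter_subset_left,
      (smoothFieldOn_mpullback Φ hU hP.2).mono Set.inter_subset_left⟩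
  have hin : ∀ {P : Π x : X, Cx (TangentSpace J x)}, (∀ x ∈ U, P x ∈ D x) →
      ∀ z ∈ (Φ.source ∩ Φ ⁻¹' U) ∩ O,
        (⟨VectorField.mpullback I J Φ (fun x => (P x).re) z,
          VectorField.mpullback I J Φ (fun x => (P x).im) z⟩ : Cx (TangentSpace I z)) ∈ D' z := by
    rintro P hPD z ⟨⟨hz, hzU⟩, hzO⟩
    rw [hO z hzO]
    convert hPD _ hzU using 1
    ext
    · exact pdiff_mpullback Φ hz (fun x => (P x).re)
    · exact pdiff_mpullback Φ hz (fun x => (P x).im)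
  have h1 := h _ ((isOpen_source_inter_preimage Φ hU).inter hOo) ⟨⟨hy, hyU⟩, hyO⟩ _ _ (hsm hP)
    (hsm hQ) (hin hPD) (hin hQD)
  rw [hO y hyO] at h1
  convert h1 using 1
  ext
  · simp only [cxBracket, Cx.map_re, ContinuousLinearMap.coe_coe, map_sub]
    rw [pdiff_mlieBracket Φ hy hU hyU hP.1 hQ.1, pdiff_mlieBracket Φ hy hU hyU hP.2 hQ.2]
  · simp only [cxBracket, Cx.map_im, ContinuousLinearMap.coe_coe, map_add]
    rw [pdiff_mlieBracket Φ hy hU hyU hP.1 hQ.2, pdiff_mlieBracket Φ hy hU hyU hP.2 hQ.1]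

theorem mpullback_symm_apply (B : Π y : Y, TangentSpace I y) {z : Y} (hz : z ∈ Φ.source) :
    VectorField.mpullback J I Φ.symm B (Φ z) = pdiff Φ z (B z) := by
  have h1 : (mfderiv J I Φ.symm (Φ z)).IsInvertible := pdiff_isInvertible Φ.symm (Φ.map_source' hz)
  rw [VectorField.mpullback_apply, h1.inverse_apply_eq]
  have h2 : (B (Φ.symm (Φ z)) : F₁) = B z :=
    congrArg (fun w => (B w : F₁)) (Φ.left_inv' hz)
  exact h2.trans (mfderiv_symm_pdiff Φ hz (B z)).symm

/-- The pushforward of a smooth vector field by a partial diffeomorphism is smooth. -/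
theorem contMDiffAt_pushforward {B : Π y : Y, TangentSpace I y} {y : Y} (hy : y ∈ Φ.source)
    (hB : ContMDiffAt I I.tangent ∞ (fun z => (⟨z, B z⟩ : TangentBundle I Y)) y) :
    ContMDiffAt J J.tangent ∞ (fun x =>
      (⟨x, VectorField.mpullback J I Φ.symm B x⟩ : TangentBundle J X)) (Φ y) := by
  have hl : Φ.symm (Φ y) = y := Φ.left_inv' hy
  have hy' : Φ y ∈ Φ.symm.source := Φ.map_source' hy
  rw [← hl] at hB
  exact ContMDiffAt.mpullback_vectorField_preimage (n := ∞) hB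
    (Φ.symm.contMDiffOn.contMDiffAt (Φ.symm.open_source.mem_nhds hy'))
    (pdiff_isInvertible Φ.symm hy') (by simp)

theorem IsSmoothEndoAt.of_pullback {S : Π x : X, TangentSpace J x →ₗ[ℝ] TangentSpace J x}
    {S' : Π y : Y, TangentSpace I y →ₗ[ℝ] TangentSpace I y} {y : Y} (hy : y ∈ Φ.source)
    (hS : ∀ᶠ z in 𝓝 y, ∀ a, pdiff Φ z (S' z a) = S (Φ z) (pdiff Φ z a))
    (h : IsSmoothEndoAt I S' y) : IsSmoothEndoAt J S (Φ y) := by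
  intro U hU hyU A hA
  have h1 := contMDiffAt_pushforward Φ hy (h _ (isOpen_source_inter_preimage Φ hU) ⟨hy, hyU⟩ _
    (smoothFieldOn_mpullback Φ hU hA))
  refine h1.congr_of_eventuallyEq ?_
  have h2 : Filter.Tendsto Φ.symm (𝓝 (Φ y)) (𝓝 y) := by
    have h3 : Φ.symm (Φ y) = y := Φ.left_inv' hy
    have h4 := (Φ.symm.contMDiffOn.contMDiffAt
      (Φ.symm.open_source.mem_nhds (Φ.map_source' hy))).continuousAt
    rwa [ContinuousAt, h3] at h4
  filter_upwards [Φ.open_target.mem_nhds (Φ.map_source' hy), h2.eventually hS] with x hx hz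
  have hxz : Φ (Φ.symm x) = x := Φ.right_inv' hx
  have hzs : Φ.symm x ∈ Φ.source := Φ.map_target' hx
  generalize Φ.symm x = z at hxz hz hzs
  subst hxz
  rw [mpullback_symm_apply Φ _ hzs, hz, pdiff_mpullback Φ hzs]

end Transfer

/-! ### Criteria on vector spaces -/

section VectorSpaceTensors

variable {W : Type*} [NormedAddCommGroup W] [NormedSpace ℝ W]
  {K : Type*} [NormedAddCommGroup K] [NormedSpace ℝ K]

theorem SmoothFieldOn.contDiffAt {A : W → W} {U : Set W} (hU : IsOpen U)
    (hA : SmoothFieldOn 𝓘(ℝ, W) A U) {x : W} (hx : x ∈ U) : ContDiffAt ℝ ∞ A x :=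
  ((contMDiffOn_vectorSpace_iff_contDiffOn (V := A)).1 hA).contDiffAt (hU.mem_nhds hx)

theorem smoothFieldOn_of_contDiffOn {A : W → W} {U : Set W} (hA : ContDiffOn ℝ ∞ A U) :
    SmoothFieldOn 𝓘(ℝ, W) A U :=
  (contMDiffOn_vectorSpace_iff_contDiffOn (V := A)).2 hA

theorem isSmoothBilinAt_of_contDiffAt {s : W → W →ₗ[ℝ] W →ₗ[ℝ] K} {S : W → W →L[ℝ] W →L[ℝ] K}
    {x : W} (hs : ∀ᶠ y in 𝓝 x, ∀ a b, s y a b = S y a b) (hS : ContDiffAt ℝ ∞ S x) :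
    IsSmoothBilinAt 𝓘(ℝ, W) s x := by
  intro U hU hx A B hA hB
  have h1 : ContDiffAt ℝ ∞ (fun y => S y (A y) (B y)) x :=
    (hS.clm_apply (hA.contDiffAt hU hx)).clm_apply (hB.contDiffAt hU hx)
  refine h1.contMDiffAt.congr_of_eventuallyEq ?_
  filter_upwards [hs] with y hy using hy _ _

theorem isClosedTwoFormAt_of_cyclic {s : W → W →ₗ[ℝ] W →ₗ[ℝ] K} {S : W → W →L[ℝ] W →L[ℝ] K}
    {S' : W →L[ℝ] W →L[ℝ] W →L[ℝ] K} {x : W} (hs : ∀ᶠ y in 𝓝 x, ∀ a b, s y a b = S y a b)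
    (hS : HasFDerivAt S S' x) (halt : ∀ a b, S x a b = -S x b a)
    (hc : ∀ a b c, S' a b c + S' b c a + S' c a b = 0) : IsClosedTwoFormAt 𝓘(ℝ, W) s x := by
  intro U hU hx A B C hA hB hC
  have h1 := extDerivTwo_eq_cyclic_sum hs hS halt
    ((hA.contDiffAt hU hx).differentiableAt (by simp))
    ((hB.contDiffAt hU hx).differentiableAt (by simp))
    ((hC.contDiffAt hU hx).differentiableAt (by simp))
  exact h1.trans (hc _ _ _)

theorem isSmoothEndoAt_of_contDiffAt {I : W → W →ₗ[ℝ] W} {S : W → W →L[ℝ] W}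
    {x : W} (hs : ∀ᶠ y in 𝓝 x, ∀ a, I y a = S y a) (hS : ContDiffAt ℝ ∞ S x) :
    IsSmoothEndoAt 𝓘(ℝ, W) I x := by
  intro U hU hx A hA
  have h1 : ContDiffAt ℝ ∞ (fun y => I y (A y)) x := by
    refine (hS.clm_apply (hA.contDiffAt hU hx)).congr_of_eventuallyEq ?_
    filter_upwards [hs] with y hy using hy _
  exact (contMDiffAt_vectorSpace_iff_contDiffAt (V := fun y => I y (A y))).2 h1

end VectorSpaceTensors

/-! ### Darboux frames -/

namespace LatticePeriodStructure

variable {E : Type*} [NormedAddCommGroup E] [NormedSpace ℂ E]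
  {M : Type*} [TopologicalSpace M] [ChartedSpace E M] [IsManifold 𝓘(ℂ, E) ω M]
  (P : LatticePeriodStructure E M)

/-- The Darboux frame around `p` as a basis of `T_q M`. -/
def basisAt (p : M) {q : M} (hq : q ∈ P.frameDom p) :
    Module.Basis (FrameIdx E) ℝ (TangentSpace 𝓘(ℝ, E) q) :=
  (P.isDarbouxFrame p).isFrame.toBasisAt hq

@[simp] theorem basisAt_apply (p : M) {q : M} (hq : q ∈ P.frameDom p) (a : FrameIdx E) :
    P.basisAt p hq a = P.frameField p a q :=
  (P.isDarbouxFrame p).isFrame.toBasisAt_coe hq a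

theorem coeff_eq_repr (p : M) {q : M} (hq : q ∈ P.frameDom p) (a : FrameIdx E)
    (t : TangentSpace 𝓘(ℝ, E) q) : P.coeff p a q t = (P.basisAt p hq).repr t a := by
  simp [coeff, IsLocalFrameOn.coeff, hq, basisAt]

theorem sum_coeff (p : M) {q : M} (hq : q ∈ P.frameDom p) (t : TangentSpace 𝓘(ℝ, E) q) :
    ∑ a, P.coeff p a q t • P.frameField p a q = t := by
  simp only [P.coeff_eq_repr p hq, ← P.basisAt_apply p hq]
  exact (P.basisAt p hq).sum_repr t

theorem coeff_sum (p : M) {q : M} (hq : q ∈ P.frameDom p) (x : FrameIdx E → ℝ) (b : FrameIdx E) :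
    P.coeff p b q (∑ a, x a • P.frameField p a q) = x b := by
  simp only [P.coeff_eq_repr p hq, ← P.basisAt_apply p hq]
  rw [Module.Basis.repr_sum_self]

theorem coeff_frameField (p : M) {q : M} (hq : q ∈ P.frameDom p) (a b : FrameIdx E) :
    P.coeff p b q (P.frameField p a q) = if a = b then 1 else 0 := by
  rw [P.coeff_eq_repr p hq, ← P.basisAt_apply p hq, Module.Basis.repr_self, Finsupp.single_apply]

theorem isOpen_frameDom (p : M) : IsOpen (P.frameDom p) := (P.isDarbouxFrame p).isOpen

theorem frameField_contMDiffAt (p : M) {q : M} (hq : q ∈ P.frameDom p) (a : FrameIdx E) :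
    ContMDiffAt 𝓘(ℝ, E) 𝓘(ℝ, E).tangent ∞
      (fun r => (⟨r, P.frameField p a r⟩ : TB E M)) q :=
  (P.isDarbouxFrame p).isFrame.contMDiffAt (P.isOpen_frameDom p) hq a

theorem omega_apply (q : M) (t u : TangentSpace 𝓘(ℝ, E) q) :
    P.omega q t u = ∑ i, (P.coeff q (.inl i) q t * P.coeff q (.inr i) q u
      - P.coeff q (.inr i) q t * P.coeff q (.inl i) q u) := by
  simp [omega, LinearMap.sum_apply]

/-- The form `ω` restricts to the integral pairing on `Γ`. -/
theorem omega_eq_pairing (q : M) (γ δ : P.Γ q) : P.omega q γ δ = P.pairing q γ δ := by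
  have hq := P.mem_frameDom q
  have h1 : ∀ a b, P.omega q (P.frame q a q) (P.frame q b q)
      = P.pairing q (P.frame q a q) (P.frame q b q) := by
    intro a b
    rw [(P.isDarbouxFrame q).pairing_eq q hq, omega_apply]
    have h2 : ∀ a b, P.coeff q b q (P.frame q a q) = if a = b then 1 else 0 :=
      fun a b => P.coeff_frameField q hq a b
    rcases a with i | i <;> rcases b with j | j <;> simp [h2, darboux, eq_comm]
    split_ifs <;> simp
  have h4 : ∀ (n : ℤ) (t : TangentSpace 𝓘(ℝ, E) q), n • t = (n : ℝ) • t := fun n t =>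
    (Int.cast_smul_eq_zsmul ℝ n t).symm
  have h3 : ∀ γ : P.Γ q, ∃ m : FrameIdx E → ℤ, γ = ∑ a, m a • P.frame q a q := by
    intro γ
    choose m hm using P.coeff_int q q hq γ
    refine ⟨m, Subtype.ext ?_⟩
    conv_lhs => rw [← P.sum_coeff q hq (γ : TangentSpace 𝓘(ℝ, E) q)]
    rw [AddSubgroup.val_finsetSum]
    refine Finset.sum_congr rfl fun a _ => ?_
    rw [hm, AddSubgroup.coe_zsmul, h4, frameField]
  obtain ⟨m, rfl⟩ := h3 γ
  obtain ⟨k, rfl⟩ := h3 δ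
  simp only [AddSubgroup.val_finsetSum, AddSubgroup.coe_zsmul, h4, map_sum, map_smul,
    LinearMap.sum_apply, LinearMap.smul_apply, h1, AddMonoidHom.finsetSum_apply, map_zsmul,
    smul_eq_mul, Int.cast_sum, Int.cast_mul, AddMonoidHom.zsmul_apply]

theorem omega_frameField (p : M) {q : M} (hq : q ∈ P.frameDom p) (a b : FrameIdx E) :
    P.omega q (P.frameField p a q) (P.frameField p b q) = darboux E a b := by
  rw [frameField, frameField, omega_eq_pairing, (P.isDarbouxFrame p).pairing_eq q hq]

variable [FiniteDimensional ℂ E]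

/-- The coefficients in a Darboux frame are smooth functions on `TM`. -/
theorem contMDiffAt_coeff (p : M) {V : TB E M} (hV : V.proj ∈ P.frameDom p) :
    ContMDiffAt 𝓘(ℝ, E).tangent 𝓘(ℝ, FrameIdx E → ℝ) ∞
      (fun W : TB E M => fun a => P.coeff p a W.proj W.2) V := by
  have : CompleteSpace E := FiniteDimensional.complete ℝ E
  have hF := P.isDarbouxFrame p
  set e := trivializationAt E (TangentSpace 𝓘(ℝ, E)) V.proj with he
  have hpb : V.proj ∈ e.baseSet := FiberBundle.mem_baseSet_trivializationAt' V.proj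
  let L : M → ((FrameIdx E → ℝ) →L[ℝ] E) := fun q =>
    ∑ a, (ContinuousLinearMap.proj a : (FrameIdx E → ℝ) →L[ℝ] ℝ).smulRight
      ((e ⟨q, P.frameField p a q⟩).2)
  have hL : ContMDiffAt 𝓘(ℝ, E) 𝓘(ℝ, (FrameIdx E → ℝ) →L[ℝ] E) ∞ L V.proj := by
    refine contMDiffAt_finsetSum fun a _ => ?_
    have h2 : ContMDiffAt 𝓘(ℝ, E) 𝓘(ℝ, E) ∞ (fun q => (e ⟨q, P.frameField p a q⟩).2) V.proj :=
      (Bundle.contMDiffAt_totalSpace.1 (P.frameField_contMDiffAt p hV a)).2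
    exact ((ContinuousLinearMap.smulRightL ℝ (FrameIdx E → ℝ) E
      (ContinuousLinearMap.proj a)).contDiff.contMDiff.contMDiffAt).comp _ h2
  have hequiv : ∀ q, q ∈ P.frameDom p → q ∈ e.baseSet → ∃ l : (FrameIdx E → ℝ) ≃L[ℝ] E,
      L q = l ∧ ∀ t : TangentSpace 𝓘(ℝ, E) q, l (fun a => P.coeff p a q t) = (e ⟨q, t⟩).2 := by
    intro q hq hqb
    let l := ((P.basisAt p hq).equivFun.symm.trans
      (e.linearEquivAt ℝ q hqb)).toContinuousLinearEquiv
    have key : ∀ t : TangentSpace 𝓘(ℝ, E) q, l (fun a => P.coeff p a q t) = (e ⟨q, t⟩).2 := by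
      intro t
      have : (fun a => P.coeff p a q t) = (P.basisAt p hq).equivFun t := by
        ext a
        rw [P.coeff_eq_repr p hq]
        rfl
      rw [this]
      show (e.linearEquivAt ℝ q hqb) ((P.basisAt p hq).equivFun.symm
        ((P.basisAt p hq).equivFun t)) = _
      rw [LinearEquiv.symm_apply_apply]
      rfl
    refine ⟨l, ?_, key⟩
    refine ContinuousLinearMap.ext fun x => ?_
    show L q x = (e.linearEquivAt ℝ q hqb) ((P.basisAt p hq).equivFun.symm x)
    rw [Module.Basis.equivFun_symm_apply, map_sum, sum_apply]
    refine Finset.sum_congr rfl fun a _ => ?_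
    rw [map_smul, P.basisAt_apply]
    rfl
  have hpr : ContMDiffAt 𝓘(ℝ, E).tangent 𝓘(ℝ, E) ∞ (fun W : TB E M => W.proj) V :=
    Bundle.contMDiff_proj (TangentSpace 𝓘(ℝ, E)) V
  have hev : ∀ᶠ W : TB E M in 𝓝 V, W.proj ∈ P.frameDom p ∧ W.proj ∈ e.baseSet :=
    hpr.continuousAt.eventually
      ((hF.isOpen.inter e.open_baseSet).mem_nhds ⟨hV, hpb⟩)
  have h1 : ContMDiffAt 𝓘(ℝ, E).tangent 𝓘(ℝ, E) ∞ (fun W : TB E M => (e W).2) V :=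
    (Bundle.contMDiffAt_totalSpace.1 (contMDiffAt_id (I := 𝓘(ℝ, E).tangent) (n := ∞)
      (x := V))).2
  obtain ⟨l, hl, -⟩ := hequiv V.proj hV hpb
  have h2 : ContMDiffAt 𝓘(ℝ, E).tangent 𝓘(ℝ, E →L[ℝ] (FrameIdx E → ℝ)) ∞
      (fun W : TB E M => (L W.proj).inverse) V := by
    have h3 : ContMDiffAt 𝓘(ℝ, (FrameIdx E → ℝ) →L[ℝ] E) 𝓘(ℝ, E →L[ℝ] (FrameIdx E → ℝ)) ∞
        (ContinuousLinearMap.inverse (R := ℝ) (M := FrameIdx E → ℝ) (M₂ := E))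
        (L V.proj) := by
      rw [hl]
      exact (contDiffAt_map_inverse l).contMDiffAt
    exact h3.comp V (hL.comp V hpr)
  refine (h2.clm_apply h1).congr_of_eventuallyEq ?_
  filter_upwards [hev] with W hW
  obtain ⟨l', hl', hl''⟩ := hequiv W.proj hW.1 hW.2
  rw [hl', ContinuousLinearMap.inverse_equiv]
  exact ((l'.symm_apply_eq).2 (hl'' W.2).symm).symm

/-- Two Darboux frames differ by a locally constant matrix. -/
theorem eventually_coeff_frameField (p : M) {r : M} (hr : r ∈ P.frameDom p) (a b : FrameIdx E) :
    ∀ᶠ q in 𝓝 r, P.coeff p a q (P.frameField r b q) = P.coeff p a r (P.frameField r b r) := by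
  have hrr := P.mem_frameDom r
  have h1 : ContinuousAt (fun q => P.coeff p a q (P.frameField r b q)) r := by
    have h2 := (P.contMDiffAt_coeff p (V := ⟨r, P.frameField r b r⟩) hr).continuousAt
    have h3 := ContinuousAt.comp (f := fun q => (⟨q, P.frameField r b q⟩ : TB E M)) h2
      (P.frameField_contMDiffAt r hrr b).continuousAt
    exact (continuous_apply a).continuousAt.comp h3
  have h4 := h1 (Metric.ball_mem_nhds _ one_pos)
  filter_upwards [h4, (P.isOpen_frameDom p).mem_nhds hr] with q hq hqp
  obtain ⟨m, hm⟩ := P.coeff_int p q hqp (P.frame r b q) a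
  obtain ⟨k, hk⟩ := P.coeff_int p r hr (P.frame r b r) a
  simp only [Set.mem_preimage, Metric.mem_ball, frameField] at hq ⊢
  rw [hm, hk, Real.dist_eq, abs_lt] at hq
  -- the coefficients are integers, hence locally constant by continuity
  have h5 : m - k < 1 := by exact_mod_cast hq.2
  have h6 : -1 < m - k := by exact_mod_cast hq.1
  have h7 : m = k := by omega
  rw [hm, hk, h7]

/-- The flat extension of `V` has constant coefficients in any Darboux frame. -/
theorem eventually_flatExt (p : M) {V : TB E M} (hV : V.proj ∈ P.frameDom p) :
    ∀ᶠ q in 𝓝 V.proj, P.flatExt V q = ∑ a, P.coeff p a V.proj V.2 • P.frameField p a q := by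
  have h1 : ∀ᶠ q in 𝓝 V.proj, ∀ a b, P.coeff p a q (P.frameField V.proj b q)
      = P.coeff p a V.proj (P.frameField V.proj b V.proj) := by
    simp only [Filter.eventually_all]
    exact fun a b => P.eventually_coeff_frameField p hV a b
  filter_upwards [h1, (P.isOpen_frameDom p).mem_nhds hV] with q hq hqp
  rw [← P.sum_coeff p hqp (P.flatExt V q)]
  refine Finset.sum_congr rfl fun a _ => ?_
  congr 1
  conv_rhs => rw [← P.sum_coeff V.proj (P.mem_frameDom V.proj) V.2]
  simp only [flatExt, map_sum, map_smul, hq]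

end LatticePeriodStructure

/-! ### Adapted charts of `TM` -/

namespace LatticePeriodStructure

variable {E : Type*} [NormedAddCommGroup E] [NormedSpace ℂ E]
  {M : Type*} [TopologicalSpace M] [ChartedSpace E M] [IsManifold 𝓘(ℂ, E) ω M]
  (P : LatticePeriodStructure E M)

/-- The linear coordinates of `TM`: the space `E × ℝ^{2n}` in which the adapted charts take their
values. -/
abbrev CoordSpace (E : Type*) [NormedAddCommGroup E] [NormedSpace ℂ E] : Type _ :=
  E × (FrameIdx E → ℝ)

/-- The inverse of the adapted chart of `TM` around the fibre over `p`, given by a chart of `M` and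
a Darboux frame. -/
def adaptedFun (p : M) (w : CoordSpace E) : TB E M :=
  ⟨(extChartAt 𝓘(ℝ, E) p).symm w.1,
    ∑ a, w.2 a • P.frameField p a ((extChartAt 𝓘(ℝ, E) p).symm w.1)⟩

/-- The domain in `E × ℝ^{2n}` of the adapted chart. -/
def adaptedDom (p : M) : Set (CoordSpace E) :=
  {w | w.1 ∈ (extChartAt 𝓘(ℝ, E) p).target ∧ (extChartAt 𝓘(ℝ, E) p).symm w.1 ∈ P.frameDom p}

theorem contMDiffAt_extChartAt_symm_of_mem {p : M} {z : E}
    (hz : z ∈ (extChartAt 𝓘(ℝ, E) p).target) :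
    ContMDiffAt 𝓘(ℝ, E) 𝓘(ℝ, E) ∞ (extChartAt 𝓘(ℝ, E) p).symm z :=
  (contMDiffOn_extChartAt_symm p).contMDiffAt ((isOpen_extChartAt_target p).mem_nhds hz)

theorem isOpen_adaptedDom (p : M) : IsOpen (P.adaptedDom p) := by
  have h1 : IsOpen ((extChartAt 𝓘(ℝ, E) p).target ∩
      (extChartAt 𝓘(ℝ, E) p).symm ⁻¹' P.frameDom p) :=
    (contMDiffOn_extChartAt_symm (I := 𝓘(ℝ, E)) (n := ∞) p).continuousOn.isOpen_inter_preimage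
      (isOpen_extChartAt_target p) (P.isOpen_frameDom p)
  exact h1.preimage continuous_fst

/-- A vector field along a map is smooth if its coefficients in a Darboux frame are smooth. -/
theorem contMDiffAt_sum_smul_frame {N : Type*} [TopologicalSpace N] {E' H' : Type*}
    [NormedAddCommGroup E'] [NormedSpace ℝ E'] [TopologicalSpace H'] [ChartedSpace H' N]
    {J : ModelWithCorners ℝ E' H'} (p : M) {f : N → M} {x : FrameIdx E → N → ℝ} {y : N}
    (hf : ContMDiffAt J 𝓘(ℝ, E) ∞ f y) (hy : f y ∈ P.frameDom p)
    (hx : ∀ a, ContMDiffAt J 𝓘(ℝ, ℝ) ∞ (x a) y) :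
    ContMDiffAt J 𝓘(ℝ, E).tangent ∞
      (fun z => (⟨f z, ∑ a, x a z • P.frameField p a (f z)⟩ : TB E M)) y := by
  set e := trivializationAt E (TangentSpace 𝓘(ℝ, E)) (f y) with he
  refine Bundle.contMDiffAt_totalSpace.2 ⟨hf, ?_⟩
  have h1 : ContMDiffAt J 𝓘(ℝ, E) ∞
      (fun z => ∑ a, x a z • (e ⟨f z, P.frameField p a (f z)⟩).2) y := by
    refine contMDiffAt_finsetSum fun a _ => (hx a).smul ?_
    have h2 : ContMDiffAt 𝓘(ℝ, E) 𝓘(ℝ, E) ∞ (fun q => (e ⟨q, P.frameField p a q⟩).2) (f y) :=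
      (Bundle.contMDiffAt_totalSpace.1 (P.frameField_contMDiffAt p hy a)).2
    exact h2.comp y hf
  refine h1.congr_of_eventuallyEq ?_
  have hb : ∀ᶠ z in 𝓝 y, f z ∈ e.baseSet :=
    hf.continuousAt.eventually (e.open_baseSet.mem_nhds
      (FiberBundle.mem_baseSet_trivializationAt' (f y)))
  filter_upwards [hb] with z hz
  show (e ⟨f z, ∑ a, x a z • P.frameField p a (f z)⟩).2 = _
  have hl : ∀ t, (e ⟨f z, t⟩).2 = e.linearEquivAt ℝ (f z) hz t := fun t => rfl
  simp only [hl, map_sum, map_smul]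

variable [FiniteDimensional ℂ E]

/-- The adapted chart of `TM` around the fibre over `p`. -/
def adapted (p : M) :
    PartialDiffeomorph 𝓘(ℝ, CoordSpace E) 𝓘(ℝ, E).tangent (CoordSpace E) (TB E M) ∞ where
  toFun := P.adaptedFun p
  invFun V := (extChartAt 𝓘(ℝ, E) p V.proj, fun a => P.coeff p a V.proj V.2)
  source := P.adaptedDom p
  target := {V | V.proj ∈ (extChartAt 𝓘(ℝ, E) p).source ∩ P.frameDom p}
  map_source' := fun w hw => ⟨(extChartAt 𝓘(ℝ, E) p).map_target hw.1, hw.2⟩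
  map_target' := fun V hV => ⟨(extChartAt 𝓘(ℝ, E) p).map_source hV.1, by
    simpa only [(extChartAt 𝓘(ℝ, E) p).left_inv hV.1] using hV.2⟩
  left_inv' := fun w hw => by
    ext a
    · exact (extChartAt 𝓘(ℝ, E) p).right_inv hw.1
    · exact P.coeff_sum p hw.2 w.2 a
  right_inv' := fun V hV => by
    have h1 := (extChartAt 𝓘(ℝ, E) p).left_inv hV.1
    have h2 : ∀ q, q = V.proj → (⟨q, ∑ a, P.coeff p a V.proj V.2 • P.frameField p a q⟩ : TB E M)
        = V := by
      rintro q rfl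
      rw [P.sum_coeff p hV.2]
    exact h2 _ h1
  open_source := P.isOpen_adaptedDom p
  open_target := ((isOpen_extChartAt_source p).inter (P.isOpen_frameDom p)).preimage
    (FiberBundle.continuous_proj E (TangentSpace 𝓘(ℝ, E)))
  contMDiffOn_toFun := fun w hw => by
    refine (P.contMDiffAt_sum_smul_frame p (f := fun w : CoordSpace E =>
      (extChartAt 𝓘(ℝ, E) p).symm w.1) (x := fun a w => w.2 a) ?_ hw.2 ?_).contMDiffWithinAt
    · exact (contMDiffAt_extChartAt_symm_of_mem hw.1).comp w contDiff_fst.contMDiff.contMDiffAt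
    · exact fun a => ((contDiff_apply ℝ ℝ a).comp contDiff_snd).contMDiff.contMDiffAt
  contMDiffOn_invFun := fun V hV => by
    have hpr : ContMDiffAt 𝓘(ℝ, E).tangent 𝓘(ℝ, E) ∞ (fun W : TB E M => W.proj) V :=
      Bundle.contMDiff_proj (TangentSpace 𝓘(ℝ, E)) V
    exact (((contMDiffAt_extChartAt' (by simpa using hV.1)).comp V hpr).prodMk_space
      (P.contMDiffAt_coeff p hV.2)).contMDiffWithinAt

/-- The differential of the inverse of the chart of `M` around `p`. -/
def baseDiff (p : M) (z : E) :
    E →L[ℝ] TangentSpace 𝓘(ℝ, E) ((extChartAt 𝓘(ℝ, E) p).symm z) :=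
  mfderiv 𝓘(ℝ, E) 𝓘(ℝ, E) (extChartAt 𝓘(ℝ, E) p).symm z

theorem baseDiff_isInvertible {p : M} {z : E} (hz : z ∈ (extChartAt 𝓘(ℝ, E) p).target) :
    (baseDiff p z).IsInvertible := by
  have h := isInvertible_mfderivWithin_extChartAt_symm (I := 𝓘(ℝ, E)) hz
  rw [ModelWithCorners.range_eq_univ, mfderivWithin_univ] at h
  exact h

/-- The charts of `M` are holomorphic: their differentials intertwine `I` with multiplication by
`i`. -/
theorem cplx_baseDiff {p : M} {z : E} (hz : z ∈ (extChartAt 𝓘(ℝ, E) p).target) (e : E) :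
    cplx E ((extChartAt 𝓘(ℝ, E) p).symm z) (baseDiff p z e) = baseDiff p z (Complex.I • e) := by
  have hc : MDifferentiableAt 𝓘(ℂ, E) 𝓘(ℂ, E) (extChartAt 𝓘(ℂ, E) p).symm z :=
    ((contMDiffOn_extChartAt_symm (I := 𝓘(ℂ, E)) (n := ω) p).contMDiffAt
      ((isOpen_extChartAt_target p).mem_nhds hz)).mdifferentiableAt (by simp)
  have h1 := hc.hasMFDerivAt
  set D : E →L[ℂ] E := mfderiv 𝓘(ℂ, E) 𝓘(ℂ, E) (extChartAt 𝓘(ℂ, E) p).symm z with hD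
  have h2 : HasMFDerivAt 𝓘(ℝ, E) 𝓘(ℝ, E) (extChartAt 𝓘(ℝ, E) p).symm z
      (D.restrictScalars ℝ : E →L[ℝ] E) :=
    ⟨h1.1, HasFDerivWithinAt.restrictScalars ℝ h1.2⟩
  have h3 : ∀ e, baseDiff p z e = D e := fun e => by
    rw [baseDiff, h2.mfderiv]
    rfl
  rw [h3, h3, map_smul]
  rfl

variable {p : M} {w : CoordSpace E}

/-- In an adapted chart, the horizontal lifts of the flat connection are the constant vectors `(e,
0)`, since flat sections have constant coefficients in a Darboux frame. -/
theorem pdiff_adapted_horizontal (hw : w ∈ P.adaptedDom p) (e : E) :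
    pdiff (P.adapted p) w (e, 0)
      = P.horiz (P.adaptedFun p w) (baseDiff p w.1 e) := by
  set V := P.adaptedFun p w with hV
  have hΦ : MDifferentiableAt 𝓘(ℝ, CoordSpace E) 𝓘(ℝ, E).tangent (P.adapted p) w :=
    (P.adapted p).mdifferentiableAt (by simp) hw
  have hin : HasMFDerivAt 𝓘(ℝ, E) 𝓘(ℝ, CoordSpace E) (fun z : E => (z, w.2)) w.1
      (ContinuousLinearMap.inl ℝ E (FrameIdx E → ℝ)) :=
    (hasFDerivAt_prodMk_left w.1 w.2).hasMFDerivAt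
  have h1 := (hΦ.hasMFDerivAt).comp (I := 𝓘(ℝ, E)) (f := fun z : E => (z, w.2)) w.1 hin
  have hs : MDifferentiableAt 𝓘(ℝ, E) 𝓘(ℝ, E) (extChartAt 𝓘(ℝ, E) p).symm w.1 :=
    (contMDiffAt_extChartAt_symm_of_mem hw.1).mdifferentiableAt (by simp)
  have hflat := P.eventually_flatExt p (V := V) hw.2
  have hσ : MDifferentiableAt 𝓘(ℝ, E) 𝓘(ℝ, E).tangent (fun q => (⟨q, P.flatExt V q⟩ : TB E M))
      V.proj := by
    have h2 := P.contMDiffAt_sum_smul_frame p (f := id) (y := V.proj) (J := 𝓘(ℝ, E))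
      (x := fun a _ => P.coeff p a V.proj V.2) contMDiffAt_id hw.2 (fun a => contMDiffAt_const)
    refine (h2.congr_of_eventuallyEq ?_).mdifferentiableAt (by simp)
    filter_upwards [hflat] with q hq
    rw [hq]
    rfl
  have h3 := (hσ.hasMFDerivAt).comp (I := 𝓘(ℝ, E)) (f := (extChartAt 𝓘(ℝ, E) p).symm) w.1
    hs.hasMFDerivAt
  have h4 : ((fun q => (⟨q, P.flatExt V q⟩ : TB E M)) ∘ (extChartAt 𝓘(ℝ, E) p).symm)
      =ᶠ[𝓝 w.1] (P.adapted p ∘ fun z : E => (z, w.2)) := by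
    filter_upwards [(contMDiffAt_extChartAt_symm_of_mem hw.1).continuousAt.eventually hflat]
      with z hz
    show (⟨_, P.flatExt V _⟩ : TB E M) = P.adaptedFun p (z, w.2)
    rw [hz]
    have h5 : ∀ a, P.coeff p a V.proj V.2 = w.2 a := fun a => P.coeff_sum p hw.2 w.2 a
    simp only [h5]
    rfl
  have h6 := h1.mfderiv.symm.trans (h4.symm.mfderiv_eq.trans h3.mfderiv)
  exact congrArg (fun l : E →L[ℝ] E × E => l e) h6

theorem contMDiff_fibreIncl (r : M) :
    ContMDiff 𝓘(ℝ, E) 𝓘(ℝ, E).tangent ∞ (fun u : E => (fibreIncl r u : TB E M)) := by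
  intro u
  set e := trivializationAt E (TangentSpace 𝓘(ℝ, E)) r with he
  have hr : r ∈ e.baseSet := FiberBundle.mem_baseSet_trivializationAt' r
  refine Bundle.contMDiffAt_totalSpace.2 ⟨contMDiffAt_const, ?_⟩
  have h1 : ContDiff ℝ ∞ (fun u : E => (e.continuousLinearEquivAt ℝ r hr :
      TangentSpace 𝓘(ℝ, E) r →L[ℝ] E) u) :=
    ContinuousLinearMap.contDiff (E := E) (F := E) (𝕜 := ℝ) _
  exact h1.contMDiff.contMDiffAt

/-- The vector with given coordinates in the Darboux frame around `p`. -/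
def frameSum (p r : M) : (FrameIdx E → ℝ) →ₗ[ℝ] TangentSpace 𝓘(ℝ, E) r where
  toFun x := ∑ a, x a • P.frameField p a r
  map_add' x y := by simp only [Pi.add_apply, add_smul, Finset.sum_add_distrib]
  map_smul' c x := by simp only [Pi.smul_apply, smul_eq_mul, mul_smul, Finset.smul_sum,
    RingHom.id_apply]

theorem frameSum_apply (p r : M) (x : FrameIdx E → ℝ) :
    P.frameSum p r x = ∑ a, x a • P.frameField p a r := rfl

theorem coeff_frameSum {r : M} (hr : r ∈ P.frameDom p) (x : FrameIdx E → ℝ) (a : FrameIdx E) :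
    P.coeff p a r (P.frameSum p r x) = x a := P.coeff_sum p hr x a

theorem frameSum_coeff {r : M} (hr : r ∈ P.frameDom p) (t : TangentSpace 𝓘(ℝ, E) r) :
    P.frameSum p r (fun a => P.coeff p a r t) = t := P.sum_coeff p hr t

/-- In an adapted chart, the vertical lift `ν` is the inclusion of the second factor. -/
theorem pdiff_adapted_vertical (hw : w ∈ P.adaptedDom p) (y : FrameIdx E → ℝ) :
    pdiff (P.adapted p) w (0, y) = nu (P.adaptedFun p w)
      (P.frameSum p ((extChartAt 𝓘(ℝ, E) p).symm w.1) y) := by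
  set r := (extChartAt 𝓘(ℝ, E) p).symm w.1 with hr
  have hΦ : MDifferentiableAt 𝓘(ℝ, CoordSpace E) 𝓘(ℝ, E).tangent (P.adapted p) w :=
    (P.adapted p).mdifferentiableAt (by simp) hw
  have hin : HasMFDerivAt 𝓘(ℝ, FrameIdx E → ℝ) 𝓘(ℝ, CoordSpace E)
      (fun x : FrameIdx E → ℝ => ((w.1, x) : CoordSpace E)) w.2
      (ContinuousLinearMap.inr ℝ E (FrameIdx E → ℝ)) :=
    (hasFDerivAt_prodMk_right w.1 w.2).hasMFDerivAt
  have h1 := (hΦ.hasMFDerivAt).comp (I := 𝓘(ℝ, FrameIdx E → ℝ))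
    (f := fun x : FrameIdx E → ℝ => ((w.1, x) : CoordSpace E)) w.2 hin
  let l : (FrameIdx E → ℝ) →L[ℝ] E :=
    LinearMap.toContinuousLinearMap (P.frameSum p r : (FrameIdx E → ℝ) →ₗ[ℝ] E)
  have hl : HasMFDerivAt 𝓘(ℝ, FrameIdx E → ℝ) 𝓘(ℝ, E) l w.2 l := l.hasFDerivAt.hasMFDerivAt
  have hf : MDifferentiableAt 𝓘(ℝ, E) 𝓘(ℝ, E).tangent (fun u : E => (fibreIncl r u : TB E M))
      (l w.2) := (contMDiff_fibreIncl r _).mdifferentiableAt (by simp)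
  have h2 := (hf.hasMFDerivAt).comp (I := 𝓘(ℝ, FrameIdx E → ℝ)) (f := l) w.2 hl
  exact congrArg (fun m : (FrameIdx E → ℝ) →L[ℝ] E × E => m y) (h1.mfderiv.symm.trans h2.mfderiv)

theorem nu_eq_pdiff (hw : w ∈ P.adaptedDom p)
    (t : TangentSpace 𝓘(ℝ, E) (P.adaptedFun p w).proj) :
    nu (P.adaptedFun p w) t = pdiff (P.adapted p) w
      (0, fun a => P.coeff p a (P.adaptedFun p w).proj t) := by
  rw [P.pdiff_adapted_vertical hw]
  congr 1
  exact (P.frameSum_coeff hw.2 t).symm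

theorem dproj_pdiff_adapted (hw : w ∈ P.adaptedDom p) (a : CoordSpace E) :
    dproj (P.adaptedFun p w) (pdiff (P.adapted p) w a) = baseDiff p w.1 a.1 := by
  have hΦ : MDifferentiableAt 𝓘(ℝ, CoordSpace E) 𝓘(ℝ, E).tangent (P.adapted p) w :=
    (P.adapted p).mdifferentiableAt (by simp) hw
  have hpr : MDifferentiableAt 𝓘(ℝ, E).tangent 𝓘(ℝ, E) (fun W : TB E M => W.proj)
      (P.adapted p w) :=
    (Bundle.contMDiff_proj (TangentSpace 𝓘(ℝ, E)) (n := ∞) _).mdifferentiableAt (by simp)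
  have h1 := (hpr.hasMFDerivAt).comp (I := 𝓘(ℝ, CoordSpace E)) (f := P.adapted p) w
    hΦ.hasMFDerivAt
  have hs : MDifferentiableAt 𝓘(ℝ, E) 𝓘(ℝ, E) (extChartAt 𝓘(ℝ, E) p).symm w.1 :=
    (contMDiffAt_extChartAt_symm_of_mem hw.1).mdifferentiableAt (by simp)
  have h2 := (hs.hasMFDerivAt).comp (I := 𝓘(ℝ, CoordSpace E)) (f := Prod.fst) w
    (hasFDerivAt_fst (𝕜 := ℝ) (E := E) (F := FrameIdx E → ℝ) (p := w)).hasMFDerivAt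
  have h3 := h1.mfderiv.symm.trans h2.mfderiv
  exact congrArg (fun l : CoordSpace E →L[ℝ] E => l a) h3

theorem mem_adapted_target (V : TB E M) : V ∈ (P.adapted V.proj).target :=
  ⟨mem_extChartAt_source V.proj, P.mem_frameDom V.proj⟩

/-- Every point of `TM` is in the image of an adapted chart. -/
theorem exists_adapted (V : TB E M) :
    ∃ (p : M) (w : CoordSpace E), w ∈ P.adaptedDom p ∧ P.adaptedFun p w = V :=
  ⟨V.proj, (P.adapted V.proj).symm V, (P.adapted V.proj).map_target' (P.mem_adapted_target V),
    (P.adapted V.proj).right_inv' (P.mem_adapted_target V)⟩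

theorem nu_injective (P : LatticePeriodStructure E M) (V : TB E M) : Function.Injective (nu V) := by
  obtain ⟨p, w, hw, rfl⟩ := P.exists_adapted V
  rw [injective_iff_map_eq_zero]
  intro t ht
  rw [P.nu_eq_pdiff hw] at ht
  have h1 := (pdiff_isInvertible (P.adapted p) hw).injective (ht.trans (map_zero _).symm)
  have h2 : (fun a => P.coeff p a (P.adaptedFun p w).proj t) = 0 := congrArg Prod.snd h1
  rw [← P.frameSum_coeff (p := p) (r := (P.adaptedFun p w).proj) hw.2 t, h2, map_zero]

theorem dproj_eq_zero_iff (P : LatticePeriodStructure E M) (V : TB E M) (a : TN V) :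
    dproj V a = 0 ↔ ∃ t, nu V t = a := by
  obtain ⟨p, w, hw, rfl⟩ := P.exists_adapted V
  obtain ⟨b, rfl⟩ := (pdiff_isInvertible (P.adapted p) hw).surjective a
  constructor
  · intro h
    have h1 : b.1 = 0 := (baseDiff_isInvertible hw.1).injective
      (((P.dproj_pdiff_adapted hw b).symm.trans h).trans (map_zero _).symm)
    refine ⟨P.frameSum p _ b.2, ?_⟩
    refine (P.pdiff_adapted_vertical hw b.2).symm.trans ?_
    exact congrArg (fun c : CoordSpace E => pdiff (P.adapted p) w c) (Prod.ext h1.symm rfl)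
  · rintro ⟨t, ht⟩
    rw [← ht, P.nu_eq_pdiff hw]
    exact (P.dproj_pdiff_adapted hw _).trans (map_zero _)

end LatticePeriodStructure

/-! ### Hamiltonian vectors in Darboux coordinates -/

section Hamiltonian

theorem two_le_infty : (2 : WithTop ℕ∞) ≤ ∞ := by
  simpa using (by exact_mod_cast le_top : ((2 : ℕ∞) : WithTop ℕ∞) ≤ ∞)

variable (ι : Type*) [Fintype ι]

/-- The complex-bilinear extension of the standard symplectic form, with Darboux coordinates
indexed by `ι ⊕ ι`. -/
def symp : (ι ⊕ ι → ℂ) →L[ℝ] (ι ⊕ ι → ℂ) →L[ℝ] ℂ :=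
  ∑ i, ((ContinuousLinearMap.mul ℝ ℂ).bilinearComp (ContinuousLinearMap.proj (.inl i))
      (ContinuousLinearMap.proj (.inr i))
    - (ContinuousLinearMap.mul ℝ ℂ).bilinearComp (ContinuousLinearMap.proj (.inr i))
      (ContinuousLinearMap.proj (.inl i)))

theorem symp_apply (y u : ι ⊕ ι → ℂ) :
    symp ι y u = ∑ i, (y (.inl i) * u (.inr i) - y (.inr i) * u (.inl i)) := by
  simp [symp]

theorem symp_neg_flip (y u : ι ⊕ ι → ℂ) : symp ι y u = -symp ι u y := by
  simp only [symp_apply, ← Finset.sum_neg_distrib]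
  exact Finset.sum_congr rfl fun i _ => by ring

theorem symp_smul_right (c : ℂ) (y u : ι ⊕ ι → ℂ) : symp ι y (c • u) = c * symp ι y u := by
  simp only [symp_apply, Finset.mul_sum]
  exact Finset.sum_congr rfl fun i _ => by simp; ring

theorem symp_smul_left (c : ℂ) (y u : ι ⊕ ι → ℂ) : symp ι (c • y) u = c * symp ι y u := by
  rw [symp_neg_flip, symp_smul_right, symp_neg_flip ι u]
  ring

/-- Complex conjugation of coordinate vectors. -/
def conjPi (F : Type*) : (F → ℂ) →L[ℝ] (F → ℂ) :=
  ContinuousLinearMap.pi fun c => (Complex.conjCLE : ℂ →L[ℝ] ℂ).comp (ContinuousLinearMap.proj c)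

@[simp] theorem conjPi_apply {F : Type*} (y : F → ℂ) (c : F) :
    conjPi F y c = starRingEnd ℂ (y c) := rfl

theorem symp_conj (y u : ι ⊕ ι → ℂ) :
    symp ι (conjPi _ y) (conjPi _ u) = starRingEnd ℂ (symp ι y u) := by
  simp [symp_apply]

theorem conjPi_ofRealPi {F : Type*} (y : F → ℝ) : conjPi F (ofRealPi F y) = ofRealPi F y := by
  ext; simp

variable {ι} {E : Type*} [NormedAddCommGroup E] [NormedSpace ℝ E]

/-- A complex vector field `k` on the fibres of `E × ℝ^{2n} → E` has, at `x`, a fibre derivative in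
the symplectic Lie algebra, that is, one which is symmetric with respect to the symplectic form.
This is the first-order condition for `k` to be Hamiltonian on the fibres. -/
def IsHamiltonianAt (k : E × (ι ⊕ ι → ℝ) → (ι ⊕ ι → ℂ)) (x : E × (ι ⊕ ι → ℝ)) : Prop :=
  DifferentiableAt ℝ k x ∧ ∀ u u', symp ι (ofRealPi _ u') (fderiv ℝ k x (0, u))
    = symp ι (ofRealPi _ u) (fderiv ℝ k x (0, u'))

variable {k k' : E × (ι ⊕ ι → ℝ) → (ι ⊕ ι → ℂ)} {x : E × (ι ⊕ ι → ℝ)}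

theorem IsHamiltonianAt.add (h : IsHamiltonianAt k x) (h' : IsHamiltonianAt k' x) :
    IsHamiltonianAt (fun z => k z + k' z) x := by
  refine ⟨h.1.add h'.1, fun u u' => ?_⟩
  rw [fderiv_fun_add h.1 h'.1]
  simp only [add_apply, map_add, h.2 u u', h'.2 u u']

theorem IsHamiltonianAt.const_smul (h : IsHamiltonianAt k x) (c : ℂ) :
    IsHamiltonianAt (fun z => c • k z) x := by
  refine ⟨h.1.const_smul c, fun u u' => ?_⟩
  rw [fderiv_fun_const_smul h.1 c]
  have e : ∀ v, (c • fderiv ℝ k x) v = c • fderiv ℝ k x v := fun v => rfl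
  rw [e, e, symp_smul_right, symp_smul_right, h.2 u u']

theorem IsHamiltonianAt.conjPi (h : IsHamiltonianAt k x) :
    IsHamiltonianAt (fun z => conjPi _ (k z)) x := by
  have h1 := ((SpecialJoyce.conjPi (ι ⊕ ι)).hasFDerivAt.comp x h.1.hasFDerivAt)
  refine ⟨h1.differentiableAt, fun u u' => ?_⟩
  have h2 : fderiv ℝ (fun z => SpecialJoyce.conjPi _ (k z)) x = _ := h1.fderiv
  rw [h2]
  simp only [ContinuousLinearMap.comp_apply]
  rw [← conjPi_ofRealPi u, ← conjPi_ofRealPi u', symp_conj, symp_conj, h.2 u u']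

theorem IsHamiltonianAt.of_fderiv_eq_zero (h : DifferentiableAt ℝ k x)
    (h0 : ∀ u, fderiv ℝ k x (0, u) = 0) : IsHamiltonianAt k x :=
  ⟨h, fun u u' => by rw [h0, h0, map_zero, map_zero]⟩

variable (ι) [DecidableEq ι]

/-- The Hamiltonian vector `u` of a linear function `l` on `ℝ^{2n}`, characterized by `l = ω(-, u)`.
-/
def hamL : ((ι ⊕ ι → ℝ) →L[ℝ] ℂ) →L[ℝ] (ι ⊕ ι → ℂ) :=
  ContinuousLinearMap.pi fun c => Sum.elim
    (fun i => -ContinuousLinearMap.apply ℝ ℂ (Pi.single (.inr i) 1 : ι ⊕ ι → ℝ))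
    (fun i => ContinuousLinearMap.apply ℝ ℂ (Pi.single (.inl i) 1 : ι ⊕ ι → ℝ)) c

theorem symp_hamL (y : ι ⊕ ι → ℝ) (l : (ι ⊕ ι → ℝ) →L[ℝ] ℂ) :
    symp ι (ofRealPi _ y) (hamL ι l) = l y := by
  have h : l y = ∑ c, (y c : ℂ) * l (Pi.single c 1) := by
    conv_lhs => rw [pi_eq_sum_univ' y]
    rw [map_sum]
    refine Finset.sum_congr rfl fun c _ => ?_
    rw [map_smul]
    rw [Complex.real_smul]
  rw [h, Fintype.sum_sum_type, symp_apply, ← Finset.sum_add_distrib]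
  exact Finset.sum_congr rfl fun i _ => by simp [hamL]

theorem symp_nondegenerate {u u' : ι ⊕ ι → ℂ}
    (h : ∀ y, symp ι (ofRealPi _ y) u = symp ι (ofRealPi _ y) u') : u = u' := by
  have key : ∀ u (i : ι), symp ι (ofRealPi _ (Pi.single (.inl i) 1)) u = u (.inr i) ∧
      symp ι (ofRealPi _ (Pi.single (.inr i) 1)) u = -u (.inl i) := by
    intro u i
    simp [symp_apply, Pi.single_apply, apply_ite Complex.ofReal]
  ext c
  rcases c with i | i
  · exact neg_injective (((key u i).2.symm.trans (h _)).trans (key u' i).2)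
  · exact ((key u i).1.symm.trans (h _)).trans (key u' i).1

theorem hamL_eq {u : ι ⊕ ι → ℂ} {l : (ι ⊕ ι → ℝ) →L[ℝ] ℂ}
    (h : ∀ y, symp ι (ofRealPi _ y) u = l y) : u = hamL ι l :=
  symp_nondegenerate ι fun y => (h y).trans (symp_hamL ι y l).symm

theorem hamL_smul (c : ℂ) (l : (ι ⊕ ι → ℝ) →L[ℝ] ℂ) : hamL ι (c • l) = c • hamL ι l :=
  (hamL_eq ι fun y => by rw [symp_smul_right, symp_hamL]; rfl).symm

variable {ι}

/-- The vector `Ham_{∂_a f}` on the fibres of `E × ℝ^{2n} → E`, as a linear function of the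
direction `a`. -/
def hamHess (f : E × (ι ⊕ ι → ℝ) → ℂ) (x : E × (ι ⊕ ι → ℝ)) : (E × (ι ⊕ ι → ℝ)) →L[ℝ] (ι ⊕ ι → ℂ) :=
  (hamL ι).comp (((ContinuousLinearMap.compL ℝ (ι ⊕ ι → ℝ) (E × (ι ⊕ ι → ℝ)) ℂ).flip
    (ContinuousLinearMap.inr ℝ E (ι ⊕ ι → ℝ))).comp (fderiv ℝ (fderiv ℝ f) x))

variable {f : E × (ι ⊕ ι → ℝ) → ℂ}

theorem symp_hamHess (y : ι ⊕ ι → ℝ) (a : E × (ι ⊕ ι → ℝ)) :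
    symp ι (ofRealPi _ y) (hamHess f x a) = fderiv ℝ (fderiv ℝ f) x a (0, y) :=
  symp_hamL ι y _

theorem contDiffAt_hamHess (hf : ContDiffAt ℝ ∞ f x) : ContDiffAt ℝ ∞ (hamHess f) x :=
  contDiffAt_const.clm_comp (contDiffAt_const.clm_comp
    ((hf.fderiv_right (m := ∞) (by simp)).fderiv_right (m := ∞) (by simp)))

/-- The vector field `Ham_{∂_a f}` on the fibres is Hamiltonian, for `a` constant on the fibres: its
fibre derivative is the Hessian of `∂_a f`, which is symmetric. -/
theorem isHamiltonianAt_hamHess (hf : ContDiffAt ℝ ∞ f x)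
    {a : E × (ι ⊕ ι → ℝ) → E × (ι ⊕ ι → ℝ)} (ha : DifferentiableAt ℝ a x)
    (h0 : ∀ u, fderiv ℝ a x (0, u) = 0) : IsHamiltonianAt (fun z => hamHess f z (a z)) x := by
  have h1 : ContDiffAt ℝ ∞ (fderiv ℝ f) x := hf.fderiv_right (m := ∞) (by simp)
  have hH := (contDiffAt_hamHess hf).differentiableAt (by simp)
  refine ⟨hH.clm_apply ha, fun u u' => ?_⟩
  -- the derivative of `f` along the constant vector `a x`
  have hg : ContDiffAt ℝ ∞ (fun z => fderiv ℝ f z (a x)) x := h1.clm_apply contDiffAt_const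
  have hsymm : ∀ᶠ z in 𝓝 x, IsSymmSndFDerivAt ℝ f z := by
    filter_upwards [(hf.of_le (m := 2) two_le_infty).eventually (by simp)] with z hz
    exact hz.isSymmSndFDerivAt (by simp)
  -- the fibre derivative of `Ham_{∂_a f}` is given by the second derivatives of `∂_a f`
  have key : ∀ u u', symp ι (ofRealPi _ u') (fderiv ℝ (fun z => hamHess f z (a z)) x (0, u))
      = fderiv ℝ (fderiv ℝ (fun z => fderiv ℝ f z (a x))) x (0, u) (0, u') := by
    intro u u'
    rw [fderiv_clm_apply hH ha]
    have e1 : ((hamHess f x).comp (fderiv ℝ a x) + (fderiv ℝ (hamHess f) x).flip (a x)) (0, u)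
        = fderiv ℝ (fun z => hamHess f z (a x)) x (0, u) := by
      rw [fderiv_clm_apply hH (differentiableAt_const _)]
      simp [h0]
    rw [e1]
    have hd : DifferentiableAt ℝ (fun z => hamHess f z (a x)) x :=
      hH.clm_apply (differentiableAt_const _)
    have e2 := ((symp ι (ofRealPi _ u')).hasFDerivAt.comp x hd.hasFDerivAt).fderiv
    have e3 : ((symp ι (ofRealPi _ u')) ∘ fun z => hamHess f z (a x)) =ᶠ[𝓝 x]
        fun z => fderiv ℝ (fun z => fderiv ℝ f z (a x)) z (0, u') := by
      filter_upwards [hsymm, (h1.of_le (m := 1) (by simp)).eventually (by simp)]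
        with z hz hz1
      show symp ι (ofRealPi _ u') (hamHess f z (a x)) = _
      rw [symp_hamHess, hz.eq, fderiv_clm_apply (hz1.differentiableAt (by simp))
        (differentiableAt_const _)]
      simp
    rw [e3.fderiv_eq] at e2
    have e4 := congrArg (fun l => l ((0 : E), u)) e2
    simp only [ContinuousLinearMap.comp_apply] at e4
    rw [← e4, fderiv_clm_apply ((hg.fderiv_right (m := ∞) (by simp)).differentiableAt (by simp))
        (differentiableAt_const _)]
    simp
  rw [key, key]
  exact ((hg.of_le (m := 2) two_le_infty).isSymmSndFDerivAt (by simp)).eq _ _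

end Hamiltonian

/-! ### The coefficients of a Joyce structure in adapted charts -/

section

variable {E : Type*} [NormedAddCommGroup E] [NormedSpace ℂ E]
  {M : Type*} [TopologicalSpace M] [ChartedSpace E M] [IsManifold 𝓘(ℂ, E) ω M]

/-- The `(1,0)`-vector `t - i I t`, the real part of which is `t`. -/
def toT10 (q : M) (t : TangentSpace 𝓘(ℝ, E) q) : T10 E q :=
  ⟨⟨t, -cplx E q t⟩, by
    have h : cplx E q (cplx E q t) = -t := by
      show (Complex.I • (Complex.I • (show E from t)) : E) = -(show E from t)
      rw [smul_smul, Complex.I_mul_I, neg_one_smul]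
    rw [T10, LinearMap.mem_ker]
    ext <;> simp [h]⟩

theorem im_of_mem_T10 {q : M} (X : T10 E q) : X.1.im = -cplx E q X.1.re := by
  have h := LinearMap.mem_ker.1 X.2
  have h1 := congrArg Cx.re h
  simp at h1
  exact (neg_eq_of_add_eq_zero_right h1).symm

theorem toT10_re {q : M} (X : T10 E q) : toT10 q X.1.re = X :=
  Subtype.ext (Cx.ext rfl (im_of_mem_T10 X).symm)

/-- The complex vertical vector of `E × ℝ^F` with the given coordinates, as an element of the
complexification. -/
def vinc (E F : Type*) [NormedAddCommGroup E] [NormedSpace ℝ E] :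
    (F → ℂ) →ₗ[ℂ] Cx (E × (F → ℝ)) where
  toFun u := ⟨(0, rePi F u), (0, imPi F u)⟩
  map_add' u u' := by ext <;> simp
  map_smul' c u := by ext <;> simp

@[simp] theorem vinc_re {F : Type*} (u : F → ℂ) : (vinc E F u).re = (0, rePi F u) := rfl

@[simp] theorem vinc_im {F : Type*} (u : F → ℂ) : (vinc E F u).im = (0, imPi F u) := rfl

/-- The complex horizontal vector of type `(1,0)` with real part `e`. -/
def horVec (F : Type*) (e : E) : Cx (E × (F → ℝ)) := ⟨(e, 0), (-(Complex.I • e), 0)⟩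

namespace LatticePeriodStructure

variable [FiniteDimensional ℂ E] (P : LatticePeriodStructure E M) {p : M} {w : CoordSpace E}

/-- The differential of the inverse of an adapted chart. -/
def adaptedDiff (p : M) (w : CoordSpace E) : CoordSpace E →ₗ[ℝ] TN (P.adaptedFun p w) where
  toFun a := pdiff (P.adapted p) w a
  map_add' a b := map_add (pdiff (P.adapted p) w) a b
  map_smul' r a := map_smul (pdiff (P.adapted p) w) r a

theorem adaptedDiff_bijective (hw : w ∈ P.adaptedDom p) :
    Function.Bijective (P.adaptedDiff p w) :=
  ⟨(pdiff_isInvertible (P.adapted p) hw).injective,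
    (pdiff_isInvertible (P.adapted p) hw).surjective⟩

theorem adaptedDiff_horizontal (hw : w ∈ P.adaptedDom p) (e : E) :
    P.adaptedDiff p w (e, 0) = P.horiz (P.adaptedFun p w) (baseDiff p w.1 e) :=
  P.pdiff_adapted_horizontal hw e

theorem adaptedDiff_vertical (hw : w ∈ P.adaptedDom p) (y : FrameIdx E → ℝ) :
    P.adaptedDiff p w (0, y) = nu (P.adaptedFun p w)
      (P.frameSum p ((extChartAt 𝓘(ℝ, E) p).symm w.1) y) :=
  P.pdiff_adapted_vertical hw y

theorem dproj_adaptedDiff (hw : w ∈ P.adaptedDom p) (a : CoordSpace E) :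
    dproj (P.adaptedFun p w) (P.adaptedDiff p w a) = baseDiff p w.1 a.1 :=
  P.dproj_pdiff_adapted hw a

/-- The coordinates of complex tangent vectors in a Darboux frame. -/
def cxCoeff (p r : M) (U : Cx (TangentSpace 𝓘(ℝ, E) r)) : FrameIdx E → ℂ :=
  ofRealPi _ (fun a => P.coeff p a r U.re) + Complex.I • ofRealPi _ (fun a => P.coeff p a r U.im)

theorem omega_frameSum {r : M} (hr : r ∈ P.frameDom p) (y y' : FrameIdx E → ℝ) :
    (P.omega r (P.frameSum p r y) (P.frameSum p r y') : ℂ)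
      = symp _ (ofRealPi _ y) (ofRealPi _ y') := by
  have h : P.omega r (P.frameSum p r y) (P.frameSum p r y')
      = ∑ b, y' b * ∑ a, y a * darboux E a b := by
    simp only [frameSum_apply, map_sum, map_smul, LinearMap.sum_apply, LinearMap.smul_apply,
      P.omega_frameField p hr, smul_eq_mul]
  rw [h, symp_apply]
  simp only [Fintype.sum_sum_type, darboux]
  simp [Finset.sum_sub_distrib, mul_comm]
  ring

theorem omega_frameSum_cx {r : M} (hr : r ∈ P.frameDom p) (y : FrameIdx E → ℝ)
    (U : Cx (TangentSpace 𝓘(ℝ, E) r)) :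
    (P.omega r (P.frameSum p r y) U.re : ℂ) + Complex.I * (P.omega r (P.frameSum p r y) U.im : ℂ)
      = symp _ (ofRealPi _ y) (P.cxCoeff p r U) := by
  rw [cxCoeff, map_add, symp_smul_right, ← P.omega_frameSum hr, ← P.omega_frameSum hr,
    P.frameSum_coeff hr, P.frameSum_coeff hr]

/-- The coordinates of the fibre over `r`, as a continuous linear equivalence. -/
def frameEquiv {r : M} (hr : r ∈ P.frameDom p) : (FrameIdx E → ℝ) ≃L[ℝ] E :=
  LinearEquiv.toContinuousLinearEquiv (E := FrameIdx E → ℝ) (F := E)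
    { toFun := fun y => P.frameSum p r y
      map_add' := fun y y' => map_add (P.frameSum p r) y y'
      map_smul' := fun c y => map_smul (P.frameSum p r) c y
      invFun := fun t a => P.coeff p a r t
      left_inv := fun y => funext fun a => P.coeff_frameSum hr y a
      right_inv := fun t => P.frameSum_coeff hr t }

/-- The Hamiltonian vector of a function on a fibre of `TM`, in an adapted chart. -/
theorem ham_adapted (hw : w ∈ P.adaptedDom p)
    {f : TangentSpace 𝓘(ℝ, E) (P.adaptedFun p w).proj → ℂ} {l : (FrameIdx E → ℝ) →L[ℝ] ℂ}
    (hl : HasFDerivAt (fun y => f (P.frameSum p (P.adaptedFun p w).proj y)) l w.2) :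
    P.ham (P.adaptedFun p w) f = Cx.map (P.adaptedDiff p w) (vinc E _ (hamL _ l)) := by
  have hr : (P.adaptedFun p w).proj ∈ P.frameDom p := hw.2
  have hd : ∀ y, fderiv ℝ f (P.adaptedFun p w).2 (P.frameSum p (P.adaptedFun p w).proj y)
      = l y := by
    intro y
    let f' : E → ℂ := f
    have h1 := (P.frameEquiv hr).comp_right_fderiv (f := f') (x := w.2)
    have h2 : fderiv ℝ (f' ∘ P.frameEquiv hr) w.2 = l := hl.fderiv
    rw [h2] at h1
    exact (congrArg (fun m : (FrameIdx E → ℝ) →L[ℝ] ℂ => m y) h1).symm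
  -- the condition which determines the Hamiltonian vector
  let C : Cx (TangentSpace 𝓘(ℝ, E) (P.adaptedFun p w).proj) → Prop := fun U =>
    ∀ W, fderiv ℝ f (P.adaptedFun p w).2 W = (P.omega (P.adaptedFun p w).proj W U.re : ℂ)
      + Complex.I * (P.omega (P.adaptedFun p w).proj W U.im : ℂ)
  have hiff : ∀ U, C U ↔ P.cxCoeff p (P.adaptedFun p w).proj U = hamL _ l := by
    intro U
    constructor
    · intro h
      refine hamL_eq _ fun y => ?_
      rw [← P.omega_frameSum_cx hr, ← h, hd]
    · intro h W
      rw [← P.frameSum_coeff hr W, hd, P.omega_frameSum_cx hr, h, symp_hamL]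
  have h1 := (hiff _).1 (Classical.epsilon_spec (p := C)
    ⟨⟨P.frameSum p (P.adaptedFun p w).proj (rePi _ (hamL _ l)),
      P.frameSum p (P.adaptedFun p w).proj (imPi _ (hamL _ l))⟩,
      (hiff _).2 (by simp only [cxCoeff, P.coeff_frameSum hr]; exact rePi_add_imPi _)⟩)
  have hre : ∀ a, P.coeff p a (P.adaptedFun p w).proj (Classical.epsilon C).re
      = rePi _ (hamL _ l) a := fun a => by rw [← h1]; simp [cxCoeff]
  have him : ∀ a, P.coeff p a (P.adaptedFun p w).proj (Classical.epsilon C).im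
      = imPi _ (hamL _ l) a := fun a => by rw [← h1]; simp [cxCoeff]
  rw [ham]
  ext
  · refine Eq.trans ?_ (P.adaptedDiff_vertical hw _).symm
    refine congrArg (nu (P.adaptedFun p w)) ?_
    rw [← P.frameSum_coeff hr (Cx.re _)]
    exact congrArg _ (funext hre)
  · refine Eq.trans ?_ (P.adaptedDiff_vertical hw _).symm
    refine congrArg (nu (P.adaptedFun p w)) ?_
    rw [← P.frameSum_coeff hr (Cx.im _)]
    exact congrArg _ (funext him)

/-- The coordinates in the Darboux frame of the coordinate vector fields of `M`. -/
def frameCoord (p : M) (w : CoordSpace E) : E →L[ℝ] (FrameIdx E → ℝ) :=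
  LinearMap.toContinuousLinearMap
    (LinearMap.pi fun a => (P.coeff p a ((extChartAt 𝓘(ℝ, E) p).symm w.1)).comp
      (baseDiff p w.1 : E →ₗ[ℝ] TangentSpace 𝓘(ℝ, E) ((extChartAt 𝓘(ℝ, E) p).symm w.1)))

theorem frameSum_frameCoord (hw : w ∈ P.adaptedDom p) (e : E) :
    P.frameSum p ((extChartAt 𝓘(ℝ, E) p).symm w.1) (P.frameCoord p w e) = baseDiff p w.1 e :=
  P.frameSum_coeff hw.2 _

theorem contMDiffAt_baseDiff {z : E} (hz : z ∈ (extChartAt 𝓘(ℝ, E) p).target) (e : E) :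
    ContMDiffAt 𝓘(ℝ, E) 𝓘(ℝ, E).tangent ∞
      (fun z' => (⟨(extChartAt 𝓘(ℝ, E) p).symm z', baseDiff p z' e⟩ : TB E M)) z := by
  have h1 : ContMDiffOn 𝓘(ℝ, E) 𝓘(ℝ, E) ∞ (extChartAt 𝓘(ℝ, E) p).symm
    (extChartAt 𝓘(ℝ, E) p).target := contMDiffOn_extChartAt_symm p
  have h2 := h1.contMDiffOn_tangentMapWithin (m := ∞) (by simp)
    (isOpen_extChartAt_target p).uniqueMDiffOn
  have h3 : ContMDiffAt 𝓘(ℝ, E) 𝓘(ℝ, E).tangent ∞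
      (fun z' => (⟨z', e⟩ : TangentBundle 𝓘(ℝ, E) E)) z :=
    (contMDiffAt_vectorSpace_iff_contDiffAt (V := fun _ : E => e)).2 contDiffAt_const
  have ho : IsOpen (Bundle.TotalSpace.proj ⁻¹' (extChartAt 𝓘(ℝ, E) p).target :
      Set (TangentBundle 𝓘(ℝ, E) E)) :=
    (isOpen_extChartAt_target p).preimage (FiberBundle.continuous_proj E (TangentSpace 𝓘(ℝ, E)))
  have h4 := (h2.contMDiffAt (ho.mem_nhds (x := (⟨z, e⟩ : TangentBundle 𝓘(ℝ, E) E)) hz)).comp z h3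
  refine h4.congr_of_eventuallyEq ?_
  filter_upwards [(isOpen_extChartAt_target p).mem_nhds hz] with z' hz'
  show _ = tangentMapWithin 𝓘(ℝ, E) 𝓘(ℝ, E) _ _ _
  rw [tangentMapWithin]
  simp only [mfderivWithin_of_isOpen (isOpen_extChartAt_target p) hz']
  rfl

theorem contDiffOn_frameCoord : ContDiffOn ℝ ∞ (P.frameCoord p) (P.adaptedDom p) := by
  rw [contDiffOn_clm_apply]
  intro e w hw
  have h1 := (P.contMDiffAt_coeff p (V := ⟨_, baseDiff p w.1 e⟩) hw.2).comp w
    ((contMDiffAt_baseDiff hw.1 e).comp w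
      (contDiff_fst (𝕜 := ℝ) (n := ∞) (E := E) (F := FrameIdx E → ℝ)).contMDiff.contMDiffAt)
  exact h1.contDiffAt.contDiffWithinAt

theorem fderiv_frameCoord_vertical (e : E) (u : FrameIdx E → ℝ) (hw : w ∈ P.adaptedDom p) :
    fderiv ℝ (fun z => P.frameCoord p z e) w (0, u) = 0 := by
  have h1 : DifferentiableAt ℝ (fun z => P.frameCoord p z e) w :=
    ((P.contDiffOn_frameCoord.contDiffAt ((P.isOpen_adaptedDom p).mem_nhds hw)).clm_apply
      contDiffAt_const).differentiableAt (by simp)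
  have h2 := (HasFDerivAt.comp (g := fun z => P.frameCoord p z e)
    (f := fun y : FrameIdx E → ℝ => ((w.1, y) : CoordSpace E)) w.2
    h1.hasFDerivAt (hasFDerivAt_prodMk_right w.1 w.2)).unique
    (hasFDerivAt_const (P.frameCoord p w e) w.2)
  exact congrArg (fun l => l u) h2

end LatticePeriodStructure

end

/-! ### The connections in adapted charts -/

section

variable {E : Type*} [NormedAddCommGroup E] [NormedSpace ℂ E]
  {M : Type*} [TopologicalSpace M] [ChartedSpace E M] [IsManifold 𝓘(ℂ, E) ω M]

/-- Multiplication by `i` on the model space. -/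
def mulI (E : Type*) [NormedAddCommGroup E] [NormedSpace ℂ E] : E →L[ℝ] E :=
  Complex.I • ContinuousLinearMap.id ℝ E

open LatticePeriodStructure

namespace AlmostSpecialJoyceStructure

variable {P : SpecialPeriodStructure E M} (A : AlmostSpecialJoyceStructure P)

/-- The function `J` of a Joyce structure in an adapted chart. -/
def potential (p : M) (w : CoordSpace E) : ℂ := A.exists_J.choose (P.adaptedFun p w)

variable [FiniteDimensional ℂ E]

/-- The coordinates of the vertical part of `h` in an adapted chart: `h` of the `(1,0)`-vector `e -
i I e` differs from its flat lift by `Ham_{∂_e J} - i Ham_{∂_{ie} J}`. -/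
def hCoord (p : M) (w : CoordSpace E) : E →L[ℝ] (FrameIdx E → ℂ) :=
  (hamHess (A.potential p) w).comp (ContinuousLinearMap.inl ℝ E (FrameIdx E → ℝ))
    - Complex.I • ((hamHess (A.potential p) w).comp
      ((ContinuousLinearMap.inl ℝ E (FrameIdx E → ℝ)).comp (mulI E)))

/-- The coordinates of `ν_t + Ham_{ν_t J}` in an adapted chart, for the coordinate vector fields
`t` on `M`. -/
def nuCoord (p : M) (w : CoordSpace E) : E →L[ℝ] (FrameIdx E → ℂ) :=
  (ofRealPi _).comp (P.frameCoord p w) + (hamHess (A.potential p) w).comp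
    ((ContinuousLinearMap.inr ℝ E (FrameIdx E → ℝ)).comp (P.frameCoord p w))

/-- The coordinates of `v` in an adapted chart: `v` of the `(1,0)`-vector `e - i I e` is `2πi` times
the value of the complex-linear extension of `nuCoord` at the conjugate vector `e + i I e`. -/
def vCoord (p : M) (w : CoordSpace E) : E →L[ℝ] (FrameIdx E → ℂ) :=
  (2 * Real.pi * Complex.I : ℂ) • (A.nuCoord p w + Complex.I • (A.nuCoord p w).comp (mulI E))

/-- The vertical part `K^ζ_e` of the horizontal lift of `e` for the connection `A^ζ`, in an adapted
chart. A real vector `t` has `(1,0)`-part `(t - i I t) / 2`, which accounts for the factor `1/2`. -/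
def connCoord (ζ : ℂ) (p : M) (w : CoordSpace E) : E →L[ℝ] (FrameIdx E → ℂ) :=
  (1 / 2 : ℂ) • (A.hCoord p w + (conjPi _).comp (A.hCoord p w)
    + (-ζ⁻¹ • (conjPi _).comp (A.vCoord p w) + ζ • A.vCoord p w))

variable {p : M} {w : CoordSpace E}

theorem hCoord_apply (e : E) : A.hCoord p w e = hamHess (A.potential p) w (e, 0)
    - Complex.I • hamHess (A.potential p) w (Complex.I • e, 0) := rfl

theorem nuCoord_apply (e : E) : A.nuCoord p w e = ofRealPi _ (P.frameCoord p w e)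
    + hamHess (A.potential p) w (0, P.frameCoord p w e) := rfl

theorem vCoord_apply (e : E) : A.vCoord p w e = (2 * Real.pi * Complex.I : ℂ) •
    (A.nuCoord p w e + Complex.I • A.nuCoord p w (Complex.I • e)) := rfl

theorem connCoord_apply (ζ : ℂ) (e : E) : A.connCoord ζ p w e = (1 / 2 : ℂ) • (A.hCoord p w e
    + conjPi _ (A.hCoord p w e)
    + (-ζ⁻¹ • conjPi _ (A.vCoord p w e) + ζ • A.vCoord p w e)) := rfl

theorem contDiffAt_potential (hw : w ∈ P.adaptedDom p) : ContDiffAt ℝ ∞ (A.potential p) w :=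
  ((A.exists_J.choose_spec.1 (P.adaptedFun p w)).comp w ((P.adapted p).contMDiffOn.contMDiffAt
    ((P.isOpen_adaptedDom p).mem_nhds hw))).contDiffAt

theorem contDiffAt_frameCoord (hw : w ∈ P.adaptedDom p) : ContDiffAt ℝ ∞ (P.frameCoord p) w :=
  P.contDiffOn_frameCoord.contDiffAt ((P.isOpen_adaptedDom p).mem_nhds hw)

theorem contDiffAt_hCoord (hw : w ∈ P.adaptedDom p) : ContDiffAt ℝ ∞ (A.hCoord p) w := by
  have h1 := contDiffAt_hamHess (A.contDiffAt_potential hw)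
  exact (h1.clm_comp contDiffAt_const).sub ((h1.clm_comp contDiffAt_const).const_smul Complex.I)

theorem contDiffAt_nuCoord (hw : w ∈ P.adaptedDom p) : ContDiffAt ℝ ∞ (A.nuCoord p) w := by
  have h1 := contDiffAt_hamHess (A.contDiffAt_potential hw)
  have h2 := contDiffAt_frameCoord hw
  exact (contDiffAt_const.clm_comp h2).add (h1.clm_comp (contDiffAt_const.clm_comp h2))

theorem contDiffAt_vCoord (hw : w ∈ P.adaptedDom p) : ContDiffAt ℝ ∞ (A.vCoord p) w := by
  have h1 := A.contDiffAt_nuCoord hw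
  exact (h1.add ((h1.clm_comp contDiffAt_const).const_smul Complex.I)).const_smul _

theorem contDiffAt_connCoord (ζ : ℂ) (hw : w ∈ P.adaptedDom p) :
    ContDiffAt ℝ ∞ (A.connCoord ζ p) w := by
  have h1 := A.contDiffAt_hCoord hw
  have h2 := A.contDiffAt_vCoord hw
  exact ((h1.add (contDiffAt_const.clm_comp h1)).add
    (((contDiffAt_const.clm_comp h2).const_smul (-ζ⁻¹)).add (h2.const_smul ζ))).const_smul _

/-- The vector `A^ζ_e` is Hamiltonian on the fibres, up to a term which is constant on them. -/
theorem isHamiltonianAt_connCoord (ζ : ℂ) (hw : w ∈ P.adaptedDom p) (e : E) :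
    IsHamiltonianAt (fun z => A.connCoord ζ p z e) w := by
  have hJ := A.contDiffAt_potential hw
  have hf := fun e => ((contDiffAt_frameCoord hw).clm_apply
    (contDiffAt_const (c := e))).differentiableAt (by simp)
  have h1 : IsHamiltonianAt (fun z => A.hCoord p z e) w := by
    have hc : ∀ e : E, IsHamiltonianAt (fun z => hamHess (A.potential p) z (e, 0)) w := fun e =>
      isHamiltonianAt_hamHess hJ (differentiableAt_const _) (fun u => by simp)
    have h2 := (hc e).add ((hc (Complex.I • e)).const_smul (-Complex.I))
    simp only [neg_smul, ← sub_eq_add_neg] at h2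
    exact h2
  have h2 : ∀ e : E, IsHamiltonianAt (fun z => A.nuCoord p z e) w := by
    intro e
    have hd := (hf e).hasFDerivAt
    have hL : ∀ {G : Type} [NormedAddCommGroup G] [NormedSpace ℝ G],
        ∀ L : (FrameIdx E → ℝ) →L[ℝ] G, ∀ u : FrameIdx E → ℝ,
        fderiv ℝ (fun z => L (P.frameCoord p z e)) w (0, u) = 0 := by
      intro G _ _ L u
      have h3 := (L.hasFDerivAt.comp w hd).fderiv
      refine (congrArg (fun l => l ((0 : E), u)) h3).trans ?_
      exact (congrArg L (P.fderiv_frameCoord_vertical e u hw)).trans (map_zero L)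
    have hv : ∀ u : FrameIdx E → ℝ,
        fderiv ℝ (fun z => ((0 : E), P.frameCoord p z e)) w (0, u) = 0 := by
      intro u
      have h3 := ((ContinuousLinearMap.inr ℝ E (FrameIdx E → ℝ)).hasFDerivAt.comp w hd).fderiv
      refine (congrArg (fun l => l ((0 : E), u)) h3).trans ?_
      exact (congrArg (ContinuousLinearMap.inr ℝ E (FrameIdx E → ℝ))
        (P.fderiv_frameCoord_vertical e u hw)).trans (map_zero _)
    exact IsHamiltonianAt.add (.of_fderiv_eq_zero
      ((ofRealPi (FrameIdx E)).differentiableAt.comp w (hf e)) (hL (ofRealPi (FrameIdx E))))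
      (isHamiltonianAt_hamHess hJ ((differentiableAt_const _).prodMk (hf e)) hv)
  have h3 : IsHamiltonianAt (fun z => A.vCoord p z e) w :=
    ((h2 e).add ((h2 (Complex.I • e)).const_smul Complex.I)).const_smul _
  exact ((h1.add h1.conjPi).add ((h3.conjPi.const_smul (-ζ⁻¹)).add (h3.const_smul ζ))).const_smul _

theorem hasFDerivAt_fderiv_apply {f : CoordSpace E → ℂ} (hf : ContDiffAt ℝ ∞ f w)
    (a b : CoordSpace E) :
    HasFDerivAt (fun y : FrameIdx E → ℝ =>
        fderiv ℝ f (w.1, y) a + Complex.I * fderiv ℝ f (w.1, y) b)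
      ((fderiv ℝ (fderiv ℝ f) w a).comp (ContinuousLinearMap.inr ℝ E (FrameIdx E → ℝ))
        + Complex.I • (fderiv ℝ (fderiv ℝ f) w b).comp
          (ContinuousLinearMap.inr ℝ E (FrameIdx E → ℝ))) w.2 := by
  have hs : IsSymmSndFDerivAt ℝ f w := (hf.of_le two_le_infty).isSymmSndFDerivAt (by simp)
  have h1 : HasFDerivAt (fderiv ℝ f) (fderiv ℝ (fderiv ℝ f) w) w :=
    ((hf.fderiv_right (m := ∞) (by simp)).differentiableAt (by simp)).hasFDerivAt
  have h2 : ∀ a, HasFDerivAt (fun y : FrameIdx E → ℝ => fderiv ℝ f (w.1, y) a)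
      ((fderiv ℝ (fderiv ℝ f) w a).comp (ContinuousLinearMap.inr ℝ E (FrameIdx E → ℝ))) w.2 := by
    intro a
    have h3 := HasFDerivAt.comp (g := fun z => fderiv ℝ f z a)
      (f := fun y : FrameIdx E → ℝ => ((w.1, y) : CoordSpace E)) w.2
      (h1.clm_apply (hasFDerivAt_const a w)) (hasFDerivAt_prodMk_right w.1 w.2)
    refine h3.congr_fderiv ?_
    ext y
    simp [hs.eq a]
  exact (h2 a).add ((h2 b).const_smul Complex.I)

theorem dirDeriv_adaptedDiff {f : TB E M → ℂ} (hf : ContMDiff 𝓘(ℝ, E).tangent 𝓘(ℝ, ℂ) ∞ f)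
    (hw : w ∈ P.adaptedDom p) (a : CoordSpace E) :
    dirDeriv 𝓘(ℝ, E).tangent f (P.adaptedFun p w) (P.adaptedDiff p w a)
      = fderiv ℝ (fun z => f (P.adaptedFun p z)) w a :=
  (dirDeriv_pdiff (P.adapted p) hw ((hf _).mdifferentiableAt (by simp)) a).trans
    (dirDeriv_eq_fderiv _ _ _)

/-- The Hamiltonian vector of the derivative of `J` along a vector field with constant
coordinates. -/
theorem ham_cxDeriv (hw : w ∈ P.adaptedDom p) (a b : CoordSpace E)
    {ξ : Π u : TangentSpace 𝓘(ℝ, E) (P.adaptedFun p w).proj,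
      Cx (TN (fibreIncl (P.adaptedFun p w).proj u))}
    (hξ : ∀ y, ξ (P.frameSum p _ y) = ⟨P.adaptedDiff p (w.1, y) a, P.adaptedDiff p (w.1, y) b⟩) :
    (P.ham (P.adaptedFun p w) fun u => cxDeriv A.exists_J.choose
      (fibreIncl (P.adaptedFun p w).proj u) (ξ u)) = Cx.map (P.adaptedDiff p w)
        (vinc E _ (hamHess (A.potential p) w a + Complex.I • hamHess (A.potential p) w b)) := by
  have h1 := hasFDerivAt_fderiv_apply (A.contDiffAt_potential hw) a b
  have h2 : hamL (Fin (Module.finrank ℂ E))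
      ((fderiv ℝ (fderiv ℝ (A.potential p)) w a).comp (ContinuousLinearMap.inr ℝ E (FrameIdx E → ℝ))
        + Complex.I • (fderiv ℝ (fderiv ℝ (A.potential p)) w b).comp
          (ContinuousLinearMap.inr ℝ E (FrameIdx E → ℝ)))
      = hamHess (A.potential p) w a + Complex.I • hamHess (A.potential p) w b := by
    rw [map_add, hamL_smul]
    rfl
  rw [← h2]
  refine P.ham_adapted hw (h1.congr_of_eventuallyEq (Filter.Eventually.of_forall fun y => ?_))
  have hy : ((w.1, y) : CoordSpace E) ∈ P.adaptedDom p := hw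
  show cxDeriv _ _ (ξ (P.frameSum p _ y)) = _
  rw [hξ]
  have e : ∀ c, dirDeriv 𝓘(ℝ, E).tangent A.exists_J.choose (P.adaptedFun p (w.1, y))
      (P.adaptedDiff p (w.1, y) c) = fderiv ℝ (A.potential p) (w.1, y) c := fun c =>
    dirDeriv_adaptedDiff A.exists_J.choose_spec.1 hy c
  exact congrArg₂ (fun s t => s + Complex.I * t) (e a) (e b)

/-- The map `h` in an adapted chart. -/
theorem h_adapted (hw : w ∈ P.adaptedDom p) (e : E) :
    A.h (P.adaptedFun p w) (toT10 _ (baseDiff p w.1 e))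
      = Cx.map (P.adaptedDiff p w) (horVec _ e + vinc E _ (A.hCoord p w e)) := by
  have h1 : ∀ y : FrameIdx E → ℝ, Cx.map (P.horiz (P.adaptedFun p (w.1, y)))
      (toT10 _ (baseDiff p w.1 e)).1 = Cx.map (P.adaptedDiff p (w.1, y)) (horVec _ e) := by
    intro y
    have hy : ((w.1, y) : CoordSpace E) ∈ P.adaptedDom p := hw
    ext
    · exact (P.adaptedDiff_horizontal hy e).symm
    · refine Eq.trans ?_ (P.adaptedDiff_horizontal hy (-(Complex.I • e))).symm
      refine congrArg (P.horiz (P.adaptedFun p (w.1, y))) ?_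
      exact (congrArg Neg.neg (cplx_baseDiff hw.1 e)).trans (map_neg _ _).symm
  rw [A.exists_J.choose_spec.2.1, map_add, A.hCoord_apply]
  refine congrArg₂ (· + ·) (h1 w.2) ?_
  refine (A.ham_cxDeriv hw (e, 0) (-(Complex.I • e), 0) fun y => h1 y).trans ?_
  have h2 : ((-(Complex.I • e), 0) : CoordSpace E) = -(Complex.I • e, 0) := by ext <;> simp
  rw [h2, map_neg, smul_neg, ← sub_eq_add_neg]

/-- The map `v` in an adapted chart. -/
theorem v_adapted (hw : w ∈ P.adaptedDom p) (e : E) :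
    A.v (P.adaptedFun p w) (toT10 _ (baseDiff p w.1 e))
      = Cx.map (P.adaptedDiff p w) (vinc E _ (A.vCoord p w e)) := by
  have h0 : ∀ (y : FrameIdx E → ℝ) (e : E), nu (P.adaptedFun p (w.1, y)) (baseDiff p w.1 e)
      = P.adaptedDiff p (w.1, y) (0, P.frameCoord p w e) := by
    intro y e
    have hy : ((w.1, y) : CoordSpace E) ∈ P.adaptedDom p := hw
    rw [P.adaptedDiff_vertical hy]
    exact congrArg (nu (P.adaptedFun p (w.1, y))) (P.frameSum_frameCoord hw e).symm
  have h1 : ∀ y : FrameIdx E → ℝ, Cx.map (nu (P.adaptedFun p (w.1, y)))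
      (Cx.conj (toT10 _ (baseDiff p w.1 e)).1)
      = ⟨P.adaptedDiff p (w.1, y) (0, P.frameCoord p w e),
        P.adaptedDiff p (w.1, y) (0, P.frameCoord p w (Complex.I • e))⟩ := by
    intro y
    ext
    · exact h0 y e
    · refine Eq.trans ?_ (h0 y (Complex.I • e))
      refine congrArg (nu (P.adaptedFun p (w.1, y))) ?_
      exact (neg_neg _).trans (cplx_baseDiff hw.1 e)
  rw [A.exists_J.choose_spec.2.2, A.vCoord_apply, map_smul, map_smul]
  congr 1
  rw [A.nuCoord_apply, A.nuCoord_apply]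
  have h3 : ∀ a b c d : FrameIdx E → ℂ, a + b + Complex.I • (c + d)
      = (a + Complex.I • c) + (b + Complex.I • d) := fun a b c d => by module
  rw [h3, map_add, map_add]
  refine congrArg₂ (· + ·) ((h1 w.2).trans ?_) (A.ham_cxDeriv hw _ _ h1)
  ext
  · refine congrArg (P.adaptedDiff p w) (Prod.ext rfl (funext fun a => ?_))
    simp
  · refine congrArg (P.adaptedDiff p w) (Prod.ext rfl (funext fun a => ?_))
    simp

end AlmostSpecialJoyceStructure

end

/-! ### Flatness of the connections in adapted charts -/

section

variable {E : Type*} [NormedAddCommGroup E] [NormedSpace ℂ E]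
  {M : Type*} [TopologicalSpace M] [ChartedSpace E M] [IsManifold 𝓘(ℂ, E) ω M]

open LatticePeriodStructure

theorem conj_vinc {F : Type*} (u : F → ℂ) :
    Cx.conj (vinc E F u) = vinc E F (conjPi F u) := by
  ext <;> simp

namespace AlmostSpecialJoyceStructure

variable {P : SpecialPeriodStructure E M} (A : AlmostSpecialJoyceStructure P)
  [FiniteDimensional ℂ E] {p : M} {w : CoordSpace E}

/-- The complex vector in coordinates that corresponds to `A^ζ_t` for the real vector `t` with
coordinates `e`. -/
def connVec (ζ : ℂ) (p : M) (w : CoordSpace E) (e : E) : Cx (CoordSpace E) :=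
  ⟨(e, rePi _ (A.connCoord ζ p w e)), (0, imPi _ (A.connCoord ζ p w e))⟩

/-- The vectors `(e, K^ζ_e)` span the image of `A^ζ`. -/
theorem map_connVec_mem_im {ζ : ℂ} (hζ : ζ ≠ 0) (hw : w ∈ P.adaptedDom p) (e : E) :
    Cx.map (P.adaptedDiff p w) (A.connVec ζ p w e) ∈ A.im ζ (P.adaptedFun p w) := by
  obtain ⟨X, hX⟩ : ∃ X : T10 E (P.adaptedFun p w).proj, X = toT10 _ (baseDiff p w.1 e) := ⟨_, rfl⟩
  have hh : A.h _ X = Cx.map (P.adaptedDiff p w) (horVec _ e + vinc E _ (A.hCoord p w e)) :=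
    hX ▸ A.h_adapted hw e
  have hv : A.v _ X = Cx.map (P.adaptedDiff p w) (vinc E _ (A.vCoord p w e)) :=
    hX ▸ A.v_adapted hw e
  have h1 : Cx.map (P.adaptedDiff p w) (A.connVec ζ p w e)
      = A.conn10 ζ _ ((1 / 2 : ℂ) • X) + A.conn01 ζ _ ((1 / 2 : ℂ) • X) := by
    have e1 : A.connVec ζ p w e = (1 / 2 : ℂ) • ((horVec _ e + vinc E _ (A.hCoord p w e))
        - ζ⁻¹ • Cx.conj (vinc E _ (A.vCoord p w e)))
        + (1 / 2 : ℂ) • (Cx.conj (horVec _ e + vinc E _ (A.hCoord p w e))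
        + ζ • vinc E _ (A.vCoord p w e)) := by
      have e2 : A.connVec ζ p w e = (1 / 2 : ℂ) • (horVec _ e + Cx.conj (horVec _ e))
          + vinc E _ (A.connCoord ζ p w e) := by
        ext <;> simp [connVec, horVec]
        module
      rw [e2, A.connCoord_apply]
      simp only [conj_vinc, map_add, map_smul]
      module
    have hc : starRingEnd ℂ (1 / 2) = 1 / 2 := by rw [map_div₀, map_one, map_ofNat]
    rw [e1, map_smul (A.conn10 ζ _), LinearMap.map_smulₛₗ (A.conn01 ζ _), hc, map_add,
      map_smul (Cx.map _), map_smul (Cx.map _), map_sub, map_add (Cx.map _) (Cx.conj _),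
      map_smul (Cx.map _), map_smul (Cx.map _), Cx.map_conj, Cx.map_conj, ← hh, ← hv]
    simp only [conn10, conn01, if_neg hζ, LinearMap.sub_apply, LinearMap.add_apply,
      LinearMap.smul_apply, LinearMap.comp_apply]
  rw [h1]
  exact Submodule.add_mem_sup ⟨_, rfl⟩ ⟨_, rfl⟩

/-- The image of `A^ζ` does not contain vertical vectors. -/
theorem eq_zero_of_mem_im {V : TB E M} {ζ : ℂ} (hζ : ζ ≠ 0) {d : Cx (TN V)} (hd : d ∈ A.im ζ V)
    (h0 : Cx.map (dproj V) d = 0) : d = 0 := by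
  obtain ⟨_, ⟨X, rfl⟩, _, ⟨Y, rfl⟩, rfl⟩ := Submodule.mem_sup.1 hd
  have h1 : Cx.map (dproj V) (A.conn10 ζ V X) = X := by
    simp only [conn10, if_neg hζ, LinearMap.sub_apply, LinearMap.smul_apply, LinearMap.comp_apply,
      map_sub, map_smul, Cx.map_conj, A.dproj_h, A.dproj_v, map_zero, smul_zero, sub_zero]
  have h2 : Cx.map (dproj V) (A.conn01 ζ V Y) = Cx.conj Y.1 := by
    simp only [conn01, LinearMap.add_apply, LinearMap.smul_apply, LinearMap.comp_apply,
      map_add, map_smul, Cx.map_conj, A.dproj_h, A.dproj_v, smul_zero, add_zero]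
  rw [map_add, h1, h2] at h0
  have h3 := congrArg Cx.re h0
  have h4 := congrArg Cx.im h0
  simp only [Cx.re_add, Cx.im_add, Cx.conj_re, Cx.conj_im, Cx.re_zero, Cx.im_zero,
    im_of_mem_T10 X, im_of_mem_T10 Y, neg_neg] at h3 h4
  have h5 : Y.1.re = X.1.re := by
    have h6 : cplx E V.proj (Y.1.re - X.1.re) = 0 := by
      rw [map_sub, ← h4]; abel
    have h7 : (Complex.I • (show E from Y.1.re - X.1.re) : E) = 0 := h6
    have h8 : (show E from Y.1.re - X.1.re) = 0 :=
      (smul_eq_zero.1 h7).resolve_left Complex.I_ne_zero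
    exact sub_eq_zero.1 h8
  rw [h5, ← two_smul ℝ] at h3
  have h8 : X.1.re = 0 := (smul_eq_zero_iff_right (two_ne_zero' ℝ)).1 h3
  have h9 : X = 0 := by rw [← toT10_re X, h8]; ext <;> simp [toT10]
  have h10 : Y = 0 := by rw [← toT10_re Y, h5, h8]; ext <;> simp [toT10]
  rw [h9, h10, map_zero, map_zero, add_zero]

end AlmostSpecialJoyceStructure

namespace SpecialJoyceStructure

variable {P : SpecialPeriodStructure E M} (A : SpecialJoyceStructure P)
  [FiniteDimensional ℂ E] {p : M} {w : CoordSpace E}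

/-- The pullback of the image of `A^ζ` under an adapted chart. -/
def imCoord (ζ : ℂ) (p : M) (w : CoordSpace E) : Submodule ℂ (Cx (CoordSpace E)) :=
  (A.im ζ (P.adaptedFun p w)).comap (Cx.map (P.adaptedDiff p w))

theorem isInvolutiveAt_imCoord {ζ : ℂ} (hζ : ζ ≠ 0) (hw : w ∈ P.adaptedDom p) :
    IsInvolutiveAt 𝓘(ℝ, CoordSpace E) (A.imCoord ζ p) w := by
  have hV : P.adaptedFun p w ∈ (P.adapted p).target := (P.adapted p).map_source' hw
  have h1 := IsInvolutiveAt.of_pullback (P.adapted p).symm (y := P.adaptedFun p w)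
    (D := A.imCoord ζ p) hV ?_ ((A.flat ζ hζ).at _)
  · have h2 : (P.adapted p).symm (P.adaptedFun p w) = w := (P.adapted p).left_inv' hw
    rwa [h2] at h1
  · filter_upwards [(P.adapted p).open_target.mem_nhds hV] with V hV u
    obtain ⟨z, hz, rfl⟩ : ∃ z ∈ P.adaptedDom p, P.adaptedFun p z = V :=
      ⟨_, (P.adapted p).map_target' hV, (P.adapted p).right_inv' hV⟩
    obtain ⟨d, rfl⟩ : ∃ d : Cx (CoordSpace E), Cx.map (P.adaptedDiff p z) d = u := by
      obtain ⟨a, ha⟩ := (P.adaptedDiff_bijective hz).2 u.re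
      obtain ⟨b, hb⟩ := (P.adaptedDiff_bijective hz).2 u.im
      exact ⟨⟨a, b⟩, Cx.ext ha hb⟩
    have h3 : ∀ z', z' = z → (d ∈ A.imCoord ζ p z' ↔ d ∈ A.imCoord ζ p z) := by
      rintro z' rfl; rfl
    refine Iff.trans (Iff.refl (d ∈ A.imCoord ζ p z))
      ((h3 _ ((P.adapted p).left_inv' hz)).symm.trans ?_)
    refine Eq.to_iff (congrArg (· ∈ A.imCoord ζ p ((P.adapted p).symm (P.adapted p z))) ?_)
    refine Cx.ext ?_ ?_
    · exact (mfderiv_symm_pdiff (P.adapted p) hz d.re).symm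
    · exact (mfderiv_symm_pdiff (P.adapted p) hz d.im).symm

/-- The flatness of `A^ζ` in coordinates: the brackets of the lifts `(e, K^ζ_e)` of constant vectors
are vertical and lie in the image of `A^ζ`, so they vanish. -/
theorem connCoord_flat {ζ : ℂ} (hζ : ζ ≠ 0) (hw : w ∈ P.adaptedDom p) (e f : E) :
    fderiv ℝ (A.connCoord ζ p) w (e, rePi _ (A.connCoord ζ p w e)) f
        + Complex.I • fderiv ℝ (A.connCoord ζ p) w (0, imPi _ (A.connCoord ζ p w e)) f
      = fderiv ℝ (A.connCoord ζ p) w (f, rePi _ (A.connCoord ζ p w f)) e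
        + Complex.I • fderiv ℝ (A.connCoord ζ p) w (0, imPi _ (A.connCoord ζ p w f)) e := by
  have hK : ∀ z ∈ P.adaptedDom p, ContDiffAt ℝ ∞ (A.connCoord ζ p) z := fun z hz =>
    A.contDiffAt_connCoord ζ hz
  have hK' := ((hK w hw).differentiableAt (by simp)).hasFDerivAt
  set K' := fderiv ℝ (A.connCoord ζ p) w with hKK
  have hre : ∀ e, HasFDerivAt (fun z => (A.connVec ζ p z e).re)
      ((ContinuousLinearMap.inr ℝ E (FrameIdx E → ℝ)).comp ((rePi _).comp (K'.flip e))) w := by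
    intro e
    have h1 : HasFDerivAt (fun z => A.connCoord ζ p z e) (K'.flip e) w :=
      (hK'.clm_apply (hasFDerivAt_const e w)).congr_fderiv
        (ContinuousLinearMap.ext fun a => by simp)
    have h2 := (hasFDerivAt_const e w).prodMk ((rePi (FrameIdx E)).hasFDerivAt.comp w h1)
    exact h2.congr_fderiv (ContinuousLinearMap.ext fun a => rfl)
  have him : ∀ e, HasFDerivAt (fun z => (A.connVec ζ p z e).im)
      ((ContinuousLinearMap.inr ℝ E (FrameIdx E → ℝ)).comp ((imPi _).comp (K'.flip e))) w := by
    intro e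
    have h1 : HasFDerivAt (fun z => A.connCoord ζ p z e) (K'.flip e) w :=
      (hK'.clm_apply (hasFDerivAt_const e w)).congr_fderiv
        (ContinuousLinearMap.ext fun a => by simp)
    have h2 := (hasFDerivAt_const (0 : E) w).prodMk ((imPi (FrameIdx E)).hasFDerivAt.comp w h1)
    exact h2.congr_fderiv (ContinuousLinearMap.ext fun a => rfl)
  have hs : ∀ e, SmoothCxFieldOn 𝓘(ℝ, CoordSpace E) (fun z => A.connVec ζ p z e)
      (P.adaptedDom p) := by
    intro e
    have h1 : ∀ z ∈ P.adaptedDom p, ContDiffAt ℝ ∞ (fun z => A.connCoord ζ p z e) z := fun z hz =>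
      (hK z hz).clm_apply contDiffAt_const
    refine ⟨smoothFieldOn_of_contDiffOn fun z hz => ?_,
      smoothFieldOn_of_contDiffOn fun z hz => ?_⟩
    · exact (contDiffAt_const.prodMk ((rePi (FrameIdx E)).contDiff.contDiffAt.comp z
        (h1 z hz))).contDiffWithinAt
    · exact (contDiffAt_const.prodMk ((imPi (FrameIdx E)).contDiff.contDiffAt.comp z
        (h1 z hz))).contDiffWithinAt
  have hmem : ∀ e, ∀ z ∈ P.adaptedDom p, A.connVec ζ p z e ∈ A.imCoord ζ p z := fun e z hz =>
    A.map_connVec_mem_im hζ hz e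
  have h1 := A.isInvolutiveAt_imCoord hζ hw _ (P.isOpen_adaptedDom p) hw _ _ (hs e) (hs f)
    (hmem e) (hmem f)
  have h2 : cxBracket 𝓘(ℝ, CoordSpace E) (fun z => A.connVec ζ p z e)
      (fun z => A.connVec ζ p z f) w
      = (⟨(0, rePi _ (K' (A.connVec ζ p w e).re f) - rePi _ (K' (A.connVec ζ p w f).re e)
          - (imPi _ (K' (A.connVec ζ p w e).im f) - imPi _ (K' (A.connVec ζ p w f).im e))),
        (0, imPi _ (K' (A.connVec ζ p w e).re f) - rePi _ (K' (A.connVec ζ p w f).im e)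
          + (rePi _ (K' (A.connVec ζ p w e).im f) - imPi _ (K' (A.connVec ζ p w f).re e)))⟩
        : Cx (CoordSpace E)) := by
    refine Cx.ext ?_ ?_
    · refine (congrArg₂ (· - ·) (mlieBracket_eq_fderiv (fun z => (A.connVec ζ p z e).re)
        (fun z => (A.connVec ζ p z f).re) w) (mlieBracket_eq_fderiv
        (fun z => (A.connVec ζ p z e).im) (fun z => (A.connVec ζ p z f).im) w)).trans ?_
      rw [(hre e).fderiv, (hre f).fderiv, (him e).fderiv, (him f).fderiv]
      exact Prod.ext (show (0 : E) - 0 - (0 - 0) = 0 by simp) rfl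
    · refine (congrArg₂ (· + ·) (mlieBracket_eq_fderiv (fun z => (A.connVec ζ p z e).re)
        (fun z => (A.connVec ζ p z f).im) w) (mlieBracket_eq_fderiv
        (fun z => (A.connVec ζ p z e).im) (fun z => (A.connVec ζ p z f).re) w)).trans ?_
      rw [(hre e).fderiv, (hre f).fderiv, (him e).fderiv, (him f).fderiv]
      exact Prod.ext (show (0 : E) - 0 + (0 - 0) = 0 by simp) rfl
  rw [h2] at h1
  have h3 := A.eq_zero_of_mem_im hζ h1 (Cx.ext
    ((P.dproj_adaptedDiff hw _).trans (map_zero _)) ((P.dproj_adaptedDiff hw _).trans (map_zero _)))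
  have h4 := congrArg Cx.re h3
  have h5 := congrArg Cx.im h3
  have h6 := congrArg Prod.snd ((P.adaptedDiff_bijective hw).1 (h4.trans (map_zero _).symm))
  have h7 := congrArg Prod.snd ((P.adaptedDiff_bijective hw).1 (h5.trans (map_zero _).symm))
  ext c
  have h8 : (K' (e, rePi _ (A.connCoord ζ p w e)) f c).re
      - (K' (f, rePi _ (A.connCoord ζ p w f)) e c).re
      - ((K' (0, imPi _ (A.connCoord ζ p w e)) f c).im
        - (K' (0, imPi _ (A.connCoord ζ p w f)) e c).im) = 0 := congrFun h6 c
  have h9 : (K' (e, rePi _ (A.connCoord ζ p w e)) f c).im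
      - (K' (0, imPi _ (A.connCoord ζ p w f)) e c).re
      + ((K' (0, imPi _ (A.connCoord ζ p w e)) f c).re
        - (K' (f, rePi _ (A.connCoord ζ p w f)) e c).im) = 0 := congrFun h7 c
  apply Complex.ext
  · simp only [Pi.add_apply, Pi.smul_apply, smul_eq_mul, Complex.add_re, Complex.mul_re,
      Complex.I_re, Complex.I_im]
    linear_combination h8
  · simp only [Pi.add_apply, Pi.smul_apply, smul_eq_mul, Complex.add_im, Complex.mul_im,
      Complex.I_re, Complex.I_im]
    linear_combination h9

/-- The 2-form on the total space that is determined by the connection `A^ζ` is closed. -/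
theorem connForm_closed {ζ : ℂ} (hζ : ζ ≠ 0) (hw : w ∈ P.adaptedDom p) :
    ∃ S' : CoordSpace E →L[ℝ] CoordSpace E →L[ℝ] CoordSpace E →L[ℝ] ℂ,
      HasFDerivAt (fun y => connForm (symp (Fin (Module.finrank ℂ E))) (A.connCoord ζ p y)) S' w ∧
      ∀ a b c, S' a b c + S' b c a + S' c a b = 0 := by
  have hK := A.contDiffAt_connCoord ζ hw
  refine SpecialJoyce.connForm_closed (symp_neg_flip _) (symp_smul_right _ _)
    (hK.of_le (by simp)) (A.connCoord_flat hζ hw) fun f u u' => ?_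
  have h1 := (A.isHamiltonianAt_connCoord ζ hw f).2 u u'
  have h2 : ∀ a, fderiv ℝ (fun z => A.connCoord ζ p z f) w a
      = fderiv ℝ (A.connCoord ζ p) w a f := by
    intro a
    rw [fderiv_clm_apply (hK.differentiableAt (by simp)) (differentiableAt_const _)]
    simp
  rw [h2, h2] at h1
  exact h1

end SpecialJoyceStructure

end

/-! ### The hyperkähler structure at a point of `TM` -/

section

variable {E : Type*} [NormedAddCommGroup E] [NormedSpace ℂ E]
  {M : Type*} [TopologicalSpace M] [ChartedSpace E M] [IsManifold 𝓘(ℂ, E) ω M]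
  [FiniteDimensional ℂ E]

open LatticePeriodStructure

namespace LatticePeriodStructure

variable (P : LatticePeriodStructure E M) {p : M} {w : CoordSpace E}

/-- A linear left inverse of `ν`. On vertical vectors it agrees with the set-theoretic inverse which
enters the definition of `ω^ν`; being linear on all of `TN`, it makes `ω^ν` accessible to bilinear
algebra. -/
def nuInv (V : TB E M) : TN V →ₗ[ℝ] TangentSpace 𝓘(ℝ, E) V.proj :=
  (LinearMap.exists_leftInverse_of_injective (nu V)
    (LinearMap.ker_eq_bot.2 (P.nu_injective V))).choose

theorem nuInv_nu (V : TB E M) (t : TangentSpace 𝓘(ℝ, E) V.proj) : P.nuInv V (nu V t) = t :=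
  LinearMap.congr_fun (LinearMap.exists_leftInverse_of_injective (nu V)
    (LinearMap.ker_eq_bot.2 (P.nu_injective V))).choose_spec t

/-- A bilinear extension of the form `ω^ν` from vertical vectors to all tangent vectors. -/
def omegaExt (V : TB E M) : TN V →ₗ[ℝ] TN V →ₗ[ℝ] ℝ :=
  (P.omega V.proj).compl₁₂ (P.nuInv V) (P.nuInv V)

/-- On vertical vectors, the bilinear extension `omegaExt` is `ω^ν`. -/
theorem omegaNu_eq {V : TB E M} {a b : TN V} (ha : dproj V a = 0) (hb : dproj V b = 0) :
    P.omegaNu V a b = P.omegaExt V a b := by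
  obtain ⟨t, rfl⟩ := (P.dproj_eq_zero_iff V a).1 ha
  obtain ⟨u, rfl⟩ := (P.dproj_eq_zero_iff V b).1 hb
  rw [omegaNu, Function.leftInverse_invFun (P.nu_injective V),
    Function.leftInverse_invFun (P.nu_injective V)]
  simp [omegaExt, nuInv_nu]

theorem omega_neg_flip (q : M) (a b : TangentSpace 𝓘(ℝ, E) q) : P.omega q a b = -P.omega q b a := by
  rw [omega_apply, omega_apply, ← Finset.sum_neg_distrib]
  exact Finset.sum_congr rfl fun i _ => by ring

theorem omegaExt_neg_flip (V : TB E M) (a b : TN V) : P.omegaExt V a b = -P.omegaExt V b a :=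
  P.omega_neg_flip _ _ _

theorem omegaExt_adapted (hw : w ∈ P.adaptedDom p) (y y' : FrameIdx E → ℝ) :
    (P.omegaExt (P.adaptedFun p w) (P.adaptedDiff p w (0, y)) (P.adaptedDiff p w (0, y')) : ℂ)
      = symp _ (ofRealPi _ y) (ofRealPi _ y') := by
  rw [P.adaptedDiff_vertical hw, P.adaptedDiff_vertical hw]
  have e : ∀ y, P.nuInv (P.adaptedFun p w) (nu (P.adaptedFun p w)
      (P.frameSum p ((extChartAt 𝓘(ℝ, E) p).symm w.1) y)) = _ := fun y => P.nuInv_nu _ _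
  rw [← P.omega_frameSum hw.2, omegaExt]
  exact congrArg Complex.ofReal
    (congrArg₂ (fun s t => P.omega ((extChartAt 𝓘(ℝ, E) p).symm w.1) s t) (e y) (e y'))

theorem bilin_omegaExt_adapted (hw : w ∈ P.adaptedDom p) (u u' : FrameIdx E → ℂ) :
    Cx.bilinₗ (P.omegaExt (P.adaptedFun p w)) (Cx.map (P.adaptedDiff p w) (vinc E _ u))
      (Cx.map (P.adaptedDiff p w) (vinc E _ u')) = symp _ u u' := by
  conv_rhs => rw [← rePi_add_imPi u, ← rePi_add_imPi u']
  simp only [map_add, add_apply, symp_smul_left, symp_smul_right, ← P.omegaExt_adapted hw]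
  apply Complex.ext <;> simp [Cx.bilinₗ_apply, Cx.bilin] <;> ring

end LatticePeriodStructure

namespace AlmostSpecialJoyceStructure

variable {P : SpecialPeriodStructure E M} (A : AlmostSpecialJoyceStructure P) (V : TB E M)

theorem isSplitting : IsSplitting (A.h V) (A.v V) := A.nondegenerate V

/-- The skew-hermitian form `(X, Y) ↦ ω^ν(v_X, conj v_Y)`. -/
def kappa : T10 E V.proj →ₛₗ[starRingEnd ℂ] T10 E V.proj →ₗ[ℂ] ℂ :=
  sesq (P.omegaExt V) (A.v V)

theorem kappa_flip (X Y : T10 E V.proj) : A.kappa V Y X = -starRingEnd ℂ (A.kappa V X Y) :=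
  sesq_flip (P.omegaExt_neg_flip V) _ X Y

theorem dproj_v_re (X : T10 E V.proj) : dproj V (A.v V X).re = 0 := congrArg Cx.re (A.dproj_v V X)

theorem dproj_v_im (X : T10 E V.proj) : dproj V (A.v V X).im = 0 := congrArg Cx.im (A.dproj_v V X)

theorem bilin_omegaNu_v (X Y : T10 E V.proj) :
    Cx.bilin (P.omegaNu V) (A.v V X) (A.v V Y) = Cx.bilinₗ (P.omegaExt V) (A.v V X) (A.v V Y) := by
  have h1 := A.dproj_v_re V
  have h2 := A.dproj_v_im V
  rw [Cx.bilinₗ_apply, Cx.bilin, Cx.bilin, P.omegaNu_eq (h1 _) (h1 _), P.omegaNu_eq (h1 _) (h2 _),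
    P.omegaNu_eq (h2 _) (h1 _), P.omegaNu_eq (h2 _) (h2 _)]

theorem bilin_omegaNu_v_conj (X Y : T10 E V.proj) :
    Cx.bilin (P.omegaNu V) (A.v V X) (Cx.conj (A.v V Y)) = A.kappa V X Y := by
  have h1 := A.dproj_v_re V
  have h2 := A.dproj_v_im V
  have h3 : ∀ X, dproj V (-(A.v V X).im) = 0 := fun X => by rw [map_neg, h2, neg_zero]
  rw [kappa, sesq_apply, Cx.bilinₗ_apply, Cx.bilin, Cx.bilin, Cx.conj_re, Cx.conj_im,
    P.omegaNu_eq (h1 _) (h1 _), P.omegaNu_eq (h1 _) (h3 _),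
    P.omegaNu_eq (h2 _) (h1 _), P.omegaNu_eq (h2 _) (h3 _)]

/-- The values of `ω₃` on real vectors. The constant is half of the `1 / 4π²` of its definition. -/
theorem ω₃_reSum (q q' : T10 E V.proj × T10 E V.proj) :
    A.ω₃ V (reSum (A.h V) (A.v V) q) (reSum (A.h V) (A.v V) q')
      = -(1 / (8 * Real.pi ^ 2)) * (A.kappa V q.2 q'.2 - A.kappa V q.1 q'.1).re := by
  set c : ℂ := -(1 / (4 * Real.pi ^ 2) : ℂ) with hc
  have hcr : c = ((-(1 / (4 * Real.pi ^ 2)) : ℝ) : ℂ) := by simp [hc]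
  have hcc : starRingEnd ℂ c = c := by rw [hcr, Complex.conj_ofReal]
  have hκ : ∀ X Y, (c • A.kappa V) Y X = -starRingEnd ℂ ((c • A.kappa V) X Y) := by
    intro X Y
    simp only [LinearMap.smul_apply, smul_eq_mul, map_mul, hcc, A.kappa_flip V X Y]
    ring
  obtain ⟨f1, f2, f3, f4, f5, f6, f7⟩ := (A.isSplitting V).form_spec (c • A.kappa V) hκ
  have h1 : A.IsOmega₃ V (A.ω₃ V) := Classical.epsilon_spec (p := A.IsOmega₃ V)
    ⟨(A.isSplitting V).form (c • A.kappa V), f1,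
      fun X Y => by rw [bilin_omegaNu_v_conj]; exact f2 X Y,
      fun X Y => by rw [bilin_omegaNu_v_conj]; exact f3 X Y, f4, f5, f6, f7⟩
  rw [form_reSum h1.alt (c • A.kappa V) hκ
    (fun X Y => (h1.v_conj_v X Y).trans (by rw [bilin_omegaNu_v_conj]; rfl))
    (fun X Y => (h1.h_conj_h X Y).trans (by rw [bilin_omegaNu_v_conj]; rfl))
    h1.h_h h1.v_v h1.h_v h1.h_conj_v, hcr]
  simp only [LinearMap.smul_apply, smul_eq_mul, ← mul_sub, Complex.re_ofReal_mul]
  ring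

theorem acs_unit {ζ : ℂ} (hζ : ζ * starRingEnd ℂ ζ = 1) :
    negEigenspace (A.acs ζ V) = A.im ζ V ∧ ∀ q, A.acs ζ V (reSum (A.h V) (A.v V) q)
      = reSum (A.h V) (A.v V) (acsUnit (T10 E V.proj) ζ q) :=
  (A.isSplitting V).epsilon_unit hζ

theorem negEigenspace_I₁ : negEigenspace (A.I₁ V) = A.im Complex.I V :=
  (A.acs_unit V (by simp)).1

theorem negEigenspace_I₂ : negEigenspace (A.I₂ V) = A.im (-1) V :=
  (A.acs_unit V (by simp)).1

theorem I₁_reSum (X Y : T10 E V.proj) : A.I₁ V (reSum (A.h V) (A.v V) (X, Y))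
    = reSum (A.h V) (A.v V) (-Y, X) := by
  rw [I₁, (A.acs_unit V (by simp)).2]
  simp [acsUnit, smul_smul]

theorem I₂_reSum (X Y : T10 E V.proj) : A.I₂ V (reSum (A.h V) (A.v V) (X, Y))
    = reSum (A.h V) (A.v V) (-(Complex.I • Y), -(Complex.I • X)) := by
  rw [I₂, (A.acs_unit V (by simp)).2]
  simp [acsUnit]

theorem I₃_reSum (X Y : T10 E V.proj) : A.I₃ V (reSum (A.h V) (A.v V) (X, Y))
    = reSum (A.h V) (A.v V) (Complex.I • X, -(Complex.I • Y)) :=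
  (A.isSplitting V).epsilon_zero.2 (X, Y)

/-- The metric `g` as a bilinear form. -/
def gBilin : TN V →ₗ[ℝ] TN V →ₗ[ℝ] ℝ := (A.ω₃ V).compl₂ (A.I₃ V)

theorem gBilin_reSum (X Y X' Y' : T10 E V.proj) :
    A.gBilin V (reSum (A.h V) (A.v V) (X, Y)) (reSum (A.h V) (A.v V) (X', Y'))
      = -(1 / (8 * Real.pi ^ 2)) * (A.kappa V X X' + A.kappa V Y Y').im := by
  rw [gBilin, LinearMap.compl₂_apply, I₃_reSum, ω₃_reSum]
  simp [add_comm]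

theorem exists_reSum (a : TN V) : ∃ X Y, reSum (A.h V) (A.v V) (X, Y) = a := by
  obtain ⟨q, rfl⟩ := (A.isSplitting V).bijective.2 a
  exact ⟨q.1, q.2, rfl⟩

theorem I₁_sq (a : TN V) : A.I₁ V (A.I₁ V a) = -a := by
  obtain ⟨X, Y, rfl⟩ := A.exists_reSum V a
  rw [I₁_reSum, I₁_reSum, ← map_neg, Prod.neg_mk]

theorem I₂_sq (a : TN V) : A.I₂ V (A.I₂ V a) = -a := by
  obtain ⟨X, Y, rfl⟩ := A.exists_reSum V a
  rw [I₂_reSum, I₂_reSum, ← map_neg, Prod.neg_mk]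
  simp [smul_smul]

theorem I₃_sq (a : TN V) : A.I₃ V (A.I₃ V a) = -a := by
  obtain ⟨X, Y, rfl⟩ := A.exists_reSum V a
  rw [I₃_reSum, I₃_reSum, ← map_neg, Prod.neg_mk]
  simp [smul_smul]

theorem I₁_I₂ (a : TN V) : A.I₁ V (A.I₂ V a) = A.I₃ V a := by
  obtain ⟨X, Y, rfl⟩ := A.exists_reSum V a
  rw [I₂_reSum, I₁_reSum, I₃_reSum, neg_neg]

theorem I₂_I₁ (a : TN V) : A.I₂ V (A.I₁ V a) = -A.I₃ V a := by
  obtain ⟨X, Y, rfl⟩ := A.exists_reSum V a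
  rw [I₁_reSum, I₂_reSum, I₃_reSum, ← map_neg, Prod.neg_mk, neg_neg, smul_neg, neg_neg]

theorem gBilin_symm (a b : TN V) : A.gBilin V a b = A.gBilin V b a := by
  obtain ⟨X, Y, rfl⟩ := A.exists_reSum V a
  obtain ⟨X', Y', rfl⟩ := A.exists_reSum V b
  rw [gBilin_reSum, gBilin_reSum, A.kappa_flip V X X', A.kappa_flip V Y Y']
  simp

theorem gBilin_I₁ (a b : TN V) : A.gBilin V (A.I₁ V a) (A.I₁ V b) = A.gBilin V a b := by
  obtain ⟨X, Y, rfl⟩ := A.exists_reSum V a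
  obtain ⟨X', Y', rfl⟩ := A.exists_reSum V b
  rw [I₁_reSum, I₁_reSum, gBilin_reSum, gBilin_reSum]
  simp [add_comm]

theorem kappa_I_smul (X Y : T10 E V.proj) :
    A.kappa V (Complex.I • X) (Complex.I • Y) = A.kappa V X Y := by
  simp [← mul_assoc]

theorem gBilin_I₂ (a b : TN V) : A.gBilin V (A.I₂ V a) (A.I₂ V b) = A.gBilin V a b := by
  obtain ⟨X, Y, rfl⟩ := A.exists_reSum V a
  obtain ⟨X', Y', rfl⟩ := A.exists_reSum V b
  rw [I₂_reSum, I₂_reSum, gBilin_reSum, gBilin_reSum]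
  simp only [map_neg, LinearMap.neg_apply, neg_neg, kappa_I_smul, add_comm]

theorem gBilin_I₃ (a b : TN V) : A.gBilin V (A.I₃ V a) (A.I₃ V b) = A.gBilin V a b := by
  obtain ⟨X, Y, rfl⟩ := A.exists_reSum V a
  obtain ⟨X', Y', rfl⟩ := A.exists_reSum V b
  rw [I₃_reSum, I₃_reSum, gBilin_reSum, gBilin_reSum]
  simp only [map_neg, LinearMap.neg_apply, neg_neg, kappa_I_smul]

/-- The form `ω₁ = g(I₁ -, -)`. -/
def ω₁ : TN V →ₗ[ℝ] TN V →ₗ[ℝ] ℝ := (A.gBilin V).comp (A.I₁ V)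

/-- The form `ω₂ = g(I₂ -, -)`. -/
def ω₂ : TN V →ₗ[ℝ] TN V →ₗ[ℝ] ℝ := (A.gBilin V).comp (A.I₂ V)

theorem ω₁_reSum (X Y X' Y' : T10 E V.proj) :
    A.ω₁ V (reSum (A.h V) (A.v V) (X, Y)) (reSum (A.h V) (A.v V) (X', Y'))
      = -(1 / (8 * Real.pi ^ 2)) * (A.kappa V X Y' - A.kappa V Y X').im := by
  rw [ω₁, LinearMap.comp_apply, I₁_reSum, gBilin_reSum]
  simp
  ring

theorem ω₂_reSum (X Y X' Y' : T10 E V.proj) :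
    A.ω₂ V (reSum (A.h V) (A.v V) (X, Y)) (reSum (A.h V) (A.v V) (X', Y'))
      = -(1 / (8 * Real.pi ^ 2)) * (A.kappa V Y X' + A.kappa V X Y').re := by
  rw [ω₂, LinearMap.comp_apply, I₂_reSum, gBilin_reSum]
  simp

theorem ω₃_eq (a b : TN V) : A.ω₃ V a b = A.gBilin V (A.I₃ V a) b := by
  obtain ⟨X, Y, rfl⟩ := A.exists_reSum V a
  obtain ⟨X', Y', rfl⟩ := A.exists_reSum V b
  rw [I₃_reSum, gBilin_reSum, ω₃_reSum]
  simp
  ring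

end AlmostSpecialJoyceStructure

namespace SpecialJoyceStructure

variable {P : SpecialPeriodStructure E M} (A : SpecialJoyceStructure P)

/-- As `ω^ν` is of type `(1,1)` for `I₃` and the `v_X` are of one type, it vanishes on pairs of
them. -/
theorem bilin_omegaExt_v (V : TB E M) (X Y : T10 E V.proj) :
    Cx.bilinₗ (P.omegaExt V) (A.v V X) (A.v V Y) = 0 := by
  rw [← A.bilin_omegaNu_v]
  have hr := A.dproj_v_re V
  have hm := A.dproj_v_im V
  have h1 : ∀ X, A.I₃ V (A.v V X).re = -(A.v V X).im := by
    intro X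
    rw [v_re (h := A.h V), v_im (h := A.h V), A.I₃_reSum, ← map_neg]
    simp
  have h2 : ∀ X, A.I₃ V (A.v V X).im = (A.v V X).re := by
    intro X
    rw [← neg_neg (A.v V X).im, ← h1, map_neg, A.I₃_sq, neg_neg]
  have e1 : P.omegaNu V (A.v V X).re (A.v V Y).re = P.omegaNu V (A.v V X).im (A.v V Y).im := by
    rw [← A.type11 V _ _ (hm X) (hm Y), h2, h2]
  have e2 : P.omegaNu V (A.v V X).re (A.v V Y).im = -P.omegaNu V (A.v V X).im (A.v V Y).re := by
    rw [← A.type11 V _ _ (hr X) (hm Y), h1, h2, P.omegaNu_eq (by rw [map_neg, hm, neg_zero]) (hr Y),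
      P.omegaNu_eq (hm X) (hr Y), map_neg, LinearMap.neg_apply]
  apply Complex.ext <;> simp [Cx.bilin, e1, e2]

variable {p : M} {w : CoordSpace E}

/-- The 2-forms `ω₁`, `ω₂`, `ω₃` in an adapted chart. -/
theorem forms_adapted (hw : w ∈ P.adaptedDom p) (a b : CoordSpace E) :
    A.ω₃ (P.adaptedFun p w) (P.adaptedDiff p w a) (P.adaptedDiff p w b)
      = -(1 / (4 * Real.pi ^ 2)) * (connForm (symp _) (A.connCoord 1 p w) a b).re ∧
    A.ω₁ (P.adaptedFun p w) (P.adaptedDiff p w a) (P.adaptedDiff p w b)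
      = 1 / (4 * Real.pi ^ 2) * (connForm (symp _) (A.connCoord 1 p w) a b).im ∧
    A.ω₂ (P.adaptedFun p w) (P.adaptedDiff p w a) (P.adaptedDiff p w b)
      = 1 / (4 * Real.pi ^ 2) * (connForm (symp _) (A.connCoord Complex.I p w) a b).im := by
  set V := P.adaptedFun p w with hV
  have hX : ∀ X : T10 E V.proj, ∃ e, A.h V X
      = Cx.map (P.adaptedDiff p w) (horVec _ e + vinc E _ (A.hCoord p w e)) ∧
      A.v V X = Cx.map (P.adaptedDiff p w) (vinc E _ (A.vCoord p w e)) := by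
    intro X
    obtain ⟨e, he⟩ := (baseDiff_isInvertible hw.1).surjective X.1.re
    have h1 : toT10 V.proj (baseDiff p w.1 e) = X := by
      rw [← toT10_re X]
      exact congrArg (toT10 V.proj) he
    exact ⟨e, h1 ▸ A.h_adapted hw e, h1 ▸ A.v_adapted hw e⟩
  obtain ⟨X, Y, hab⟩ := A.exists_reSum V (P.adaptedDiff p w a)
  obtain ⟨X', Y', hab'⟩ := A.exists_reSum V (P.adaptedDiff p w b)
  obtain ⟨e, hhX, hvX⟩ := hX X
  obtain ⟨f, hhY, hvY⟩ := hX Y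
  obtain ⟨e', hhX', hvX'⟩ := hX X'
  obtain ⟨f', hhY', hvY'⟩ := hX Y'
  -- the vertical part of `Re h_X + Re v_Y` with respect to `A^ζ`
  have hvert : ∀ (ζ : ℂ) (a : CoordSpace E) (X Y : T10 E V.proj) (e f : E), A.h V X
      = Cx.map (P.adaptedDiff p w) (horVec _ e + vinc E _ (A.hCoord p w e)) →
      A.v V Y = Cx.map (P.adaptedDiff p w) (vinc E _ (A.vCoord p w f)) →
      reSum (A.h V) (A.v V) (X, Y) = P.adaptedDiff p w a →
      vertPart (A.connCoord ζ p w) a = (1 / 2 : ℂ) • (A.vCoord p w f + conjPi _ (A.vCoord p w f)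
        + ζ⁻¹ • conjPi _ (A.vCoord p w e) - ζ • A.vCoord p w e) := by
    intro ζ a X Y e f hX hY hXY
    have h1 : P.adaptedDiff p w a = P.adaptedDiff p w
        ((horVec (FrameIdx E) e + vinc E _ (A.hCoord p w e)).re
          + (vinc E _ (A.vCoord p w f)).re) := by
      rw [← hXY, map_add]
      exact congrArg₂ (· + ·) (congrArg Cx.re hX) (congrArg Cx.re hY)
    have h2 : a = (e, rePi _ (A.hCoord p w e) + rePi _ (A.vCoord p w f)) := by
      rw [(P.adaptedDiff_bijective hw).1 h1]
      simp [horVec]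
    have h3 : ∀ u : FrameIdx E → ℂ, ofRealPi _ (rePi _ u) = (1 / 2 : ℂ) • (u + conjPi _ u) := by
      intro u
      ext c
      simp [Complex.add_conj]
    rw [vertPart_apply, h2, map_add, h3, h3, A.connCoord_apply]
    module
  have hk : ∀ (X Y : T10 E V.proj) (e f : E),
      A.v V X = Cx.map (P.adaptedDiff p w) (vinc E _ (A.vCoord p w e)) →
      A.v V Y = Cx.map (P.adaptedDiff p w) (vinc E _ (A.vCoord p w f)) →
      symp _ (A.vCoord p w e) (conjPi _ (A.vCoord p w f)) = A.kappa V X Y ∧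
      symp _ (A.vCoord p w e) (A.vCoord p w f) = 0 := by
    intro X Y e f hX hY
    constructor
    · rw [AlmostSpecialJoyceStructure.kappa, sesq_apply, hX, hY, ← Cx.map_conj, conj_vinc,
        P.bilin_omegaExt_adapted hw]
    · rw [← A.bilin_omegaExt_v V X Y, hX, hY, P.bilin_omegaExt_adapted hw]
  have hcc : ∀ e f : E, symp _ (conjPi _ (A.vCoord p w e)) (A.vCoord p w f)
      = -symp _ (A.vCoord p w f) (conjPi _ (A.vCoord p w e)) := fun e f => symp_neg_flip _ _ _
  -- `Ω_ζ` in terms of `κ`, from which the three forms are read off at `ζ = 1` and `ζ = i`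
  have hΩ : ∀ ζ : ℂ, ζ ≠ 0 → connForm (symp _) (A.connCoord ζ p w) a b = (1 / 4 : ℂ) *
      (A.kappa V Y Y' + starRingEnd ℂ (A.kappa V Y Y')
        - (A.kappa V X X' + starRingEnd ℂ (A.kappa V X X'))
        + ζ⁻¹ * (A.kappa V Y X' + starRingEnd ℂ (A.kappa V X Y'))
        - ζ * (starRingEnd ℂ (A.kappa V Y X') + A.kappa V X Y')) := by
    intro ζ hζ
    rw [connForm_apply, hvert ζ a X Y e f hhX hvY hab, hvert ζ b X' Y' e' f' hhX' hvY' hab']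
    simp only [map_add, map_sub, add_apply, sub_apply,
      symp_smul_left, symp_smul_right, symp_conj, hcc, (hk _ _ _ _ hvY hvY').2,
      (hk _ _ _ _ hvY hvX').2, (hk _ _ _ _ hvX hvY').2, (hk _ _ _ _ hvX hvX').2, map_zero,
      (hk _ _ _ _ hvY hvY').1, (hk _ _ _ _ hvY hvX').1, (hk _ _ _ _ hvX hvY').1,
      (hk _ _ _ _ hvX hvX').1, (hk _ _ _ _ hvY' hvY).1, (hk _ _ _ _ hvY' hvX).1,
      (hk _ _ _ _ hvX' hvY).1, (hk _ _ _ _ hvX' hvX).1, A.kappa_flip V Y Y', A.kappa_flip V Y X',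
      A.kappa_flip V X Y', A.kappa_flip V X X']
    linear_combination (-(1 / 4) * (A.kappa V X X' + starRingEnd ℂ (A.kappa V X X')))
      * mul_inv_cancel₀ hζ
  rw [hΩ 1 one_ne_zero, hΩ Complex.I Complex.I_ne_zero, ← hab, ← hab', A.ω₃_reSum,
    A.ω₁_reSum, A.ω₂_reSum]
  generalize A.kappa V Y Y' = k₁
  generalize A.kappa V X X' = k₂
  generalize A.kappa V Y X' = k₃
  generalize A.kappa V X Y' = k₄
  have h4 : ∀ z : ℂ, (1 / 4 * z).re = 1 / 4 * z.re ∧ (1 / 4 * z).im = 1 / 4 * z.im := by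
    intro z
    rw [show (1 / 4 : ℂ) = ((1 / 4 : ℝ) : ℂ) by norm_num, Complex.re_ofReal_mul,
      Complex.im_ofReal_mul]
    exact ⟨rfl, rfl⟩
  simp only [(h4 _).1, (h4 _).2]
  refine ⟨?_, ?_, ?_⟩
  · simp
    ring
  · simp
    ring
  · simp
    ring

/-- The form `κ` is non-degenerate, because `ω^ν` is, and the vertical space is spanned by the real
parts of the vectors `v_Y`, while the pairings of `v_X` with other `v_Y` vanish. -/
theorem eq_zero_of_kappa {V : TB E M} {X : T10 E V.proj} (h : ∀ Y, A.kappa V X Y = 0) : X = 0 := by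
  obtain ⟨p, w, hw, rfl⟩ := P.exists_adapted V
  obtain ⟨e, he⟩ := (baseDiff_isInvertible hw.1).surjective X.1.re
  have h1 : toT10 (P.adaptedFun p w).proj (baseDiff p w.1 e) = X := by
    rw [← toT10_re X]
    exact congrArg (toT10 (P.adaptedFun p w).proj) he
  have hv : A.v (P.adaptedFun p w) X = Cx.map (P.adaptedDiff p w) (vinc E _ (A.vCoord p w e)) :=
    h1 ▸ A.v_adapted hw e
  have h2 : A.vCoord p w e = 0 := by
    refine symp_nondegenerate _ fun y => ?_
    obtain ⟨X', Y', hy⟩ := A.exists_reSum (P.adaptedFun p w) (P.adaptedDiff p w (0, y))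
    have h3 : X' = 0 := by
      have h4 := congrArg (dproj (P.adaptedFun p w)) hy
      have h5 : dproj (P.adaptedFun p w) (A.h (P.adaptedFun p w) X').re = X'.1.re :=
        congrArg Cx.re (A.dproj_h (P.adaptedFun p w) X')
      rw [show reSum (A.h (P.adaptedFun p w)) (A.v (P.adaptedFun p w)) (X', Y')
        = (A.h _ X').re + (A.v _ Y').re from rfl, map_add, h5, A.dproj_v_re, add_zero] at h4
      have h6 : X'.1.re = 0 := h4.trans ((P.dproj_adaptedDiff hw _).trans (map_zero _))
      rw [← toT10_re X', h6]
      ext <;> simp [toT10]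
    have h4 : Cx.map (P.adaptedDiff p w) (vinc E _ (ofRealPi _ y))
        = (1 / 2 : ℂ) • (A.v (P.adaptedFun p w) Y' + Cx.conj (A.v (P.adaptedFun p w) Y')) := by
      have h5 : P.adaptedDiff p w (0, y) = (A.v (P.adaptedFun p w) Y').re := by
        rw [← hy, h3, v_re (h := A.h (P.adaptedFun p w))]
      ext
      · simp only [Cx.map_re, vinc_re]
        refine Eq.trans (h5 ▸ rfl) (?_ : (A.v (P.adaptedFun p w) Y').re = _)
        simp
        module
      · simp only [Cx.map_im, vinc_im]
        refine Eq.trans ?_ (?_ : (0 : TN (P.adaptedFun p w)) = _)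
        · refine Eq.trans (congrArg (P.adaptedDiff p w) ?_) (map_zero _)
          ext <;> simp
        · simp
    rw [symp_neg_flip, symp_neg_flip _ _ 0, ← P.bilin_omegaExt_adapted hw, ← hv, h4, map_smul,
      map_add, A.bilin_omegaExt_v]
    have h6 : Cx.bilinₗ (P.omegaExt (P.adaptedFun p w)) (A.v (P.adaptedFun p w) X)
        (Cx.conj (A.v (P.adaptedFun p w) Y')) = 0 := h Y'
    rw [h6]
    simp
  have h3 : A.v (P.adaptedFun p w) X = 0 := by rw [hv, h2, map_zero, map_zero]
  have h4 : reSum (A.h (P.adaptedFun p w)) (A.v (P.adaptedFun p w)) (0, X)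
      = reSum (A.h (P.adaptedFun p w)) (A.v (P.adaptedFun p w)) 0 := by
    rw [← v_re (h := A.h (P.adaptedFun p w)), h3, map_zero]
    rfl
  exact congrArg Prod.snd ((A.isSplitting (P.adaptedFun p w)).bijective.1 h4)

theorem neg_scale_ne_zero : -(1 / (8 * Real.pi ^ 2)) ≠ 0 := by
  have := Real.pi_ne_zero
  simp [this]

/-- `g` is the imaginary part of the hermitian form `κ ⊕ κ`, up to a constant. -/
theorem gBilin_nondegenerate {V : TB E M} {a : TN V} (h : ∀ b, A.gBilin V a b = 0) : a = 0 := by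
  obtain ⟨X, Y, rfl⟩ := A.exists_reSum V a
  have key : ∀ X' Y', (A.kappa V X X' + A.kappa V Y Y').im = 0 := fun X' Y' => by
    have := h (reSum (A.h V) (A.v V) (X', Y'))
    rw [A.gBilin_reSum] at this
    exact (mul_eq_zero.1 this).resolve_left neg_scale_ne_zero
  have hX : X = 0 := A.eq_zero_of_kappa fun X' => by
    -- the real part of `κ(X, X')` is the imaginary part of `κ(X, i X')`
    have h1 := key X' 0
    have h2 := key (Complex.I • X') 0
    simp at h1 h2
    exact Complex.ext h2 h1
  have hY : Y = 0 := A.eq_zero_of_kappa fun X' => by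
    have h1 := key 0 X'
    have h2 := key 0 (Complex.I • X')
    simp at h1 h2
    exact Complex.ext h2 h1
  rw [hX, hY]
  exact map_zero _

end SpecialJoyceStructure

end

/-! ### Integrability from closed forms -/

section VectorSpace

variable {W : Type*} [NormedAddCommGroup W] [NormedSpace ℝ W]
  {K K' : Type*} [NormedAddCommGroup K] [NormedSpace ℝ K] [NormedAddCommGroup K'] [NormedSpace ℝ K']

/-- The composition of a bilinear form with a linear map of its values. -/
def postComp (W : Type*) [NormedAddCommGroup W] [NormedSpace ℝ W] (L : K →L[ℝ] K') :
    (W →L[ℝ] W →L[ℝ] K) →L[ℝ] (W →L[ℝ] W →L[ℝ] K') :=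
  ContinuousLinearMap.compL ℝ W (W →L[ℝ] K) (W →L[ℝ] K') (ContinuousLinearMap.compL ℝ W K K' L)

theorem contDiffAt_postComp {Y : Type*} [NormedAddCommGroup Y] [NormedSpace ℝ Y] {n : WithTop ℕ∞}
    (L : K →L[ℝ] K') {s : Y → W →L[ℝ] W →L[ℝ] K} {x : Y} (hs : ContDiffAt ℝ n s x) :
    ContDiffAt ℝ n (fun y => postComp W L (s y)) x := by
  have h : ContDiff ℝ n (postComp W L : (W →L[ℝ] W →L[ℝ] K) → (W →L[ℝ] W →L[ℝ] K')) :=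
    ContinuousLinearMap.contDiff _
  exact h.contDiffAt.comp x hs

theorem hasFDerivAt_postComp (L : K →L[ℝ] K') (s : W →L[ℝ] W →L[ℝ] K) :
    HasFDerivAt (postComp W L : (W →L[ℝ] W →L[ℝ] K) → (W →L[ℝ] W →L[ℝ] K')) (postComp W L) s :=
  ContinuousLinearMap.hasFDerivAt _

theorem exists_hasFDerivAt_postComp {Y : Type*} [NormedAddCommGroup Y] [NormedSpace ℝ Y]
    (L : K →L[ℝ] K') {s : Y → W →L[ℝ] W →L[ℝ] K} {s' : Y →L[ℝ] W →L[ℝ] W →L[ℝ] K} {x : Y}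
    (hs : HasFDerivAt s s' x) : ∃ t' : Y →L[ℝ] W →L[ℝ] W →L[ℝ] K',
      HasFDerivAt (fun y => postComp W L (s y)) t' x ∧ ∀ a b c, t' a b c = L (s' a b c) := by
  have h := HasFDerivAt.comp (𝕜 := ℝ) (E := Y) (F := W →L[ℝ] W →L[ℝ] K)
    (G := W →L[ℝ] W →L[ℝ] K') (f := s) (f' := s') x (hasFDerivAt_postComp L (s x)) hs
  exact ⟨_, h, fun _ _ _ => rfl⟩

/-- The complex bilinear form with real part `s` and imaginary part `t`. -/
def complexBilin (s t : W →L[ℝ] W →L[ℝ] ℝ) : W →L[ℝ] W →L[ℝ] ℂ :=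
  postComp W Complex.ofRealCLM s + postComp W (Complex.I • Complex.ofRealCLM) t

theorem exists_hasFDerivAt_complexBilin {Y : Type*} [NormedAddCommGroup Y] [NormedSpace ℝ Y]
    {s t : Y → W →L[ℝ] W →L[ℝ] ℝ} {s' t' : Y →L[ℝ] W →L[ℝ] W →L[ℝ] ℝ} {x : Y}
    (hs : HasFDerivAt s s' x) (ht : HasFDerivAt t t' x) : ∃ u' : Y →L[ℝ] W →L[ℝ] W →L[ℝ] ℂ,
      HasFDerivAt (fun y => complexBilin (s y) (t y)) u' x ∧
      ∀ a b c, u' a b c = (s' a b c : ℂ) + Complex.I * (t' a b c : ℂ) := by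
  obtain ⟨u₁, h1, h2⟩ := exists_hasFDerivAt_postComp Complex.ofRealCLM hs
  obtain ⟨u₂, h3, h4⟩ := exists_hasFDerivAt_postComp (Complex.I • Complex.ofRealCLM) ht
  have h5 := HasFDerivAt.add (𝕜 := ℝ) (E := Y) (F := W →L[ℝ] W →L[ℝ] ℂ) h1 h3
  refine ⟨u₁ + u₂, h5, fun a b c => ?_⟩
  simp only [add_apply, h2, h4]
  rfl

/-- If a closed complex 2-form is non-degenerate and of type `(2,0)` with respect to a field of
endomorphisms `I`, then its kernel, the `(-i)`-eigenspace of `I`, is involutive. -/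
theorem isInvolutiveAt_of_closed {I : W → W →ₗ[ℝ] W} {S : W → W →L[ℝ] W →L[ℝ] ℂ}
    {S' : W →L[ℝ] W →L[ℝ] W →L[ℝ] ℂ} {x : W} (hS : HasFDerivAt S S' x)
    (hc : ∀ a b c, S' a b c + S' b c a + S' c a b = 0)
    (halt : ∀ᶠ y in 𝓝 x, ∀ a b, S y a b = -S y b a)
    (htype : ∀ᶠ y in 𝓝 x, ∀ a b, S y (I y a) b = Complex.I * S y a b)
    (hnd : ∀ a, (∀ b, S x a b = 0) → a = 0) :
    IsInvolutiveAt 𝓘(ℝ, W) (fun y => negEigenspace (I y)) x := by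
  intro U hU hx P Q hP hQ hPD hQD
  have hskew : ∀ a b c, S' a b c = -S' a c b := by
    intro a b c
    have h1 := (hS.clm_apply (hasFDerivAt_const b x)).clm_apply (hasFDerivAt_const c x)
    have h2 := (hS.clm_apply (hasFDerivAt_const c x)).clm_apply (hasFDerivAt_const b x)
    have h3 : (fun y => S y b c) =ᶠ[𝓝 x] fun y => -S y c b := by
      filter_upwards [halt] with y hy using hy b c
    have h4 := congrArg (fun l => l a) ((h1.congr_of_eventuallyEq h3.symm).unique h2.neg)
    simpa using h4
  have hx' := hU.mem_nhds hx
  -- sections of the `(-i)`-eigenspace are in the kernel of the form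
  have hker : ∀ {P : W → Cx W}, (∀ y ∈ U, P y ∈ negEigenspace (I y)) → ∀ᶠ y in 𝓝 x, ∀ c,
      S y (P y).re c + Complex.I * S y (P y).im c = 0 := by
    intro P hPD
    filter_upwards [htype, hx'] with y hy hyU c
    rw [← (mem_negEigenspace.1 (hPD y hyU)).1, hy, ← mul_assoc, Complex.I_mul_I]
    ring
  -- the derivative of the previous identity
  have hd : ∀ {P : W → Cx W}, SmoothCxFieldOn 𝓘(ℝ, W) P U → (∀ y ∈ U, P y ∈ negEigenspace (I y)) →
      ∀ a c, S' a (P x).re c + Complex.I * S' a (P x).im c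
        + S x (fderiv ℝ (fun y => (P y).re) x a) c
        + Complex.I * S x (fderiv ℝ (fun y => (P y).im) x a) c = 0 := by
    intro P hP hPD a c
    have h1 := (hS.clm_apply ((hP.1.contDiffAt hU hx).differentiableAt
      (by simp)).hasFDerivAt).clm_apply (hasFDerivAt_const c x)
    have h2 := (hS.clm_apply ((hP.2.contDiffAt hU hx).differentiableAt
      (by simp)).hasFDerivAt).clm_apply (hasFDerivAt_const c x)
    have h3 : (fun y => S y (P y).re c + Complex.I * S y (P y).im c) =ᶠ[𝓝 x] fun _ => 0 := by
      filter_upwards [hker hPD] with y hy using hy c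
    have h4 := congrArg (fun l => l a) ((h1.add (h2.const_mul Complex.I)).unique
      ((hasFDerivAt_const (0 : ℂ) x).congr_of_eventuallyEq h3))
    simp at h4
    linear_combination h4
  have hK := fun c => (hker hPD).self_of_nhds c
  have hL := fun c => (hker hQD).self_of_nhds c
  have hP1 := hd hP hPD
  have hQ1 := hd hQ hQD
  set p1 : W := (P x).re
  set p2 : W := (P x).im
  set q1 : W := (Q x).re
  set q2 : W := (Q x).im
  set A1 := fderiv ℝ (fun y => (P y).re) x
  set A2 := fderiv ℝ (fun y => (P y).im) x
  set B1 := fderiv ℝ (fun y => (Q y).re) x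
  set B2 := fderiv ℝ (fun y => (Q y).im) x
  have hbr : cxBracket 𝓘(ℝ, W) P Q x
      = (⟨(B1 p1 - A1 q1) - (B2 p2 - A2 q2), (B2 p1 - A1 q2) + (B1 p2 - A2 q1)⟩ : Cx W) := by
    unfold cxBracket
    exact congrArg₂ Cx.mk
      (congrArg₂ (fun a b : W => a - b)
        (mlieBracket_eq_fderiv (fun y => (P y).re) (fun y => (Q y).re) x)
        (mlieBracket_eq_fderiv (fun y => (P y).im) (fun y => (Q y).im) x))
      (congrArg₂ (fun a b : W => a + b)
        (mlieBracket_eq_fderiv (fun y => (P y).re) (fun y => (Q y).im) x)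
        (mlieBracket_eq_fderiv (fun y => (P y).im) (fun y => (Q y).re) x))
  have hsx := halt.self_of_nhds
  have htx := htype.self_of_nhds
  -- the bracket is in the kernel of the form
  have hzero : ∀ c, S x ((B1 p1 - A1 q1) - (B2 p2 - A2 q2)) c
      + Complex.I * S x ((B2 p1 - A1 q2) + (B1 p2 - A2 q1)) c = 0 := by
    intro c
    have k1 := hc p1 q1 c
    have k2 := hc p1 q2 c
    have k3 := hc p2 q1 c
    have k4 := hc p2 q2 c
    have e : S' c p1 q1 + Complex.I * S' c p2 q1 + Complex.I * (S' c p1 q2 + Complex.I * S' c p2 q2)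
        = 0 := by
      have f1 := hP1 c q1
      have f2 := hP1 c q2
      have f3 := hL (A1 c)
      have f4 := hL (A2 c)
      rw [hsx q1, hsx q2] at f3 f4
      linear_combination f1 + Complex.I * f2 + f3 + Complex.I * f4
    have g1 := hQ1 p1 c
    have g2 := hQ1 p2 c
    have g3 := hP1 q1 c
    have g4 := hP1 q2 c
    rw [hskew q1 p1 c, hskew q1 p2 c] at g3
    rw [hskew q2 p1 c, hskew q2 p2 c] at g4
    simp only [map_add, map_sub, add_apply, sub_apply]
    have hI := Complex.I_sq
    linear_combination g1 + Complex.I * g2 - g3 - Complex.I * g4 + e - k1 - Complex.I * k2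
      - Complex.I * k3 - Complex.I ^ 2 * k4
      + (S x (A2 q2) c - S x (B2 p2) c) * hI
  rw [hbr]
  refine (mem_negEigenspace (I := I x)
    (w := ⟨B1 p1 - A1 q1 - (B2 p2 - A2 q2), B2 p1 - A1 q2 + (B1 p2 - A2 q1)⟩)).2 ⟨?_, ?_⟩
  · refine sub_eq_zero.1 (hnd _ fun b => ?_)
    rw [map_sub, sub_apply, htx]
    linear_combination Complex.I * hzero b -
      (S x ((B2 p1 - A1 q2) + (B1 p2 - A2 q1)) b) * Complex.I_sq
  · refine sub_eq_zero.1 (hnd _ fun b => ?_)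
    rw [sub_neg_eq_add, map_add, add_apply, htx]
    linear_combination hzero b

/-- A field of endomorphisms which relates two smooth bilinear forms is smooth, if the first form is
non-degenerate. -/
theorem isSmoothEndoAt_of_forms [FiniteDimensional ℝ W] {I : W → W →ₗ[ℝ] W}
    {S T : W → W →L[ℝ] W →L[ℝ] ℝ} {x : W} (hS : ContDiffAt ℝ ∞ S x) (hT : ContDiffAt ℝ ∞ T x)
    (hI : ∀ᶠ y in 𝓝 x, ∀ a b, S y (I y a) b = T y a b)
    (hnd : ∀ᶠ y in 𝓝 x, ∀ a, (∀ b, S y a b = 0) → a = 0) : IsSmoothEndoAt 𝓘(ℝ, W) I x := by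
  have : CompleteSpace W := FiniteDimensional.complete ℝ W
  have hinv : ∀ y, (∀ a, (∀ b, S y a b = 0) → a = 0) → (S y).IsInvertible := by
    intro y hy
    have h1 : Function.Injective (S y : W →ₗ[ℝ] (W →L[ℝ] ℝ)) :=
      (injective_iff_map_eq_zero _).2 fun a ha => hy a fun b => by
        exact congrArg (fun l : W →L[ℝ] ℝ => l b) ha
    have h2 : Module.finrank ℝ W = Module.finrank ℝ (W →L[ℝ] ℝ) := by
      rw [← (LinearMap.toContinuousLinearMap (𝕜 := ℝ) (E := W) (F' := ℝ)).finrank_eq]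
      exact (Subspace.dual_finrank_eq (K := ℝ) (V := W)).symm
    exact ⟨(LinearEquiv.ofInjectiveOfFinrankEq _ h1 h2).toContinuousLinearEquiv, by ext; rfl⟩
  refine isSmoothEndoAt_of_contDiffAt (S := fun y => (S y).inverse.comp (T y)) ?_ ?_
  · filter_upwards [hI, hnd] with y hy hyn a
    have h1 : S y (I y a) = T y a := ContinuousLinearMap.ext (hy a)
    show I y a = (S y).inverse (T y a)
    rw [← h1, (hinv y hyn).inverse_apply_self]
  · exact ((hinv x hnd.self_of_nhds).contDiffAt_map_inverse.comp x hS).clm_comp hT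

end VectorSpace

section Sums

variable {F : Type*} [NormedAddCommGroup F] [NormedSpace ℝ F] {H : Type*} [TopologicalSpace H]
  {J : ModelWithCorners ℝ F H} {X : Type*} [TopologicalSpace X] [ChartedSpace H X]
  [IsManifold J ∞ X]
  {K : Type*} [NormedAddCommGroup K] [NormedSpace ℝ K]

theorem IsSmoothBilin.compl₂ {s : Π x : X, TangentSpace J x →ₗ[ℝ] TangentSpace J x →ₗ[ℝ] K}
    {I : Π x : X, TangentSpace J x →ₗ[ℝ] TangentSpace J x} (hs : IsSmoothBilin J s)
    (hI : IsSmoothEndo J I) : IsSmoothBilin J (fun x => (s x).compl₂ (I x)) :=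
  fun U hU A B hA hB => hs U hU A _ hA (hI U hU B hB)

/-- The complex 2-form with real part `s` and imaginary part `t`. -/
def complexForm (s t : Π x : X, TangentSpace J x →ₗ[ℝ] TangentSpace J x →ₗ[ℝ] ℝ) (x : X) :
    TangentSpace J x →ₗ[ℝ] TangentSpace J x →ₗ[ℝ] ℂ :=
  LinearMap.mk₂ ℝ (fun a b => (s x a b : ℂ) + Complex.I * (t x a b : ℂ))
    (fun a b c => by simp; ring) (fun r a b => by simp; ring)
    (fun a b c => by simp; ring) (fun r a b => by simp; ring)

@[simp] theorem complexForm_apply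
    (s t : Π x : X, TangentSpace J x →ₗ[ℝ] TangentSpace J x →ₗ[ℝ] ℝ) (x : X)
    (a b : TangentSpace J x) :
    complexForm s t x a b = (s x a b : ℂ) + Complex.I * (t x a b : ℂ) := rfl

/-- The real-linear map `(r, r') ↦ r + i r'`. -/
def complexCLM : ℝ × ℝ →L[ℝ] ℂ :=
  Complex.ofRealCLM.comp (ContinuousLinearMap.fst ℝ ℝ ℝ)
    + (Complex.I • Complex.ofRealCLM).comp (ContinuousLinearMap.snd ℝ ℝ ℝ)

theorem dirDeriv_complex {f g : X → ℝ} {x : X} (hf : MDifferentiableAt J 𝓘(ℝ, ℝ) f x)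
    (hg : MDifferentiableAt J 𝓘(ℝ, ℝ) g x) (a : TangentSpace J x) :
    dirDeriv J (fun y => (f y : ℂ) + Complex.I * (g y : ℂ)) x a
      = ((dirDeriv J f x a : ℝ) : ℂ) + Complex.I * ((dirDeriv J g x a : ℝ) : ℂ) := by
  have h1 := (Complex.ofRealCLM.hasMFDerivAt (x := f x)).comp x hf.hasMFDerivAt
  have h2 := ((Complex.I • Complex.ofRealCLM).hasMFDerivAt (x := g x)).comp x hg.hasMFDerivAt
  exact congrArg (fun l : TangentSpace J x →L[ℝ] ℂ => l a) (h1.add h2).mfderiv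

theorem IsSmoothBilin.complexForm {s t : Π x : X, TangentSpace J x →ₗ[ℝ] TangentSpace J x →ₗ[ℝ] ℝ}
    (hs : IsSmoothBilin J s) (ht : IsSmoothBilin J t) : IsSmoothBilin J (complexForm s t) :=
  fun U hU A B hA hB => complexCLM.contMDiff.comp_contMDiffOn
    ((hs U hU A B hA hB).prodMk_space (ht U hU A B hA hB))

theorem IsClosedTwoForm.complexForm
    {s t : Π x : X, TangentSpace J x →ₗ[ℝ] TangentSpace J x →ₗ[ℝ] ℝ}
    (hs : IsSmoothBilin J s) (ht : IsSmoothBilin J t) (hsc : IsClosedTwoForm J s)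
    (htc : IsClosedTwoForm J t) : IsClosedTwoForm J (complexForm s t) := by
  intro U hU A B C hA hB hC h1 h2 h3 x hx
  have e1 := hsc U hU A B C hA hB hC h1 h2 h3 x hx
  have e2 := htc U hU A B C hA hB hC h1 h2 h3 x hx
  have hd : ∀ {A B : Π x : X, TangentSpace J x} (C : Π x : X, TangentSpace J x),
      SmoothFieldOn J A U → SmoothFieldOn J B U →
      dirDeriv J (fun y => SpecialJoyce.complexForm s t y (A y) (B y)) x (C x)
        = ((dirDeriv J (fun y => s y (A y) (B y)) x (C x) : ℝ) : ℂ)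
          + Complex.I * ((dirDeriv J (fun y => t y (A y) (B y)) x (C x) : ℝ) : ℂ) :=
    fun {A B} C hA hB => dirDeriv_complex
      (((hs U hU A B hA hB).contMDiffAt (hU.mem_nhds hx)).mdifferentiableAt (by simp))
      (((ht U hU A B hA hB).contMDiffAt (hU.mem_nhds hx)).mdifferentiableAt (by simp)) _
  unfold extDerivTwo at e1 e2 ⊢
  rw [hd A hB hC, hd B hC hA, hd C hA hB]
  simp only [complexForm_apply]
  have f1 := congrArg Complex.ofReal e1
  have f2 := congrArg Complex.ofReal e2
  push_cast at f1 f2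
  linear_combination f1 + Complex.I * f2

end Sums

section Pullback

variable {F₁ : Type*} [NormedAddCommGroup F₁] [NormedSpace ℝ F₁]
  {H₁ : Type*} [TopologicalSpace H₁] {I : ModelWithCorners ℝ F₁ H₁}
  {Y : Type*} [TopologicalSpace Y] [ChartedSpace H₁ Y]
  {F₂ : Type*} [NormedAddCommGroup F₂] [NormedSpace ℝ F₂]
  {H₂ : Type*} [TopologicalSpace H₂] {J : ModelWithCorners ℝ F₂ H₂}
  {X : Type*} [TopologicalSpace X] [ChartedSpace H₂ X]
  (Φ : PartialDiffeomorph I J Y X ∞)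

theorem mem_negEigenspace_map {V W : Type*} [AddCommGroup V] [Module ℝ V] [AddCommGroup W]
    [Module ℝ W] {S : V →ₗ[ℝ] V} {T : W →ₗ[ℝ] W} {d : V →ₗ[ℝ] W} (hd : Function.Injective d)
    (h : ∀ a, d (S a) = T (d a)) (w : Cx V) :
    w ∈ negEigenspace S ↔ Cx.map d w ∈ negEigenspace T := by
  rw [mem_negEigenspace, mem_negEigenspace, Cx.map_re, Cx.map_im, ← h, ← h, ← map_neg]
  exact ⟨fun h => ⟨congrArg d h.1, congrArg d h.2⟩, fun h => ⟨hd h.1, hd h.2⟩⟩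

/-- The pullback of a field of endomorphisms by a partial diffeomorphism. -/
def pullEndo (S : Π x : X, TangentSpace J x →ₗ[ℝ] TangentSpace J x) (z : Y) :
    TangentSpace I z →ₗ[ℝ] TangentSpace I z :=
  ((pdiff Φ z).inverse : TangentSpace J (Φ z) →ₗ[ℝ] TangentSpace I z) ∘ₗ S (Φ z) ∘ₗ
    (pdiff Φ z : TangentSpace I z →ₗ[ℝ] TangentSpace J (Φ z))

theorem pdiff_pullEndo {z : Y} (hz : z ∈ Φ.source)
    (S : Π x : X, TangentSpace J x →ₗ[ℝ] TangentSpace J x) (a : TangentSpace I z) :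
    pdiff Φ z (pullEndo Φ S z a) = S (Φ z) (pdiff Φ z a) :=
  (pdiff_isInvertible Φ hz).self_apply_inverse _

end Pullback

/-! ### The hyperkähler structure of `TM` -/

section

variable {E : Type*} [NormedAddCommGroup E] [NormedSpace ℂ E]
  {M : Type*} [TopologicalSpace M] [ChartedSpace E M] [IsManifold 𝓘(ℂ, E) ω M]
  [FiniteDimensional ℂ E]

open LatticePeriodStructure

namespace SpecialJoyceStructure

variable {P : SpecialPeriodStructure E M} (A : SpecialJoyceStructure P) {p : M} {w : CoordSpace E}

/-- The real component `c(Ω_ζ)` of the closed complex 2-form with kernel the connection `A^ζ`, in an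
adapted chart. -/
def formCoord (c : ℂ →L[ℝ] ℝ) (ζ : ℂ) (p : M) (w : CoordSpace E) :
    CoordSpace E →L[ℝ] CoordSpace E →L[ℝ] ℝ :=
  postComp (CoordSpace E) c (connForm (symp _) (A.connCoord ζ p w))

theorem formCoord_apply (c : ℂ →L[ℝ] ℝ) (ζ : ℂ) (a b : CoordSpace E) :
    A.formCoord c ζ p w a b = c (connForm (symp _) (A.connCoord ζ p w) a b) := rfl

theorem contDiffAt_formCoord (c : ℂ →L[ℝ] ℝ) (ζ : ℂ) (hw : w ∈ P.adaptedDom p) :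
    ContDiffAt ℝ ∞ (A.formCoord c ζ p) w :=
  contDiffAt_postComp c (contDiffAt_connForm (symp _) (A.contDiffAt_connCoord ζ hw))

theorem formCoord_neg_flip (c : ℂ →L[ℝ] ℝ) (ζ : ℂ) (a b : CoordSpace E) :
    A.formCoord c ζ p w a b = -A.formCoord c ζ p w b a := by
  rw [formCoord_apply, formCoord_apply, connForm_apply, connForm_apply, symp_neg_flip, map_neg]

theorem formCoord_closed (c : ℂ →L[ℝ] ℝ) {ζ : ℂ} (hζ : ζ ≠ 0) (hw : w ∈ P.adaptedDom p) :
    ∃ S' : CoordSpace E →L[ℝ] CoordSpace E →L[ℝ] CoordSpace E →L[ℝ] ℝ,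
      HasFDerivAt (A.formCoord c ζ p) S' w ∧ ∀ a b c,
      S' a b c + S' b c a + S' c a b = 0 := by
  obtain ⟨S', h1, h2⟩ := A.connForm_closed hζ hw
  obtain ⟨T', h3, h4⟩ := exists_hasFDerivAt_postComp c h1
  refine ⟨T', h3, fun a b d => ?_⟩
  rw [h4, h4, h4, ← map_add, ← map_add, h2, map_zero]

/-- A form which is a real component of some `Ω_ζ` in all adapted charts is smooth and closed. -/
theorem isSmoothBilinAt_isClosedTwoFormAt {s : Π V : TB E M, TN V →ₗ[ℝ] TN V →ₗ[ℝ] ℝ}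
    {c : ℂ →L[ℝ] ℝ} {ζ : ℂ} (hζ : ζ ≠ 0) (hs : ∀ (p : M) (w : CoordSpace E),
      w ∈ P.adaptedDom p → ∀ a b, s (P.adaptedFun p w) (P.adaptedDiff p w a) (P.adaptedDiff p w b)
        = A.formCoord c ζ p w a b) (V : TB E M) :
    IsSmoothBilinAt 𝓘(ℝ, E).tangent s V ∧ IsClosedTwoFormAt 𝓘(ℝ, E).tangent s V := by
  have : CompleteSpace E := FiniteDimensional.complete ℝ E
  obtain ⟨p, w, hw, rfl⟩ := P.exists_adapted V
  let s' : Π z : CoordSpace E, CoordSpace E →ₗ[ℝ] CoordSpace E →ₗ[ℝ] ℝ := fun z =>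
    (s (P.adaptedFun p z)).compl₁₂ (P.adaptedDiff p z) (P.adaptedDiff p z)
  have h1 : ∀ᶠ z in 𝓝 w, ∀ a b, s' z a b = A.formCoord c ζ p z a b := by
    filter_upwards [(P.isOpen_adaptedDom p).mem_nhds hw] with z hz using hs p z hz
  have h2 := isSmoothBilinAt_of_contDiffAt h1 (A.contDiffAt_formCoord c ζ hw)
  obtain ⟨S', h3, h4⟩ := A.formCoord_closed c hζ hw
  have h5 := isClosedTwoFormAt_of_cyclic h1 h3 (A.formCoord_neg_flip c ζ) h4
  exact ⟨IsSmoothBilinAt.of_pullback (P.adapted p) hw (.of_forall fun _ _ _ => rfl) h2,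
    IsClosedTwoFormAt.of_pullback (P.adapted p) hw (.of_forall fun _ _ _ => rfl) h2 h5⟩

/-- The function `c Im` on `ℂ`, for `c = 1 / 4π²`. -/
def imScale : ℂ →L[ℝ] ℝ := (1 / (4 * Real.pi ^ 2)) • Complex.imCLM

/-- The function `-c Re` on `ℂ`, for `c = 1 / 4π²`. -/
def reScale : ℂ →L[ℝ] ℝ := (-(1 / (4 * Real.pi ^ 2))) • Complex.reCLM

theorem ω₁_adapted (hw : w ∈ P.adaptedDom p) (a b : CoordSpace E) :
    A.ω₁ (P.adaptedFun p w) (P.adaptedDiff p w a) (P.adaptedDiff p w b)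
      = A.formCoord imScale 1 p w a b := (A.forms_adapted hw a b).2.1

theorem ω₂_adapted (hw : w ∈ P.adaptedDom p) (a b : CoordSpace E) :
    A.ω₂ (P.adaptedFun p w) (P.adaptedDiff p w a) (P.adaptedDiff p w b)
      = A.formCoord imScale Complex.I p w a b := (A.forms_adapted hw a b).2.2

theorem ω₃_adapted (hw : w ∈ P.adaptedDom p) (a b : CoordSpace E) :
    A.ω₃ (P.adaptedFun p w) (P.adaptedDiff p w a) (P.adaptedDiff p w b)
      = A.formCoord reScale 1 p w a b := (A.forms_adapted hw a b).1

/-- The smoothness and closedness of `ω₁`, and likewise of `ω₂` and `ω₃` below, from those of `Ω_ζ`.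
-/
theorem ω₁_smooth_closed (V : TB E M) : IsSmoothBilinAt 𝓘(ℝ, E).tangent (fun V => A.ω₁ V) V ∧
    IsClosedTwoFormAt 𝓘(ℝ, E).tangent (fun V => A.ω₁ V) V :=
  A.isSmoothBilinAt_isClosedTwoFormAt one_ne_zero (fun _ _ hw => A.ω₁_adapted hw) V

theorem ω₂_smooth_closed (V : TB E M) : IsSmoothBilinAt 𝓘(ℝ, E).tangent (fun V => A.ω₂ V) V ∧
    IsClosedTwoFormAt 𝓘(ℝ, E).tangent (fun V => A.ω₂ V) V :=
  A.isSmoothBilinAt_isClosedTwoFormAt Complex.I_ne_zero (fun _ _ hw => A.ω₂_adapted hw) V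

theorem ω₃_smooth_closed (V : TB E M) : IsSmoothBilinAt 𝓘(ℝ, E).tangent (fun V => A.ω₃ V) V ∧
    IsClosedTwoFormAt 𝓘(ℝ, E).tangent (fun V => A.ω₃ V) V :=
  A.isSmoothBilinAt_isClosedTwoFormAt one_ne_zero (fun _ _ hw => A.ω₃_adapted hw) V

theorem ω₁_I₃ (V : TB E M) (a b : TN V) : A.ω₁ V (A.I₃ V a) b = -A.ω₂ V a b := by
  have h : A.I₁ V (A.I₃ V a) = -A.I₂ V a := by rw [← A.I₁_I₂, A.I₁_sq]
  show A.gBilin V (A.I₁ V (A.I₃ V a)) b = -A.gBilin V (A.I₂ V a) b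
  rw [h, map_neg, LinearMap.neg_apply]

theorem ω₂_I₃ (V : TB E M) (a b : TN V) : A.ω₂ V (A.I₃ V a) b = A.ω₁ V a b := by
  have h : A.I₂ V (A.I₃ V a) = A.I₁ V a := by
    rw [← neg_neg (A.I₃ V a), ← A.I₂_I₁, map_neg, A.I₂_sq, neg_neg]
  show A.gBilin V (A.I₂ V (A.I₃ V a)) b = A.gBilin V (A.I₁ V a) b
  rw [h]

theorem ω₂_I₁ (V : TB E M) (a b : TN V) : A.ω₂ V (A.I₁ V a) b = -A.ω₃ V a b := by
  rw [A.ω₃_eq]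
  show A.gBilin V (A.I₂ V (A.I₁ V a)) b = -A.gBilin V (A.I₃ V a) b
  rw [A.I₂_I₁, map_neg, LinearMap.neg_apply]

theorem ω₃_I₂ (V : TB E M) (a b : TN V) : A.ω₃ V (A.I₂ V a) b = -A.ω₁ V a b := by
  have h : A.I₃ V (A.I₂ V a) = -A.I₁ V a := by rw [← A.I₁_I₂, A.I₂_sq, map_neg]
  rw [A.ω₃_eq]
  show A.gBilin V (A.I₃ V (A.I₂ V a)) b = -A.gBilin V (A.I₁ V a) b
  rw [h, map_neg, LinearMap.neg_apply]

theorem ω₁_nondegenerate {V : TB E M} {a : TN V} (h : ∀ b, A.ω₁ V a b = 0) : a = 0 := by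
  have h1 : A.I₁ V a = 0 := A.gBilin_nondegenerate h
  rw [← neg_eq_zero, ← A.I₁_sq, h1, map_zero]

theorem ω₂_nondegenerate {V : TB E M} {a : TN V} (h : ∀ b, A.ω₂ V a b = 0) : a = 0 := by
  have h1 : A.I₂ V a = 0 := A.gBilin_nondegenerate h
  rw [← neg_eq_zero, ← A.I₂_sq, h1, map_zero]

theorem ω₃_nondegenerate {V : TB E M} {a : TN V} (h : ∀ b, A.ω₃ V a b = 0) : a = 0 := by
  have h1 : A.I₃ V a = 0 := A.gBilin_nondegenerate fun b => (A.ω₃_eq V a b).symm.trans (h b)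
  rw [← neg_eq_zero, ← A.I₃_sq, h1, map_zero]

theorem eq_zero_of_adapted {s : Π V : TB E M, TN V →ₗ[ℝ] TN V →ₗ[ℝ] ℝ}
    (hnd : ∀ V a, (∀ b, s V a b = 0) → a = 0) (hw : w ∈ P.adaptedDom p) {a : CoordSpace E}
    (h : ∀ b, s (P.adaptedFun p w) (P.adaptedDiff p w a) (P.adaptedDiff p w b) = 0) : a = 0 := by
  refine (P.adaptedDiff_bijective hw).1 ((hnd _ _ fun b => ?_).trans (map_zero _).symm)
  obtain ⟨b, rfl⟩ := (P.adaptedDiff_bijective hw).2 b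
  exact h b

/-- A field of endomorphisms of `TM` in an adapted chart. -/
def coordEndo (P : SpecialPeriodStructure E M) (S : Π V : TB E M, TN V →ₗ[ℝ] TN V) (p : M)
    (w : CoordSpace E) : CoordSpace E →ₗ[ℝ] CoordSpace E :=
  pullEndo (P.adapted p) S w

theorem adaptedDiff_coordEndo (S : Π V : TB E M, TN V →ₗ[ℝ] TN V) (hw : w ∈ P.adaptedDom p)
    (a : CoordSpace E) : P.adaptedDiff p w (coordEndo P S p w a)
      = S (P.adaptedFun p w) (P.adaptedDiff p w a) :=
  pdiff_pullEndo (P.adapted p) hw S a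

/-- A field of endomorphisms of `TM` that relates two of the forms `ω₁`, `ω₂`, `ω₃` is smooth. -/
theorem isSmoothEndo_of_forms {s t : Π V : TB E M, TN V →ₗ[ℝ] TN V →ₗ[ℝ] ℝ}
    {c c' : ℂ →L[ℝ] ℝ} {ζ ζ' : ℂ} (hs : ∀ (p : M) (w : CoordSpace E),
      w ∈ P.adaptedDom p → ∀ a b, s (P.adaptedFun p w) (P.adaptedDiff p w a) (P.adaptedDiff p w b)
        = A.formCoord c ζ p w a b) (ht : ∀ (p : M) (w : CoordSpace E),
      w ∈ P.adaptedDom p → ∀ a b, t (P.adaptedFun p w) (P.adaptedDiff p w a) (P.adaptedDiff p w b)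
        = A.formCoord c' ζ' p w a b) (hnd : ∀ V a, (∀ b, s V a b = 0) → a = 0)
    {S : Π V : TB E M, TN V →ₗ[ℝ] TN V} (hS : ∀ V a b, s V (S V a) b = -t V a b) :
    IsSmoothEndo 𝓘(ℝ, E).tangent S := by
  have : CompleteSpace E := FiniteDimensional.complete ℝ E
  refine IsSmoothEndo.of_at fun V => ?_
  obtain ⟨p, w, hw, rfl⟩ := P.exists_adapted V
  have hev : ∀ᶠ z in 𝓝 w, z ∈ P.adaptedDom p := (P.isOpen_adaptedDom p).mem_nhds hw
  refine IsSmoothEndoAt.of_pullback (P.adapted p) (S' := coordEndo P S p) hw ?_ ?_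
  · filter_upwards [hev] with z hz a using pdiff_pullEndo (P.adapted p) hz S a
  · refine isSmoothEndoAt_of_forms (A.contDiffAt_formCoord c ζ hw)
      (A.contDiffAt_formCoord c' ζ' hw).neg ?_ ?_
    · filter_upwards [hev] with z hz a b
      rw [← hs p z hz, adaptedDiff_coordEndo S hz, hS, ht p z hz]
      rfl
    · filter_upwards [hev] with z hz a ha
      exact eq_zero_of_adapted hnd hz fun b => (hs p z hz a b).trans (ha b)

theorem isSmoothEndo_I₃ : IsSmoothEndo 𝓘(ℝ, E).tangent (fun V => A.I₃ V) :=
  A.isSmoothEndo_of_forms (fun _ _ hw => A.ω₁_adapted hw) (fun _ _ hw => A.ω₂_adapted hw)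
    (fun _ _ => A.ω₁_nondegenerate) A.ω₁_I₃

theorem isSmoothEndo_I₁ : IsSmoothEndo 𝓘(ℝ, E).tangent (fun V => A.I₁ V) :=
  A.isSmoothEndo_of_forms (fun _ _ hw => A.ω₂_adapted hw) (fun _ _ hw => A.ω₃_adapted hw)
    (fun _ _ => A.ω₂_nondegenerate) A.ω₂_I₁

theorem isSmoothEndo_I₂ : IsSmoothEndo 𝓘(ℝ, E).tangent (fun V => A.I₂ V) :=
  A.isSmoothEndo_of_forms (fun _ _ hw => A.ω₃_adapted hw) (fun _ _ hw => A.ω₁_adapted hw)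
    (fun _ _ => A.ω₃_nondegenerate) A.ω₃_I₂

/-- `I₃` is integrable, as `ω₁ + i ω₂` is a closed form of type `(2,0)`. -/
theorem isInvolutive_I₃ : IsInvolutive 𝓘(ℝ, E).tangent (fun V => negEigenspace (A.I₃ V)) := by
  have : CompleteSpace E := FiniteDimensional.complete ℝ E
  refine IsInvolutive.of_at fun V => ?_
  obtain ⟨p, w, hw, rfl⟩ := P.exists_adapted V
  have hev : ∀ᶠ z in 𝓝 w, z ∈ P.adaptedDom p := (P.isOpen_adaptedDom p).mem_nhds hw
  let I' := coordEndo P (fun V => A.I₃ V) p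
  refine IsInvolutiveAt.of_pullback (P.adapted p) (D' := fun z => negEigenspace (I' z)) hw ?_ ?_
  · filter_upwards [hev] with z hz a
    exact mem_negEigenspace_map (pdiff_isInvertible (P.adapted p) hz).injective
      (pdiff_pullEndo (P.adapted p) hz (fun V => A.I₃ V)) a
  obtain ⟨S₁', h1, h1'⟩ := A.formCoord_closed imScale one_ne_zero hw
  obtain ⟨S₂', h2, h2'⟩ := A.formCoord_closed imScale Complex.I_ne_zero hw
  obtain ⟨S', h3, h4⟩ := exists_hasFDerivAt_complexBilin h1 h2
  refine isInvolutiveAt_of_closed h3 ?_ ?_ ?_ ?_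
  · intro a b c
    have e1 := congrArg Complex.ofReal (h1' a b c)
    have e2 := congrArg Complex.ofReal (h2' a b c)
    push_cast at e1 e2
    rw [h4, h4, h4]
    linear_combination e1 + Complex.I * e2
  · refine .of_forall fun z a b => ?_
    show (A.formCoord imScale 1 p z a b : ℂ)
        + Complex.I * (A.formCoord imScale Complex.I p z a b : ℂ)
      = -((A.formCoord imScale 1 p z b a : ℂ)
        + Complex.I * (A.formCoord imScale Complex.I p z b a : ℂ))
    rw [A.formCoord_neg_flip imScale 1 a b, A.formCoord_neg_flip imScale Complex.I a b]
    push_cast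
    ring
  · filter_upwards [hev] with z hz a b
    show (A.formCoord imScale 1 p z (I' z a) b : ℂ)
        + Complex.I * (A.formCoord imScale Complex.I p z (I' z a) b : ℂ)
      = Complex.I * ((A.formCoord imScale 1 p z a b : ℂ)
        + Complex.I * (A.formCoord imScale Complex.I p z a b : ℂ))
    rw [← A.ω₁_adapted hz, ← A.ω₂_adapted hz, ← A.ω₁_adapted hz, ← A.ω₂_adapted hz,
      adaptedDiff_coordEndo (fun V => A.I₃ V) hz, A.ω₁_I₃, A.ω₂_I₃, mul_add, ← mul_assoc,
      Complex.I_mul_I]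
    push_cast
    ring
  · intro a ha
    refine eq_zero_of_adapted (s := fun V => A.ω₁ V) (fun _ _ => A.ω₁_nondegenerate) hw fun b => ?_
    rw [A.ω₁_adapted hw]
    have := congrArg Complex.re (ha b)
    have h3 : (A.formCoord imScale 1 p w a b : ℂ)
        + Complex.I * (A.formCoord imScale Complex.I p w a b : ℂ) = 0 := ha b
    simpa using congrArg Complex.re h3

theorem gBilin_smooth : IsSmoothBilin 𝓘(ℝ, E).tangent (fun V => A.gBilin V) :=
  (IsSmoothBilin.of_at fun V => (A.ω₃_smooth_closed V).1).compl₂ A.isSmoothEndo_I₃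

theorem isComplexStructure_I₁ : IsComplexStructure 𝓘(ℝ, E).tangent (fun V => A.I₁ V) where
  smooth := A.isSmoothEndo_I₁
  sq := A.I₁_sq
  involutive := by simpa only [A.negEigenspace_I₁] using A.flat Complex.I Complex.I_ne_zero

theorem isComplexStructure_I₂ : IsComplexStructure 𝓘(ℝ, E).tangent (fun V => A.I₂ V) where
  smooth := A.isSmoothEndo_I₂
  sq := A.I₂_sq
  involutive := by simpa only [A.negEigenspace_I₂] using A.flat (-1) (by simp)

theorem isComplexStructure_I₃ : IsComplexStructure 𝓘(ℝ, E).tangent (fun V => A.I₃ V) where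
  smooth := A.isSmoothEndo_I₃
  sq := A.I₃_sq
  involutive := A.isInvolutive_I₃

end SpecialJoyceStructure

end

/-! ### Descent to the quotient by the lattices -/

section

variable {E : Type*} [NormedAddCommGroup E] [NormedSpace ℂ E]
  {M : Type*} [TopologicalSpace M] [ChartedSpace E M] [IsManifold 𝓘(ℂ, E) ω M]
  [FiniteDimensional ℂ E]

namespace LatticePeriodStructure

variable (P : LatticePeriodStructure E M)

/-- Points with the same image in `X` are related by a translation by a local section of `2π Γ`. -/
theorem exists_translate {V W : TB E M} (h : P.quot V = P.quot W) :
    ∃ (U : Set M) (γ : Π q : M, P.Γ q), IsOpen U ∧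
      SmoothFieldOn 𝓘(ℝ, E) (fun q => (γ q : TangentSpace 𝓘(ℝ, E) q)) U ∧ V.proj ∈ U ∧
      P.translate γ V = W := by
  obtain ⟨γ₀, h0⟩ := P.exists_of_quot_eq h
  obtain ⟨γ, hγ, h2⟩ := P.exists_section V.proj γ₀
  exact ⟨_, γ, (P.isDarbouxFrame V.proj).isOpen, h2, P.mem_frameDom V.proj, by
    rw [h0, translate, hγ]⟩

/-- The compositions of the quotient map with its local inverses are smooth, as they are locally
translations by sections of the lattices. -/
theorem contMDiffAt_localInverse_quot {V T : TB E M}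
    (hV : P.quot V ∈ (P.isLocalHomeomorph_quot.localInverseAt T).source) :
    ContMDiffAt 𝓘(ℝ, E).tangent 𝓘(ℝ, E).tangent ∞
      (fun V' => P.isLocalHomeomorph_quot.localInverseAt T (P.quot V')) V := by
  set s := P.isLocalHomeomorph_quot.localInverseAt T with hs
  have h1 : P.quot (s (P.quot V)) = P.quot V :=
    P.isLocalHomeomorph_quot.apply_localInverseAt_of_mem hV
  obtain ⟨U, γ, hU, h2, hVU, hT⟩ := P.exists_translate h1.symm
  have h3 := P.translate_smooth h2 hU hVU
  refine h3.congr_of_eventuallyEq ?_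
  have hev : ∀ᶠ V' in 𝓝 V, P.translate γ V' ∈ s.target :=
    h3.continuousAt (s.open_target.mem_nhds (by rw [hT]; exact s.map_source hV))
  filter_upwards [hev] with V' hV'
  rw [← P.quot_translate γ V']
  have h4 := s.right_inv hV'
  rw [hs, P.isLocalHomeomorph_quot.localInverseAt_symm] at h4
  exact h4

/-- A representative of a point of `X`, the one which is used for its chart. -/
def rep (x : P.X) : TB E M := P.quot_surjective.hasRightInverse.choose x

theorem quot_rep (x : P.X) : P.quot (P.rep x) = x :=
  P.quot_surjective.hasRightInverse.choose_spec x

theorem extChartAt_quotient (x y : P.X) : extChartAt 𝓘(ℝ, E).tangent x y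
    = extChartAt 𝓘(ℝ, E).tangent (P.rep x)
      (P.isLocalHomeomorph_quot.localInverseAt (P.rep x) y) := rfl

theorem extChartAt_quotient_symm (x : P.X) (w : E × E) : (extChartAt 𝓘(ℝ, E).tangent x).symm w
    = P.quot ((extChartAt 𝓘(ℝ, E).tangent (P.rep x)).symm w) := by
  rw [← P.isLocalHomeomorph_quot.localInverseAt_symm (P.rep x)]
  rfl

theorem localInverse_rep (x : P.X) :
    P.isLocalHomeomorph_quot.localInverseAt (P.rep x) x = P.rep x := by
  conv_lhs => rw [← P.quot_rep x]
  have := (P.isLocalHomeomorph_quot.localInverseAt (P.rep x)).right_inv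
    (P.isLocalHomeomorph_quot.self_mem_localInverseAt_target (x := P.rep x))
  rw [P.isLocalHomeomorph_quot.localInverseAt_symm] at this
  rw [P.quot_rep]
  rwa [P.quot_rep] at this

theorem mem_localInverse_source (x : P.X) :
    x ∈ (P.isLocalHomeomorph_quot.localInverseAt (P.rep x)).source := by
  have := P.isLocalHomeomorph_quot.apply_self_mem_localInverseAt_source (x := P.rep x)
  rwa [P.quot_rep] at this

/-- The quotient map is smooth for the manifold structure of `X`, the charts of which are those of
`TM` at chosen representatives, composed with local inverses of the quotient map. -/
theorem contMDiffAt_quot (V : TB E M) :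
    ContMDiffAt 𝓘(ℝ, E).tangent 𝓘(ℝ, E).tangent ∞ P.quot V := by
  rw [contMDiffAt_iff_target]
  refine ⟨P.continuous_quot.continuousAt, ?_⟩
  have h1 := P.contMDiffAt_localInverse_quot (P.mem_localInverse_source (P.quot V))
  refine ContMDiffAt.comp (g := extChartAt 𝓘(ℝ, E).tangent (P.rep (P.quot V))) V ?_ h1
  have h2 : P.isLocalHomeomorph_quot.localInverseAt (P.rep (P.quot V)) (P.quot V)
      ∈ (chartAt (ModelProd E E) (P.rep (P.quot V))).source := by
    rw [P.localInverse_rep]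
    exact mem_chart_source _ _
  exact contMDiffAt_extChartAt' h2

/-- The quotient map, restricted to the image of a local inverse. -/
def quotDiffeo (T : TB E M) :
    PartialDiffeomorph 𝓘(ℝ, E).tangent 𝓘(ℝ, E).tangent (TB E M) P.X ∞ where
  toFun := P.quot
  invFun := P.isLocalHomeomorph_quot.localInverseAt T
  source := (P.isLocalHomeomorph_quot.localInverseAt T).target
  target := (P.isLocalHomeomorph_quot.localInverseAt T).source
  map_source' V hV := by
    have := (P.isLocalHomeomorph_quot.localInverseAt T).map_target hV
    rwa [P.isLocalHomeomorph_quot.localInverseAt_symm] at this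
  map_target' x hx := (P.isLocalHomeomorph_quot.localInverseAt T).map_source hx
  left_inv' V hV := by
    have := (P.isLocalHomeomorph_quot.localInverseAt T).right_inv hV
    rwa [P.isLocalHomeomorph_quot.localInverseAt_symm] at this
  right_inv' x hx := P.isLocalHomeomorph_quot.apply_localInverseAt_of_mem hx
  open_source := (P.isLocalHomeomorph_quot.localInverseAt T).open_target
  open_target := (P.isLocalHomeomorph_quot.localInverseAt T).open_source
  contMDiffOn_toFun V _ := (P.contMDiffAt_quot V).contMDiffWithinAt
  contMDiffOn_invFun x hx := by
    refine ContMDiffAt.contMDiffWithinAt ?_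
    rw [contMDiffAt_iff_source]
    have h1 : ContMDiffAt 𝓘(ℝ, E).tangent 𝓘(ℝ, E).tangent ∞
        (fun V' => P.isLocalHomeomorph_quot.localInverseAt T (P.quot V')) (P.rep x) :=
      P.contMDiffAt_localInverse_quot (by rwa [P.quot_rep])
    have h2 : (extChartAt 𝓘(ℝ, E).tangent (P.rep x)).symm (extChartAt 𝓘(ℝ, E).tangent x x)
        = P.rep x := by
      rw [extChartAt_quotient, P.localInverse_rep, extChartAt_to_inv]
    have h3 := contMDiffWithinAt_extChartAt_symm_range (I := 𝓘(ℝ, E).tangent) (n := ∞) (P.rep x)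
      (y := extChartAt 𝓘(ℝ, E).tangent x x) (by
        rw [extChartAt_quotient, P.localInverse_rep]
        exact mem_extChartAt_target _)
    rw [← h2] at h1
    refine (ContMDiffAt.comp_contMDiffWithinAt _ h1 h3).congr ?_ ?_
    · intro w _
      exact congrArg _ (P.extChartAt_quotient_symm x w)
    · exact congrArg _ (P.extChartAt_quotient_symm x _)

theorem mem_quotDiffeo_source (V : TB E M) : V ∈ (P.quotDiffeo V).source :=
  P.isLocalHomeomorph_quot.self_mem_localInverseAt_target

/-- The differential of the quotient map. -/
def quotDiff (V : TB E M) : TN V ≃ₗ[ℝ] TangentSpace 𝓘(ℝ, E).tangent (P.quot V) :=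
  LinearEquiv.ofBijective (mfderiv 𝓘(ℝ, E).tangent 𝓘(ℝ, E).tangent P.quot V :
    TN V →ₗ[ℝ] TangentSpace 𝓘(ℝ, E).tangent (P.quot V))
    (pdiff_isInvertible (P.quotDiffeo V) (P.mem_quotDiffeo_source V)).bijective

/-- The translations are deck transformations of the quotient map. -/
theorem quotDiff_translate {U : Set M} {γ : Π q : M, P.Γ q} (hU : IsOpen U)
    (hγ : SmoothFieldOn 𝓘(ℝ, E) (fun q => (γ q : TangentSpace 𝓘(ℝ, E) q)) U) {V : TB E M}
    (hV : V.proj ∈ U) (a : TN V) : (P.quotDiff (P.translate γ V)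
      (mfderiv 𝓘(ℝ, E).tangent 𝓘(ℝ, E).tangent (P.translate γ) V a) : E × E) = P.quotDiff V a := by
  have h1 : MDifferentiableAt 𝓘(ℝ, E).tangent 𝓘(ℝ, E).tangent P.quot (P.translate γ V) :=
    (P.contMDiffAt_quot _).mdifferentiableAt (by simp)
  have h2 := mfderiv_comp V h1 ((P.translate_smooth hγ hU hV).mdifferentiableAt (by simp))
  have h3 : P.quot ∘ P.translate γ = P.quot := funext (P.quot_translate γ)
  have h4 : (mfderiv 𝓘(ℝ, E).tangent 𝓘(ℝ, E).tangent (P.quot ∘ P.translate γ) V :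
      (E × E) →L[ℝ] (E × E)) = mfderiv 𝓘(ℝ, E).tangent 𝓘(ℝ, E).tangent P.quot V := by rw [h3]
  exact (congrArg (fun l : (E × E) →L[ℝ] (E × E) => l a) (h2.symm.trans h4))

/-- The field of endomorphisms of `X` induced by one of `TM`. It is defined by means of the chosen
representatives, on which it does not depend if the field is invariant (`descendEndo_quot`). -/
def descendEndo (S : Π V : TB E M, TN V →ₗ[ℝ] TN V) (x : P.X) :
    TangentSpace 𝓘(ℝ, E).tangent x →ₗ[ℝ] TangentSpace 𝓘(ℝ, E).tangent x :=
  (P.quotDiff (P.rep x)).toLinearMap ∘ₗ S (P.rep x) ∘ₗ (P.quotDiff (P.rep x)).symm.toLinearMap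

/-- The field of bilinear forms on `X` induced by one on `TM`, see `descendEndo`. -/
def descendBilin (s : Π V : TB E M, TN V →ₗ[ℝ] TN V →ₗ[ℝ] ℝ) (x : P.X) :
    TangentSpace 𝓘(ℝ, E).tangent x →ₗ[ℝ] TangentSpace 𝓘(ℝ, E).tangent x →ₗ[ℝ] ℝ :=
  (s (P.rep x)).compl₁₂ (P.quotDiff (P.rep x)).symm.toLinearMap
    (P.quotDiff (P.rep x)).symm.toLinearMap

/-- Invariance of a field of endomorphisms under the translations by local sections of `2π Γ`. -/
def IsInvariantEndo (S : Π V : TB E M, TN V →ₗ[ℝ] TN V) : Prop :=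
  ∀ (U : Set M) (γ : Π q : M, P.Γ q), IsOpen U →
    SmoothFieldOn 𝓘(ℝ, E) (fun q => (γ q : TangentSpace 𝓘(ℝ, E) q)) U → ∀ V : TB E M, V.proj ∈ U →
    ∀ a, S (P.translate γ V) (mfderiv 𝓘(ℝ, E).tangent 𝓘(ℝ, E).tangent (P.translate γ) V a)
      = mfderiv 𝓘(ℝ, E).tangent 𝓘(ℝ, E).tangent (P.translate γ) V (S V a)

/-- Invariance of a field of bilinear forms under the translations by local sections of `2π Γ`. -/
def IsInvariantBilin (s : Π V : TB E M, TN V →ₗ[ℝ] TN V →ₗ[ℝ] ℝ) : Prop :=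
  ∀ (U : Set M) (γ : Π q : M, P.Γ q), IsOpen U →
    SmoothFieldOn 𝓘(ℝ, E) (fun q => (γ q : TangentSpace 𝓘(ℝ, E) q)) U → ∀ V : TB E M, V.proj ∈ U →
    ∀ a b, s (P.translate γ V) (mfderiv 𝓘(ℝ, E).tangent 𝓘(ℝ, E).tangent (P.translate γ) V a)
      (mfderiv 𝓘(ℝ, E).tangent 𝓘(ℝ, E).tangent (P.translate γ) V b) = s V a b

variable {P}

theorem descendEndo_quot {S : Π V : TB E M, TN V →ₗ[ℝ] TN V} (hS : P.IsInvariantEndo S)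
    (V : TB E M) (a : TN V) :
    P.descendEndo S (P.quot V) (P.quotDiff V a) = P.quotDiff V (S V a) := by
  have key : ∀ W, P.quot V = P.quot W → (P.quotDiff W (S W ((P.quotDiff W).symm
      (show TangentSpace 𝓘(ℝ, E).tangent (P.quot W) from P.quotDiff V a))) : E × E)
        = P.quotDiff V (S V a) := by
    intro W hW
    obtain ⟨U, γ, hU, hγ, hV, rfl⟩ := P.exists_translate hW
    have h1 : ∀ a, (P.quotDiff (P.translate γ V)).symm
        (show TangentSpace 𝓘(ℝ, E).tangent (P.quot (P.translate γ V)) from P.quotDiff V a)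
        = mfderiv 𝓘(ℝ, E).tangent 𝓘(ℝ, E).tangent (P.translate γ) V a := fun a =>
      (LinearEquiv.symm_apply_eq _).2 (P.quotDiff_translate hU hγ hV a).symm
    rw [h1, hS U γ hU hγ V hV]
    exact P.quotDiff_translate hU hγ hV _
  exact key _ (P.quot_rep _).symm

theorem descendBilin_quot {s : Π V : TB E M, TN V →ₗ[ℝ] TN V →ₗ[ℝ] ℝ} (hs : P.IsInvariantBilin s)
    (V : TB E M) (a b : TN V) :
    P.descendBilin s (P.quot V) (P.quotDiff V a) (P.quotDiff V b) = s V a b := by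
  have key : ∀ W, P.quot V = P.quot W → s W ((P.quotDiff W).symm
      (show TangentSpace 𝓘(ℝ, E).tangent (P.quot W) from P.quotDiff V a)) ((P.quotDiff W).symm
      (show TangentSpace 𝓘(ℝ, E).tangent (P.quot W) from P.quotDiff V b)) = s V a b := by
    intro W hW
    obtain ⟨U, γ, hU, hγ, hV, rfl⟩ := P.exists_translate hW
    have h1 : ∀ a, (P.quotDiff (P.translate γ V)).symm
        (show TangentSpace 𝓘(ℝ, E).tangent (P.quot (P.translate γ V)) from P.quotDiff V a)
        = mfderiv 𝓘(ℝ, E).tangent 𝓘(ℝ, E).tangent (P.translate γ) V a := fun a =>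
      (LinearEquiv.symm_apply_eq _).2 (P.quotDiff_translate hU hγ hV a).symm
    rw [h1, h1, hs U γ hU hγ V hV]
  exact key _ (P.quot_rep _).symm

/-- To prove a statement about all tangent vectors of `X`, prove it for the images of tangent
vectors of `TM`. -/
theorem forall_tangent_iff {q : Π x : P.X, TangentSpace 𝓘(ℝ, E).tangent x → Prop} :
    (∀ x a, q x a) ↔ ∀ V a, q (P.quot V) (P.quotDiff V a) := by
  refine ⟨fun h V a => h _ _, fun h x a => ?_⟩
  obtain ⟨V, rfl⟩ := P.quot_surjective x
  obtain ⟨a, rfl⟩ := (P.quotDiff V).surjective a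
  exact h V a

theorem isSmoothEndo_descend {S : Π V : TB E M, TN V →ₗ[ℝ] TN V} (hS : P.IsInvariantEndo S)
    (h : IsSmoothEndo 𝓘(ℝ, E).tangent S) : IsSmoothEndo 𝓘(ℝ, E).tangent (P.descendEndo S) := by
  have : CompleteSpace E := FiniteDimensional.complete ℝ E
  refine IsSmoothEndo.of_at fun x => ?_
  obtain ⟨V, rfl⟩ := P.quot_surjective x
  exact IsSmoothEndoAt.of_pullback (P.quotDiffeo V) (P.mem_quotDiffeo_source V)
    (.of_forall fun W a => (descendEndo_quot hS W a).symm) (h.at V)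

theorem isSmoothBilin_descend {s : Π V : TB E M, TN V →ₗ[ℝ] TN V →ₗ[ℝ] ℝ}
    {s' : Π x : P.X, TangentSpace 𝓘(ℝ, E).tangent x →ₗ[ℝ] TangentSpace 𝓘(ℝ, E).tangent x →ₗ[ℝ] ℝ}
    (hs : ∀ V a b, s' (P.quot V) (P.quotDiff V a) (P.quotDiff V b) = s V a b)
    (h : IsSmoothBilin 𝓘(ℝ, E).tangent s) : IsSmoothBilin 𝓘(ℝ, E).tangent s' := by
  have : CompleteSpace E := FiniteDimensional.complete ℝ E
  refine IsSmoothBilin.of_at fun x => ?_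
  obtain ⟨V, rfl⟩ := P.quot_surjective x
  exact IsSmoothBilinAt.of_pullback (P.quotDiffeo V) (P.mem_quotDiffeo_source V)
    (.of_forall fun W a b => (hs W a b).symm) (h.at V)

theorem isClosedTwoForm_descend {s : Π V : TB E M, TN V →ₗ[ℝ] TN V →ₗ[ℝ] ℝ}
    {s' : Π x : P.X, TangentSpace 𝓘(ℝ, E).tangent x →ₗ[ℝ] TangentSpace 𝓘(ℝ, E).tangent x →ₗ[ℝ] ℝ}
    (hs : ∀ V a b, s' (P.quot V) (P.quotDiff V a) (P.quotDiff V b) = s V a b)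
    (h : IsSmoothBilin 𝓘(ℝ, E).tangent s) (hc : IsClosedTwoForm 𝓘(ℝ, E).tangent s) :
    IsClosedTwoForm 𝓘(ℝ, E).tangent s' := by
  have : CompleteSpace E := FiniteDimensional.complete ℝ E
  refine IsClosedTwoForm.of_at fun x => ?_
  obtain ⟨V, rfl⟩ := P.quot_surjective x
  exact IsClosedTwoFormAt.of_pullback (P.quotDiffeo V) (P.mem_quotDiffeo_source V)
    (.of_forall fun W a b => (hs W a b).symm) (h.at V) (hc.at V)

theorem isComplexStructure_descend {S : Π V : TB E M, TN V →ₗ[ℝ] TN V} (hS : P.IsInvariantEndo S)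
    (h : IsComplexStructure 𝓘(ℝ, E).tangent S) :
    IsComplexStructure 𝓘(ℝ, E).tangent (P.descendEndo S) where
  smooth := isSmoothEndo_descend hS h.smooth
  sq := forall_tangent_iff.2 fun V a => by
    rw [descendEndo_quot hS, descendEndo_quot hS, h.sq, map_neg]
  involutive := by
    have : CompleteSpace E := FiniteDimensional.complete ℝ E
    refine IsInvolutive.of_at fun x => ?_
    obtain ⟨V, rfl⟩ := P.quot_surjective x
    exact IsInvolutiveAt.of_pullback (P.quotDiffeo V) (P.mem_quotDiffeo_source V)
      (.of_forall fun W a => mem_negEigenspace_map (P.quotDiff W).injective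
        (fun b => (descendEndo_quot hS W b).symm) a) (h.involutive.at V)

end LatticePeriodStructure

open LatticePeriodStructure

namespace SpecialJoyceStructure

variable {P : SpecialPeriodStructure E M} {A : SpecialJoyceStructure P}

theorem invariant_I₁ (hA : A.IsCompatible) : P.IsInvariantEndo (fun V => A.I₁ V) :=
  fun U γ hU hγ V hV => (hA U hU γ hγ V hV).1

theorem invariant_I₂ (hA : A.IsCompatible) : P.IsInvariantEndo (fun V => A.I₂ V) :=
  fun U γ hU hγ V hV => (hA U hU γ hγ V hV).2.1

theorem invariant_I₃ (hA : A.IsCompatible) : P.IsInvariantEndo (fun V => A.I₃ V) :=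
  fun U γ hU hγ V hV => (hA U hU γ hγ V hV).2.2.1

theorem invariant_g (hA : A.IsCompatible) : P.IsInvariantBilin (fun V => A.gBilin V) :=
  fun U γ hU hγ V hV => (hA U hU γ hγ V hV).2.2.2

/-- The hyperkähler structure of `X`. -/
def quotHyperkahler (hA : A.IsCompatible) : Hyperkahler 𝓘(ℝ, E).tangent P.X :=
  have h₁ := invariant_I₁ hA
  have h₂ := invariant_I₂ hA
  have h₃ := invariant_I₃ hA
  have hg := invariant_g hA
  { g := P.descendBilin fun V => A.gBilin V
    I₁ := P.descendEndo fun V => A.I₁ V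
    I₂ := P.descendEndo fun V => A.I₂ V
    I₃ := P.descendEndo fun V => A.I₃ V
    g_smooth := isSmoothBilin_descend (descendBilin_quot hg) A.gBilin_smooth
    g_symm := forall_tangent_iff.2 fun V a b => by
      obtain ⟨b, rfl⟩ := (P.quotDiff V).surjective b
      rw [descendBilin_quot hg, descendBilin_quot hg, A.gBilin_symm]
    g_nondegenerate := forall_tangent_iff.2 fun V a h => by
      rw [A.gBilin_nondegenerate fun b => (descendBilin_quot hg V a b).symm.trans (h _), map_zero]
    complex₁ := isComplexStructure_descend h₁ A.isComplexStructure_I₁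
    complex₂ := isComplexStructure_descend h₂ A.isComplexStructure_I₂
    complex₃ := isComplexStructure_descend h₃ A.isComplexStructure_I₃
    I₁_I₂ := forall_tangent_iff.2 fun V a => by
      rw [descendEndo_quot h₂, descendEndo_quot h₁, descendEndo_quot h₃, A.I₁_I₂]
    I₂_I₁ := forall_tangent_iff.2 fun V a => by
      rw [descendEndo_quot h₁, descendEndo_quot h₂, descendEndo_quot h₃, A.I₂_I₁, map_neg]
    hermitian₁ := forall_tangent_iff.2 fun V a b => by
      obtain ⟨b, rfl⟩ := (P.quotDiff V).surjective b
      rw [descendEndo_quot h₁, descendEndo_quot h₁, descendBilin_quot hg, descendBilin_quot hg,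
        A.gBilin_I₁]
    hermitian₂ := forall_tangent_iff.2 fun V a b => by
      obtain ⟨b, rfl⟩ := (P.quotDiff V).surjective b
      rw [descendEndo_quot h₂, descendEndo_quot h₂, descendBilin_quot hg, descendBilin_quot hg,
        A.gBilin_I₂]
    hermitian₃ := forall_tangent_iff.2 fun V a b => by
      obtain ⟨b, rfl⟩ := (P.quotDiff V).surjective b
      rw [descendEndo_quot h₃, descendEndo_quot h₃, descendBilin_quot hg, descendBilin_quot hg,
        A.gBilin_I₃]
    closed₁ := by
      refine isClosedTwoForm_descend (s := fun V => A.ω₁ V) (fun V a b => ?_)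
        (IsSmoothBilin.of_at fun V => (A.ω₁_smooth_closed V).1)
        (IsClosedTwoForm.of_at fun V => (A.ω₁_smooth_closed V).2)
      rw [LinearMap.comp_apply, descendEndo_quot h₁, descendBilin_quot hg]
      rfl
    closed₂ := by
      refine isClosedTwoForm_descend (s := fun V => A.ω₂ V) (fun V a b => ?_)
        (IsSmoothBilin.of_at fun V => (A.ω₂_smooth_closed V).1)
        (IsClosedTwoForm.of_at fun V => (A.ω₂_smooth_closed V).2)
      rw [LinearMap.comp_apply, descendEndo_quot h₂, descendBilin_quot hg]
      rfl
    closed₃ := by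
      refine isClosedTwoForm_descend (s := fun V => A.ω₃ V) (fun V a b => ?_)
        (IsSmoothBilin.of_at fun V => (A.ω₃_smooth_closed V).1)
        (IsClosedTwoForm.of_at fun V => (A.ω₃_smooth_closed V).2)
      rw [LinearMap.comp_apply, descendEndo_quot h₃, descendBilin_quot hg, A.ω₃_eq] }

theorem induces_quotHyperkahler (hA : A.IsCompatible) : A.Induces (quotHyperkahler hA) := fun V =>
  ⟨descendEndo_quot (invariant_I₁ hA) V, descendEndo_quot (invariant_I₂ hA) V,
    descendEndo_quot (invariant_I₃ hA) V, descendBilin_quot (invariant_g hA) V⟩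

theorem quotHyperkahler_I₃ (hA : A.IsCompatible) (V : TB E M) (a : TN V) :
    (quotHyperkahler hA).I₃ (P.quot V) (P.quotDiff V a) = P.quotDiff V (A.I₃ V a) :=
  descendEndo_quot (invariant_I₃ hA) V a

theorem quotHyperkahler_ω₁ (hA : A.IsCompatible) (V : TB E M) (a b : TN V) :
    (quotHyperkahler hA).ω₁ (P.quot V) (P.quotDiff V a) (P.quotDiff V b) = A.ω₁ V a b :=
  (congrArg (fun t => (quotHyperkahler hA).g (P.quot V) t (P.quotDiff V b))
    (descendEndo_quot (invariant_I₁ hA) V a)).trans (descendBilin_quot (invariant_g hA) V _ b)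

theorem quotHyperkahler_ω₂ (hA : A.IsCompatible) (V : TB E M) (a b : TN V) :
    (quotHyperkahler hA).ω₂ (P.quot V) (P.quotDiff V a) (P.quotDiff V b) = A.ω₂ V a b :=
  (congrArg (fun t => (quotHyperkahler hA).g (P.quot V) t (P.quotDiff V b))
    (descendEndo_quot (invariant_I₂ hA) V a)).trans (descendBilin_quot (invariant_g hA) V _ b)

theorem quotHyperkahler_ω₃ (hA : A.IsCompatible) (V : TB E M) (a b : TN V) :
    (quotHyperkahler hA).ω₃ (P.quot V) (P.quotDiff V a) (P.quotDiff V b) = A.ω₃ V a b :=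
  ((congrArg (fun t => (quotHyperkahler hA).g (P.quot V) t (P.quotDiff V b))
    (descendEndo_quot (invariant_I₃ hA) V a)).trans (descendBilin_quot
      (invariant_g hA) V _ b)).trans (A.ω₃_eq V a b).symm

end SpecialJoyceStructure

end

/-! ### The topology of the quotient and its projection -/

section

variable {E : Type*} [NormedAddCommGroup E] [NormedSpace ℂ E]
  {M : Type*} [TopologicalSpace M] [ChartedSpace E M] [IsManifold 𝓘(ℂ, E) ω M]

/-- Countably many charts of `M` cover `M`, and the induced charts of `TM` cover `TM`. -/
theorem secondCountableTopology_TB [FiniteDimensional ℂ E] [SecondCountableTopology M] :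
    SecondCountableTopology (TB E M) := by
  have : ProperSpace E := FiniteDimensional.proper ℂ E
  have : SecondCountableTopology (ModelProd E E) :=
    inferInstanceAs (SecondCountableTopology (E × E))
  obtain ⟨s, hs, hsU⟩ := TopologicalSpace.countable_cover_nhds
    (f := fun p : M => (chartAt E p).source) fun p => chart_source_mem_nhds E p
  refine ChartedSpace.secondCountable_of_countable_cover (ModelProd E E)
    (s := (fun p : M => (⟨p, (0 : E)⟩ : TB E M)) '' s) ?_ (hs.image _)
  refine Set.eq_univ_of_forall fun V => ?_
  have hV : V.proj ∈ ⋃ p ∈ s, (chartAt E p).source := hsU ▸ Set.mem_univ _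
  simp only [Set.mem_iUnion] at hV ⊢
  obtain ⟨p, hp, hpV⟩ := hV
  exact ⟨_, ⟨p, hp, rfl⟩, (TangentBundle.mem_chart_source_iff _ _).2 hpV⟩

namespace LatticePeriodStructure

variable (P : LatticePeriodStructure E M)

theorem secondCountableTopology_X [FiniteDimensional ℂ E] [SecondCountableTopology M] :
    SecondCountableTopology P.X := by
  have := secondCountableTopology_TB (E := E) (M := M)
  exact TopologicalSpace.Quotient.secondCountableTopology P.isOpenMap_quot

theorem continuous_proj : Continuous P.proj :=
  Continuous.quotient_lift (FiberBundle.continuous_proj E (TangentSpace 𝓘(ℝ, E))) _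

/-- Two vectors over the domain of a Darboux frame have the same image in `X` if and only if their
coefficients agree modulo `2π`. -/
theorem quot_eq_iff {p q : M} (hq : q ∈ P.frameDom p) (t u : TangentSpace 𝓘(ℝ, E) q) :
    P.quot ⟨q, t⟩ = P.quot ⟨q, u⟩ ↔ ∀ a, (P.coeff p a q t : AddCircle (2 * Real.pi))
      = (P.coeff p a q u : AddCircle (2 * Real.pi)) := by
  constructor
  · intro h a
    obtain ⟨γ, hγ⟩ := P.exists_of_quot_eq h
    have h1 : u = t + (2 * Real.pi) • (γ : TangentSpace 𝓘(ℝ, E) q) := by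
      injection hγ
    obtain ⟨m, hm⟩ := P.coeff_int p q hq γ a
    rw [h1, map_add, map_smul, hm, AddCircle.coe_add, smul_eq_mul,
      mul_comm (2 * Real.pi), ← zsmul_eq_mul, AddCircle.coe_zsmul, AddCircle.coe_period, smul_zero,
      add_zero]
  · intro h
    have h1 : ∀ a, ∃ m : ℤ, P.coeff p a q u = P.coeff p a q t + 2 * Real.pi * m := by
      intro a
      obtain ⟨m, hm⟩ := (QuotientAddGroup.eq.1 (h a) :
        -(P.coeff p a q t) + P.coeff p a q u ∈ AddSubgroup.zmultiples (2 * Real.pi))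
      refine ⟨m, ?_⟩
      simp only [zsmul_eq_mul] at hm
      linarith
    choose m hm using h1
    refine Quotient.sound (s := P.setoid) ⟨∑ a, m a • P.frame p a q, ?_⟩
    have h2 : u = t + (2 * Real.pi) • ((∑ a, m a • P.frame p a q : P.Γ q) :
        TangentSpace 𝓘(ℝ, E) q) := by
      refine (P.sum_coeff p hq u).symm.trans ?_
      conv_rhs => rw [← P.sum_coeff p hq t]
      rw [AddSubgroup.val_finsetSum, Finset.smul_sum, ← Finset.sum_add_distrib]
      refine Finset.sum_congr rfl fun a _ => ?_
      rw [hm, add_smul, mul_smul, AddSubgroup.coe_zsmul, ← Int.cast_smul_eq_zsmul ℝ]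
      rfl
    rw [h2]

variable [FiniteDimensional ℂ E]

/-- The coordinates modulo `2π` of the fibres of `X → M` that belong to the Darboux frame around
`p`, in terms of the chosen representative; see `angle_quot`. -/
def angle (p : M) (x : P.X) (a : FrameIdx E) : AddCircle (2 * Real.pi) :=
  P.coeff p a (P.rep x).proj (P.rep x).2

theorem angle_quot (p : M) {V : TB E M} (hV : V.proj ∈ P.frameDom p) (a : FrameIdx E) :
    P.angle p (P.quot V) a = P.coeff p a V.proj V.2 := by
  have key : ∀ W : TB E M, P.quot W = P.quot V →
      (P.coeff p a W.proj W.2 : AddCircle (2 * Real.pi)) = P.coeff p a V.proj V.2 := by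
    rintro ⟨q, t⟩ hW
    obtain ⟨r, u⟩ := V
    obtain rfl : q = r := congrArg P.proj hW
    exact (P.quot_eq_iff hV t u).1 hW a
  exact key _ (P.quot_rep _)

theorem continuousAt_angle (p : M) {x : P.X} (hx : P.proj x ∈ P.frameDom p) :
    ContinuousAt (P.angle p) x := by
  obtain ⟨V, rfl⟩ := P.quot_surjective x
  have h1 : ContinuousAt (P.angle p ∘ P.quot) V := by
    have h2 : ContinuousAt (fun (W : TB E M) a =>
        (P.coeff p a W.proj W.2 : AddCircle (2 * Real.pi)))
        V := by
      refine continuousAt_pi.2 fun a => ?_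
      exact (AddCircle.continuous_mk' _).continuousAt.comp
        (continuousAt_pi.1 (P.contMDiffAt_coeff p hx).continuousAt a)
    refine h2.congr ?_
    filter_upwards [((P.isOpen_frameDom p).preimage
      (FiberBundle.continuous_proj E (TangentSpace 𝓘(ℝ, E)))).mem_nhds hx] with W hW
    exact funext fun a => (P.angle_quot p hW a).symm
  rw [ContinuousAt, ← P.isLocalHomeomorph_quot.map_nhds_eq V, Filter.tendsto_map'_iff]
  exact h1

/-- Two points of `X` are separated by their images in `M`, or by the angles, which are continuous.
-/
theorem t2Space_X [T2Space M] : T2Space P.X := by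
  rw [t2Space_iff_disjoint_nhds]
  intro x y hxy
  by_cases h : P.proj x = P.proj y
  · have hx : P.proj x ∈ P.frameDom (P.proj x) := P.mem_frameDom _
    refine (P.continuousAt_angle _ hx).disjoint (disjoint_nhds_nhds.2 fun hne => hxy ?_)
      (P.continuousAt_angle (P.proj x) (h ▸ hx))
    obtain ⟨⟨q, t⟩, rfl⟩ := P.quot_surjective x
    obtain ⟨⟨r, u⟩, rfl⟩ := P.quot_surjective y
    obtain rfl : q = r := h
    refine (P.quot_eq_iff hx t u).2 fun a => ?_
    exact (P.angle_quot q (V := ⟨q, t⟩) hx a).symm.trans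
      ((congrFun hne a).trans (P.angle_quot q (V := ⟨q, u⟩) hx a))
  · exact P.continuous_proj.continuousAt.disjoint (disjoint_nhds_nhds.2 h)
      P.continuous_proj.continuousAt

theorem contMDiff_proj : ContMDiff 𝓘(ℝ, E).tangent 𝓘(ℝ, E) ∞ P.proj := by
  intro x
  obtain ⟨V, rfl⟩ := P.quot_surjective x
  have hV : P.quot V ∈ (P.quotDiffeo V).target :=
    (P.quotDiffeo V).map_source' (P.mem_quotDiffeo_source V)
  have h1 : ContMDiffAt 𝓘(ℝ, E).tangent 𝓘(ℝ, E).tangent ∞ (P.quotDiffeo V).symm (P.quot V) :=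
    (P.quotDiffeo V).symm.contMDiffOn.contMDiffAt ((P.quotDiffeo V).open_target.mem_nhds hV)
  have h2 : ContMDiffAt 𝓘(ℝ, E).tangent 𝓘(ℝ, E) ∞ (fun W : TB E M => W.proj)
      ((P.quotDiffeo V).symm (P.quot V)) := Bundle.contMDiff_proj (TangentSpace 𝓘(ℝ, E)) _
  refine (h2.comp (P.quot V) h1).congr_of_eventuallyEq ?_
  filter_upwards [(P.quotDiffeo V).open_target.mem_nhds hV] with y hy
  exact (congrArg P.proj ((P.quotDiffeo V).right_inv' hy)).symm

theorem mfderiv_proj (V : TB E M) (a : TN V) :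
    mfderiv 𝓘(ℝ, E).tangent 𝓘(ℝ, E) P.proj (P.quot V) (P.quotDiff V a) = dproj V a := by
  have h1 := mfderiv_comp V ((P.contMDiff_proj (P.quot V)).mdifferentiableAt (by simp))
    ((P.contMDiffAt_quot V).mdifferentiableAt (by simp))
  exact (congrArg (fun l : (E × E) →L[ℝ] E => l a) h1).symm

theorem mem_vert_iff (V : TB E M) (a : TN V) :
    P.quotDiff V a ∈ vert 𝓘(ℝ, E).tangent E P.proj (P.quot V) ↔ dproj V a = 0 := by
  rw [← P.mfderiv_proj V a]
  exact LinearMap.mem_ker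

theorem continuous_frameSum (p : M) :
    Continuous fun x : FrameIdx E → ℝ => P.quot ⟨p, P.frameSum p p x⟩ := by
  have h : Continuous fun x : FrameIdx E → ℝ => (P.frameSum p p x : E) :=
    (P.frameEquiv (P.mem_frameDom p)).continuous
  exact P.continuous_quot.comp ((contMDiff_fibreIncl p).continuous.comp h)

/-- A fibre is the image of the cube `[0, 2π]^{2n}`, in the coordinates of a Darboux frame. -/
theorem fibre_eq_image (p : M) : P.proj ⁻¹' {p}
    = (fun x : FrameIdx E → ℝ => P.quot ⟨p, P.frameSum p p x⟩) ''
      Set.pi Set.univ fun _ => Set.Icc 0 (2 * Real.pi) := by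
  ext y
  constructor
  · intro hy
    obtain ⟨⟨q, t⟩, rfl⟩ := P.quot_surjective y
    obtain rfl : q = p := hy
    have hq := P.mem_frameDom q
    have hpi : Fact (0 < 2 * Real.pi) := ⟨Real.two_pi_pos⟩
    refine ⟨fun a => toIcoMod Real.two_pi_pos 0 (P.coeff q a q t), fun a _ => ?_, ?_⟩
    · have := toIcoMod_mem_Ico Real.two_pi_pos 0 (P.coeff q a q t)
      rw [zero_add] at this
      exact ⟨this.1, this.2.le⟩
    · refine (P.quot_eq_iff hq _ _).2 fun a => ?_
      rw [P.coeff_frameSum hq]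
      exact QuotientAddGroup.eq.2 ⟨toIcoDiv Real.two_pi_pos 0 (P.coeff q a q t), by
        have := self_sub_toIcoMod Real.two_pi_pos 0 (P.coeff q a q t)
        simp only
        rw [← this]
        ring⟩
  · rintro ⟨x, -, rfl⟩
    rfl

theorem isCompact_fibre (p : M) : IsCompact (P.proj ⁻¹' {p}) := by
  rw [fibre_eq_image]
  exact (isCompact_univ_pi fun _ => isCompact_Icc).image (P.continuous_frameSum p)

theorem isConnected_fibre (p : M) : IsConnected (P.proj ⁻¹' {p}) := by
  rw [fibre_eq_image]
  exact (isConnected_univ_pi.2 fun _ => isConnected_Icc Real.two_pi_pos.le).image _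
    (P.continuous_frameSum p).continuousOn

end LatticePeriodStructure

end

/-! ### Periods over tori -/

/-- The integral of `∑ du_i ∧ dv_i` over a torus, for functions on `ℝ²` that are periodic up to
constants: by the divergence theorem it is determined by these constants. -/
theorem integral_sum_wedge {ι : Type*} [Fintype ι] {u v : ι → ℝ × ℝ → ℝ} {a₁ a₂ b₁ b₂ : ι → ℝ}
    (hu : ∀ i, ContDiff ℝ ∞ (u i)) (hv : ∀ i, ContDiff ℝ ∞ (v i))
    (hu₁ : ∀ i s t, u i (s + 1, t) = u i (s, t) + a₁ i)
    (hu₂ : ∀ i s t, u i (s, t + 1) = u i (s, t) + a₂ i)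
    (hv₁ : ∀ i s t, v i (s + 1, t) = v i (s, t) + b₁ i)
    (hv₂ : ∀ i s t, v i (s, t + 1) = v i (s, t) + b₂ i) :
    ∫ s in (0 : ℝ)..1, ∫ t in (0 : ℝ)..1, ∑ i, (fderiv ℝ (u i) (s, t) (1, 0)
        * fderiv ℝ (v i) (s, t) (0, 1)
        - fderiv ℝ (u i) (s, t) (0, 1) * fderiv ℝ (v i) (s, t) (1, 0))
      = ∑ i, (a₁ i * b₂ i - a₂ i * b₁ i) := by
  have hdu : ∀ i z, HasFDerivAt (u i) (fderiv ℝ (u i) z) z := fun i z =>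
    ((hu i).differentiable (by simp) z).hasFDerivAt
  have hdv : ∀ i z, HasFDerivAt (v i) (fderiv ℝ (v i) z) z := fun i z =>
    ((hv i).differentiable (by simp) z).hasFDerivAt
  have hcu : ∀ i, ContDiff ℝ ∞ (fderiv ℝ (u i)) := fun i => (hu i).fderiv_right (by simp)
  have hcv : ∀ i, ContDiff ℝ ∞ (fderiv ℝ (v i)) := fun i => (hv i).fderiv_right (by simp)
  have hd2 : ∀ i z, HasFDerivAt (fderiv ℝ (v i)) (fderiv ℝ (fderiv ℝ (v i)) z) z := fun i z =>
    ((hcv i).differentiable (by simp) z).hasFDerivAt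
  have hd2' : ∀ i z (e : ℝ × ℝ), HasFDerivAt (fun z => fderiv ℝ (v i) z e)
      ((fderiv ℝ (fderiv ℝ (v i)) z).flip e) z := fun i z e =>
    ((hd2 i z).clm_apply (hasFDerivAt_const e z)).congr_fderiv (by ext <;> simp)
  have hsymm : ∀ i z, fderiv ℝ (fderiv ℝ (v i)) z (1, 0) (0, 1)
      = fderiv ℝ (fderiv ℝ (v i)) z (0, 1) (1, 0) := fun i z =>
    ((hv i).contDiffAt.isSymmSndFDerivAt (by simpa using two_le_infty)) _ _
  have hf : ∀ z, HasFDerivAt (fun z => ∑ i, u i z * fderiv ℝ (v i) z (0, 1))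
      (∑ i, (u i z • (fderiv ℝ (fderiv ℝ (v i)) z).flip (0, 1)
        + fderiv ℝ (v i) z (0, 1) • fderiv ℝ (u i) z)) z := fun z =>
    HasFDerivAt.fun_sum fun i _ => (hdu i z).mul (hd2' i z (0, 1))
  have hg : ∀ z, HasFDerivAt (fun z => -∑ i, u i z * fderiv ℝ (v i) z (1, 0))
      (-∑ i, (u i z • (fderiv ℝ (fderiv ℝ (v i)) z).flip (1, 0)
        + fderiv ℝ (v i) z (1, 0) • fderiv ℝ (u i) z)) z := fun z =>
    (HasFDerivAt.fun_sum fun i _ => (hdu i z).mul (hd2' i z (1, 0))).fun_neg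
  have hint : ∀ z : ℝ × ℝ, (∑ i, (u i z • (fderiv ℝ (fderiv ℝ (v i)) z).flip (0, 1)
        + fderiv ℝ (v i) z (0, 1) • fderiv ℝ (u i) z)) (1, 0)
      + (-∑ i, (u i z • (fderiv ℝ (fderiv ℝ (v i)) z).flip (1, 0)
        + fderiv ℝ (v i) z (1, 0) • fderiv ℝ (u i) z)) (0, 1)
      = ∑ i, (fderiv ℝ (u i) z (1, 0) * fderiv ℝ (v i) z (0, 1)
        - fderiv ℝ (u i) z (0, 1) * fderiv ℝ (v i) z (1, 0)) := by
    intro z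
    simp only [neg_apply, sum_apply, add_apply, smul_apply, ContinuousLinearMap.flip_apply,
      smul_eq_mul, hsymm]
    rw [← sub_eq_add_neg, ← Finset.sum_sub_distrib]
    exact Finset.sum_congr rfl fun i _ => by ring
  have hcont : Continuous fun z : ℝ × ℝ => ∑ i, (fderiv ℝ (u i) z (1, 0) * fderiv ℝ (v i) z (0, 1)
        - fderiv ℝ (u i) z (0, 1) * fderiv ℝ (v i) z (1, 0)) := by
    have h1 := fun i => (hcu i).continuous
    have h2 := fun i => (hcv i).continuous
    fun_prop
  have h := MeasureTheory.integral2_divergence_prod_of_hasFDerivAt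
    (fun z => ∑ i, u i z * fderiv ℝ (v i) z (0, 1))
    (fun z => -∑ i, u i z * fderiv ℝ (v i) z (1, 0)) _ _ 0 0 1 1
    (fun z _ => (hf z).continuousAt.continuousWithinAt)
    (fun z _ => (hg z).continuousAt.continuousWithinAt) (fun z _ => hf z) (fun z _ => hg z) (by
      simp only [hint]
      exact hcont.continuousOn.integrableOn_compact (isCompact_uIcc.prod isCompact_uIcc))
  simp only [hint] at h
  rw [h]
  -- the derivatives of `v` are periodic
  have hp₁ : ∀ i s t, fderiv ℝ (v i) (s + 1, t) = fderiv ℝ (v i) (s, t) := by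
    intro i s t
    have h1 : (fun z : ℝ × ℝ => v i (z + (1, 0))) = fun z => v i z + b₁ i := by
      funext z
      rw [← hv₁ i z.1 z.2]
      congr 1
      ext <;> simp
    have h2 := fderiv_comp_add_right (𝕜 := ℝ) (f := v i) (x := (s, t)) ((1, 0) : ℝ × ℝ)
    rw [h1, fderiv_add_const] at h2
    simpa using h2.symm
  have hp₂ : ∀ i s t, fderiv ℝ (v i) (s, t + 1) = fderiv ℝ (v i) (s, t) := by
    intro i s t
    have h1 : (fun z : ℝ × ℝ => v i (z + (0, 1))) = fun z => v i z + b₂ i := by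
      funext z
      rw [← hv₂ i z.1 z.2]
      congr 1
      ext <;> simp
    have h2 := fderiv_comp_add_right (𝕜 := ℝ) (f := v i) (x := (s, t)) ((0, 1) : ℝ × ℝ)
    rw [h1, fderiv_add_const] at h2
    simpa using h2.symm
  have hi₁ : ∀ i, ∫ s in (0 : ℝ)..1, fderiv ℝ (v i) (s, 0) (1, 0) = b₁ i := by
    intro i
    have hd : ∀ s : ℝ, HasDerivAt (fun s => v i (s, 0)) (fderiv ℝ (v i) (s, 0) (1, 0)) s := fun s =>
      (hdv i (s, 0)).comp_hasDerivAt s ((hasDerivAt_id s).prodMk (hasDerivAt_const s 0))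
    rw [intervalIntegral.integral_eq_sub_of_hasDerivAt (fun s _ => hd s)]
    · have := hv₁ i 0 0
      rw [zero_add] at this
      rw [this]
      ring
    · refine Continuous.intervalIntegrable ?_ _ _
      have := (hcv i).continuous
      fun_prop
  have hi₂ : ∀ i, ∫ t in (0 : ℝ)..1, fderiv ℝ (v i) (0, t) (0, 1) = b₂ i := by
    intro i
    have hd : ∀ t : ℝ, HasDerivAt (fun t => v i (0, t)) (fderiv ℝ (v i) (0, t) (0, 1)) t := fun t =>
      (hdv i (0, t)).comp_hasDerivAt t ((hasDerivAt_const t 0).prodMk (hasDerivAt_id t))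
    rw [intervalIntegral.integral_eq_sub_of_hasDerivAt (fun s _ => hd s)]
    · have := hv₂ i 0 0
      rw [zero_add] at this
      rw [this]
      ring
    · refine Continuous.intervalIntegrable ?_ _ _
      have := (hcv i).continuous
      fun_prop
  have hc1 : ∀ i, Continuous fun s : ℝ => fderiv ℝ (v i) (s, 0) (1, 0) := fun i => by
    have := (hcv i).continuous
    fun_prop
  have hc2 : ∀ i, Continuous fun t : ℝ => fderiv ℝ (v i) (0, t) (0, 1) := fun i => by
    have := (hcv i).continuous
    fun_prop
  have hcu' := fun i => (hu i).continuous
  have hcv' := fun i => (hcv i).continuous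
  have e1 : (∫ s in (0 : ℝ)..1, -∑ i, u i (s, 1) * fderiv ℝ (v i) (s, 1) (1, 0))
      - ∫ s in (0 : ℝ)..1, -∑ i, u i (s, 0) * fderiv ℝ (v i) (s, 0) (1, 0) = -∑ i, a₂ i * b₁ i := by
    rw [← intervalIntegral.integral_sub
      (Continuous.intervalIntegrable (by fun_prop) _ _)
      (Continuous.intervalIntegrable (by fun_prop) _ _)]
    have h3 : ∀ s : ℝ, (-∑ i, u i (s, 1) * fderiv ℝ (v i) (s, 1) (1, 0))
        - (-∑ i, u i (s, 0) * fderiv ℝ (v i) (s, 0) (1, 0))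
        = ∑ i, -a₂ i * fderiv ℝ (v i) (s, 0) (1, 0) := by
      intro s
      rw [← Finset.sum_neg_distrib, ← Finset.sum_neg_distrib, ← Finset.sum_sub_distrib]
      refine Finset.sum_congr rfl fun i _ => ?_
      have h4 := hu₂ i s 0
      have h5 := hp₂ i s 0
      rw [zero_add] at h4 h5
      rw [h4, h5]
      ring
    simp only [h3]
    rw [intervalIntegral.integral_finsetSum fun i _ =>
      Continuous.intervalIntegrable ((hc1 i).const_mul _) _ _, ← Finset.sum_neg_distrib]
    refine Finset.sum_congr rfl fun i _ => ?_
    rw [intervalIntegral.integral_const_mul, hi₁]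
    ring
  have e2 : (∫ t in (0 : ℝ)..1, ∑ i, u i (1, t) * fderiv ℝ (v i) (1, t) (0, 1))
      - ∫ t in (0 : ℝ)..1, ∑ i, u i (0, t) * fderiv ℝ (v i) (0, t) (0, 1) = ∑ i, a₁ i * b₂ i := by
    rw [← intervalIntegral.integral_sub
      (Continuous.intervalIntegrable (by fun_prop) _ _)
      (Continuous.intervalIntegrable (by fun_prop) _ _)]
    have h3 : ∀ t : ℝ, (∑ i, u i (1, t) * fderiv ℝ (v i) (1, t) (0, 1))
        - (∑ i, u i (0, t) * fderiv ℝ (v i) (0, t) (0, 1))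
        = ∑ i, a₁ i * fderiv ℝ (v i) (0, t) (0, 1) := by
      intro t
      rw [← Finset.sum_sub_distrib]
      refine Finset.sum_congr rfl fun i _ => ?_
      have h4 := hu₁ i 0 t
      have h5 := hp₁ i 0 t
      rw [zero_add] at h4 h5
      rw [h4, h5]
      ring
    simp only [h3]
    rw [intervalIntegral.integral_finsetSum fun i _ =>
      Continuous.intervalIntegrable ((hc2 i).const_mul _) _ _]
    refine Finset.sum_congr rfl fun i _ => ?_
    rw [intervalIntegral.integral_const_mul, hi₂]
  rw [Finset.sum_sub_distrib]
  linarith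

/-! ### The algebraic integrable system -/

section

section Hyperkahler

variable {F : Type*} [NormedAddCommGroup F] [NormedSpace ℝ F] {H : Type*} [TopologicalSpace H]
  {J : ModelWithCorners ℝ F H} {X : Type*} [TopologicalSpace X] [ChartedSpace H X]
  [IsManifold J ∞ X]

namespace Hyperkahler

variable (S : Hyperkahler J X) (x : X) (a b : TangentSpace J x)

theorem ω₁_self : S.ω₁ x a a = 0 := by
  have h := S.hermitian₁ x (S.I₁ x a) a
  rw [S.complex₁.sq, map_neg, LinearMap.neg_apply, S.g_symm x a] at h
  show S.g x (S.I₁ x a) a = 0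
  linarith

theorem ω₂_self : S.ω₂ x a a = 0 := by
  have h := S.hermitian₂ x (S.I₂ x a) a
  rw [S.complex₂.sq, map_neg, LinearMap.neg_apply, S.g_symm x a] at h
  show S.g x (S.I₂ x a) a = 0
  linarith

theorem ω₃_self : S.ω₃ x a a = 0 := by
  have h := S.hermitian₃ x (S.I₃ x a) a
  rw [S.complex₃.sq, map_neg, LinearMap.neg_apply, S.g_symm x a] at h
  show S.g x (S.I₃ x a) a = 0
  linarith

theorem ω₁_I₃ : S.ω₁ x (S.I₃ x a) b = -S.ω₂ x a b := by
  show S.g x (S.I₁ x (S.I₃ x a)) b = -S.g x (S.I₂ x a) b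
  rw [← S.I₁_I₂, S.complex₁.sq, map_neg, LinearMap.neg_apply]

theorem ω₂_I₃ : S.ω₂ x (S.I₃ x a) b = S.ω₁ x a b := by
  show S.g x (S.I₂ x (S.I₃ x a)) b = S.g x (S.I₁ x a) b
  rw [← neg_neg (S.I₃ x a), ← S.I₂_I₁, map_neg, S.complex₂.sq, neg_neg]

theorem ω₃_I₃ : S.ω₃ x (S.I₃ x a) (S.I₃ x b) = S.ω₃ x a b :=
  S.hermitian₃ x _ _

theorem eq_zero_of_ω₁ {a : TangentSpace J x} (h : ∀ b, S.ω₁ x a b = 0) : a = 0 := by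
  have h1 : S.I₁ x a = 0 := S.g_nondegenerate x _ h
  rw [← neg_eq_zero, ← S.complex₁.sq, h1, map_zero]

theorem ω₁_smooth : IsSmoothBilin J S.ω₁ :=
  fun U hU A B hA hB => S.g_smooth U hU _ B (S.complex₁.smooth U hU A hA) hB

theorem ω₂_smooth : IsSmoothBilin J S.ω₂ :=
  fun U hU A B hA hB => S.g_smooth U hU _ B (S.complex₂.smooth U hU A hA) hB

theorem ω₃_smooth : IsSmoothBilin J S.ω₃ :=
  fun U hU A B hA hB => S.g_smooth U hU _ B (S.complex₃.smooth U hU A hA) hB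

end Hyperkahler

end Hyperkahler

variable {E : Type*} [NormedAddCommGroup E] [NormedSpace ℂ E]
  {M : Type*} [TopologicalSpace M] [ChartedSpace E M] [IsManifold 𝓘(ℂ, E) ω M]
  [FiniteDimensional ℂ E]

open LatticePeriodStructure

namespace AlmostSpecialJoyceStructure

variable {P : SpecialPeriodStructure E M} (A : AlmostSpecialJoyceStructure P) (V : TB E M)

theorem dproj_reSum (X Y : T10 E V.proj) :
    dproj V (reSum (A.h V) (A.v V) (X, Y)) = X.1.re := by
  have h5 : dproj V (A.h V X).re = X.1.re := congrArg Cx.re (A.dproj_h V X)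
  rw [show reSum (A.h V) (A.v V) (X, Y) = (A.h V X).re + (A.v V Y).re from rfl, map_add, h5,
    A.dproj_v_re, add_zero]

theorem dproj_surjective (A : AlmostSpecialJoyceStructure P) (V : TB E M) :
    Function.Surjective (dproj V) := fun t =>
  ⟨reSum (A.h V) (A.v V) (toT10 V.proj t, 0), A.dproj_reSum V _ _⟩

/-- The projection `TM → M` is `I₃`-holomorphic. -/
theorem dproj_I₃ (a : TN V) : dproj V (A.I₃ V a) = cplx E V.proj (dproj V a) := by
  obtain ⟨X, Y, rfl⟩ := A.exists_reSum V a
  rw [A.I₃_reSum, A.dproj_reSum, A.dproj_reSum]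
  have h : (Complex.I • X).1.re = -X.1.im := by
    rw [Submodule.coe_smul, Cx.re_smul]
    simp
  rw [h, im_of_mem_T10, neg_neg]

theorem dproj_reSum_eq_zero_iff (X Y : T10 E V.proj) :
    dproj V (reSum (A.h V) (A.v V) (X, Y)) = 0 ↔ X = 0 := by
  rw [A.dproj_reSum]
  refine ⟨fun h => ?_, fun h => by rw [h]; rfl⟩
  rw [← toT10_re X, h]
  refine Subtype.ext (Cx.ext rfl ?_)
  show -cplx E V.proj 0 = 0
  rw [map_zero, neg_zero]

theorem exists_reSum_of_dproj {a : TN V} (h : dproj V a = 0) :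
    ∃ Y, reSum (A.h V) (A.v V) (0, Y) = a := by
  obtain ⟨X, Y, rfl⟩ := A.exists_reSum V a
  exact ⟨Y, by rw [(A.dproj_reSum_eq_zero_iff V X Y).1 h]⟩

end AlmostSpecialJoyceStructure

namespace SpecialJoyceStructure

variable {P : SpecialPeriodStructure E M} (A : SpecialJoyceStructure P)

/-- The vertical spaces are Lagrangian for `ω₁ + i ω₂`. -/
theorem dproj_eq_zero_iff_forall (V : TB E M) (a : TN V) : dproj V a = 0 ↔
    ∀ b, dproj V b = 0 → A.ω₁ V a b = 0 ∧ A.ω₂ V a b = 0 := by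
  constructor
  · intro ha b hb
    obtain ⟨Y, rfl⟩ := A.exists_reSum_of_dproj V ha
    obtain ⟨Y', rfl⟩ := A.exists_reSum_of_dproj V hb
    rw [A.ω₁_reSum, A.ω₂_reSum]
    simp
  · intro h
    obtain ⟨X, Y, rfl⟩ := A.exists_reSum V a
    rw [A.dproj_reSum_eq_zero_iff]
    refine A.eq_zero_of_kappa fun Y' => ?_
    obtain ⟨h1, h2⟩ := h _ ((A.dproj_reSum_eq_zero_iff V 0 Y').2 rfl)
    rw [A.ω₁_reSum] at h1
    rw [A.ω₂_reSum] at h2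
    have h3 := (mul_eq_zero.1 h1).resolve_left neg_scale_ne_zero
    have h4 := (mul_eq_zero.1 h2).resolve_left neg_scale_ne_zero
    rw [map_zero, sub_zero] at h3
    rw [map_zero, zero_add] at h4
    exact Complex.ext h4 h3

/-- The restriction of `ω₃` to the fibres is non-degenerate. -/
theorem eq_zero_of_ω₃_vertical {V : TB E M} {a : TN V} (ha : dproj V a = 0)
    (h : ∀ b, dproj V b = 0 → A.ω₃ V a b = 0) : a = 0 := by
  obtain ⟨Y, rfl⟩ := A.exists_reSum_of_dproj V ha
  have key : ∀ Y', (A.kappa V Y Y').re = 0 := by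
    intro Y'
    have h1 := h _ ((A.dproj_reSum_eq_zero_iff V 0 Y').2 rfl)
    rw [A.ω₃_reSum] at h1
    have h2 := (mul_eq_zero.1 h1).resolve_left neg_scale_ne_zero
    simpa using h2
  have hY : Y = 0 := A.eq_zero_of_kappa fun Y' => by
    have h1 := key Y'
    have h2 := key (Complex.I • Y')
    simp at h2
    exact Complex.ext h1 h2
  rw [hY]
  exact map_zero _

theorem ω₃_vertical {p : M} {w : CoordSpace E} (hw : w ∈ P.adaptedDom p)
    (y y' : FrameIdx E → ℝ) :
    A.ω₃ (P.adaptedFun p w) (P.adaptedDiff p w (0, y)) (P.adaptedDiff p w (0, y'))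
      = -(1 / (4 * Real.pi ^ 2)) * ∑ i, (y (.inl i) * y' (.inr i) - y (.inr i) * y' (.inl i)) := by
  rw [(A.forms_adapted hw _ _).1, connForm_apply]
  simp only [vertPart_apply, map_zero, sub_zero, symp_apply, ofRealPi_apply, ← Complex.ofReal_mul,
    ← Complex.ofReal_sub, ← Complex.ofReal_sum, Complex.ofReal_re]

end SpecialJoyceStructure

namespace LatticePeriodStructure

variable (P : LatticePeriodStructure E M)

/-- The point of the coordinate space that lies over `p` and has fibre coordinates `x`. -/
def fibreCoord (p : M) (x : FrameIdx E → ℝ) : CoordSpace E := (extChartAt 𝓘(ℝ, E) p p, x)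

theorem extChartAt_symm_self (p : M) :
    (extChartAt 𝓘(ℝ, E) p).symm (extChartAt 𝓘(ℝ, E) p p) = p := extChartAt_to_inv p

theorem fibreCoord_mem (p : M) (x : FrameIdx E → ℝ) : fibreCoord p x ∈ P.adaptedDom p :=
  ⟨mem_extChartAt_target p, by
    show (extChartAt 𝓘(ℝ, E) p).symm (extChartAt 𝓘(ℝ, E) p p) ∈ _
    rw [extChartAt_symm_self]
    exact P.mem_frameDom p⟩

theorem adaptedFun_fibreCoord_proj (p : M) (x : FrameIdx E → ℝ) :
    (P.adaptedFun p (fibreCoord p x)).proj = p := extChartAt_symm_self p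

theorem coeff_adaptedFun_fibreCoord (p : M) (x : FrameIdx E → ℝ) (a : FrameIdx E) :
    P.coeff p a (P.adaptedFun p (fibreCoord p x)).proj (P.adaptedFun p (fibreCoord p x)).2 = x a :=
  P.coeff_sum p (P.fibreCoord_mem p x).2 x a

theorem angle_fibreCoord (p : M) (x : FrameIdx E → ℝ) (a : FrameIdx E) :
    P.angle p (P.quot (P.adaptedFun p (fibreCoord p x))) a = (x a : AddCircle (2 * Real.pi)) := by
  rw [P.angle_quot p (P.fibreCoord_mem p x).2, P.coeff_adaptedFun_fibreCoord]

theorem eq_of_angle_eq {p : M} {x y : P.X} (hx : P.proj x = p) (hy : P.proj y = p)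
    (h : P.angle p x = P.angle p y) : x = y := by
  obtain ⟨⟨q, t⟩, rfl⟩ := P.quot_surjective x
  obtain ⟨⟨r, u⟩, rfl⟩ := P.quot_surjective y
  obtain rfl : q = p := hx
  obtain rfl : r = q := hy
  have hq := P.mem_frameDom r
  refine (P.quot_eq_iff hq t u).2 fun a => ?_
  exact (P.angle_quot r (V := ⟨r, t⟩) hq a).symm.trans
    ((congrFun h a).trans (P.angle_quot r (V := ⟨r, u⟩) hq a))

/-- A smooth map from `ℝ²` to a fibre of `X` lifts to the linear coordinates of the fibre. -/
theorem exists_lift {p : M} {f : ℝ × ℝ → P.X}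
    (hf : ContMDiff 𝓘(ℝ, ℝ × ℝ) 𝓘(ℝ, E).tangent ∞ f) (hp : ∀ z, P.proj (f z) = p) :
    ∃ x : ℝ × ℝ → FrameIdx E → ℝ, ContDiff ℝ ∞ x ∧
      (∀ z, P.quot (P.adaptedFun p (fibreCoord p (x z))) = f z) ∧
      ∀ z a, P.angle p (f z) a = (x z a : AddCircle (2 * Real.pi)) := by
  have hcov := AddCircle.isCoveringMap_coe (2 * Real.pi)
  have hθ : Continuous fun z => P.angle p (f z) := continuous_iff_continuousAt.2 fun z =>
    ContinuousAt.comp (P.continuousAt_angle p (by rw [hp]; exact P.mem_frameDom p))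
      hf.continuous.continuousAt
  have hlift : ∀ a, ∃ x : C(ℝ × ℝ, ℝ), ∀ z,
      (x z : AddCircle (2 * Real.pi)) = P.angle p (f z) a := by
    intro a
    obtain ⟨e, he⟩ := QuotientAddGroup.mk_surjective (P.angle p (f 0) a)
    obtain ⟨x, ⟨-, hx⟩, -⟩ := hcov.existsUnique_continuousMap_lifts
      ⟨fun z => P.angle p (f z) a, (continuous_apply a).comp hθ⟩ 0 e he
    exact ⟨x, fun z => congrFun hx z⟩
  choose x hx using hlift
  have hq : ∀ z, P.quot (P.adaptedFun p (fibreCoord p fun a => x a z)) = f z := fun z =>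
    P.eq_of_angle_eq (P.adaptedFun_fibreCoord_proj p _) (hp z) (funext fun a => by
      rw [P.angle_fibreCoord, hx])
  refine ⟨fun z a => x a z, ?_, hq, fun z a => (hx a z).symm⟩
  rw [contDiff_iff_contDiffAt]
  intro z
  -- near `z` the lift is the composition of `f` with a local inverse of the quotient map
  set W : ℝ × ℝ → TB E M := fun z => P.adaptedFun p (fibreCoord p fun a => x a z) with hW
  have hWc : Continuous W := by
    refine continuous_iff_continuousAt.2 fun z => ?_
    have h1 : ContinuousAt (P.adaptedFun p) (fibreCoord p fun a => x a z) :=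
      ((P.adapted p).contMDiffOn.contMDiffAt
        ((P.adapted p).open_source.mem_nhds (P.fibreCoord_mem p _))).continuousAt
    have h2 : Continuous fun z => (fibreCoord p fun a => x a z : CoordSpace E) :=
      continuous_const.prodMk (continuous_pi fun a => (x a).continuous)
    exact ContinuousAt.comp (f := fun z => fibreCoord p fun a => x a z) h1 h2.continuousAt
  have hWs : ContMDiffAt 𝓘(ℝ, ℝ × ℝ) 𝓘(ℝ, E).tangent ∞ W z := by
    have h1 : f z ∈ (P.quotDiffeo (W z)).target := by
      rw [← hq z]
      exact (P.quotDiffeo (W z)).map_source' (P.mem_quotDiffeo_source (W z))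
    have h2 := (P.quotDiffeo (W z)).symm.contMDiffOn.contMDiffAt
      ((P.quotDiffeo (W z)).open_target.mem_nhds h1)
    refine (h2.comp z (hf z)).congr_of_eventuallyEq ?_
    filter_upwards [hWc.continuousAt ((P.quotDiffeo (W z)).open_source.mem_nhds
      (P.mem_quotDiffeo_source (W z)))] with y hy
    refine ((P.quotDiffeo (W z)).left_inv' hy).symm.trans ?_
    exact congrArg (P.quotDiffeo (W z)).symm (hq y)
  have h3 := (P.contMDiffAt_coeff p (V := W z) (P.fibreCoord_mem p _).2).comp z hWs
  have h4 : ((fun V : TB E M => fun a => P.coeff p a V.proj V.2) ∘ W) = fun z a => x a z :=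
    funext fun z => funext fun a => P.coeff_adaptedFun_fibreCoord p _ a
  rw [h4] at h3
  exact h3.contDiffAt

end LatticePeriodStructure

end

/-! ### Integrality of the fibre classes and the compatible integrable system -/

section

variable {E : Type*} [NormedAddCommGroup E] [NormedSpace ℂ E]
  {M : Type*} [TopologicalSpace M] [ChartedSpace E M] [IsManifold 𝓘(ℂ, E) ω M]
  [FiniteDimensional ℂ E]

open LatticePeriodStructure

/-- A lift to `ℝ^F` of a map to a torus that is periodic with period `e` is periodic up to a
constant in `2π ℤ^F`. -/
theorem exists_period {F Z : Type*} {x : ℝ × ℝ → F → ℝ} {θ : ℝ × ℝ → Z}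
    {angle : Z → F → AddCircle (2 * Real.pi)} (hx : Continuous x)
    (hθ : ∀ z a, angle (θ z) a = (x z a : AddCircle (2 * Real.pi))) {e : ℝ × ℝ}
    (he : ∀ z, θ (z + e) = θ z) :
    ∃ m : F → ℤ, ∀ a z, x (z + e) a = x z a + 2 * Real.pi * m a := by
  have hcov := AddCircle.isCoveringMap_coe (2 * Real.pi)
  have hc : ∀ a, Continuous fun z => x z a := fun a => (continuous_apply a).comp hx
  have hz : ∀ z a, (x (z + e) a : AddCircle (2 * Real.pi)) = x z a := fun z a => by
    rw [← hθ, ← hθ, he]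
  have h1 : ∀ a, ∃ m : ℤ, x (0 + e) a = x 0 a + 2 * Real.pi * m := by
    intro a
    obtain ⟨m, hm⟩ := (QuotientAddGroup.eq.1 (hz 0 a).symm :
      -(x 0 a) + x (0 + e) a ∈ AddSubgroup.zmultiples (2 * Real.pi))
    refine ⟨m, ?_⟩
    simp only [zsmul_eq_mul] at hm
    linarith
  choose m hm using h1
  refine ⟨m, fun a z => ?_⟩
  refine congrFun (hcov.eq_of_comp_eq (g₁ := fun z => x (z + e) a)
    (g₂ := fun z => x z a + 2 * Real.pi * m a) ((hc a).comp (continuous_add_const e))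
    ((hc a).add continuous_const) (funext fun z => ?_) 0 (hm a)) z
  show (x (z + e) a : AddCircle (2 * Real.pi)) = ((x z a + 2 * Real.pi * m a : ℝ) : AddCircle _)
  rw [hz, AddCircle.coe_add, mul_comm (2 * Real.pi), ← zsmul_eq_mul, AddCircle.coe_zsmul,
    AddCircle.coe_period, smul_zero,
      add_zero]

namespace LatticePeriodStructure

variable (P : LatticePeriodStructure E M)

/-- The differential of a map from `ℝ²` to a fibre of `X`, in terms of a lift to the linear
coordinates. -/
theorem mfderiv_quot_fibreCoord (p : M) {x : ℝ × ℝ → FrameIdx E → ℝ} {z : ℝ × ℝ}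
    (hx : DifferentiableAt ℝ x z) (d : ℝ × ℝ) :
    (mfderiv 𝓘(ℝ, ℝ × ℝ) 𝓘(ℝ, E).tangent
        (fun z => P.quot (P.adaptedFun p (fibreCoord p (x z)))) z d : E × E)
      = P.quotDiff (P.adaptedFun p (fibreCoord p (x z)))
        (P.adaptedDiff p (fibreCoord p (x z)) (0, fderiv ℝ x z d)) := by
  have h1 : HasMFDerivAt 𝓘(ℝ, ℝ × ℝ) 𝓘(ℝ, CoordSpace E) (fun z => fibreCoord p (x z)) z
      ((0 : (ℝ × ℝ) →L[ℝ] E).prod (fderiv ℝ x z)) :=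
    ((hasFDerivAt_const (extChartAt 𝓘(ℝ, E) p p) z).prodMk hx.hasFDerivAt).hasMFDerivAt
  have h2 : HasMFDerivAt 𝓘(ℝ, CoordSpace E) 𝓘(ℝ, E).tangent (P.adapted p) (fibreCoord p (x z)) _ :=
    ((P.adapted p).mdifferentiableAt (by simp) (P.fibreCoord_mem p (x z))).hasMFDerivAt
  have h3 : HasMFDerivAt 𝓘(ℝ, E).tangent 𝓘(ℝ, E).tangent P.quot
      (P.adaptedFun p (fibreCoord p (x z))) _ :=
    ((P.contMDiffAt_quot _).mdifferentiableAt (by simp)).hasMFDerivAt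
  have h4 := (HasMFDerivAt.comp (f := P.adapted p) (g := P.quot) _ h3 h2).comp z h1
  exact congrArg (fun l : (ℝ × ℝ) →L[ℝ] E × E => l d) h4.mfderiv

end LatticePeriodStructure

namespace SpecialJoyceStructure

variable {P : SpecialPeriodStructure E M} {A : SpecialJoyceStructure P}

/-- The periods of `ω₃` on the fibres of `X` are integers: on a fibre, `ω₃` is `-1/4π²` times the
standard symplectic form of the coordinates, which are defined modulo `2π`. -/
theorem isIntegralOnFibre_ω₃ (hA : A.IsCompatible) (p : M) :
    IsIntegralOnFibre 𝓘(ℝ, E).tangent P.proj p (quotHyperkahler hA).ω₃ := by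
  intro f hf hp hf₁ hf₂
  obtain ⟨x, hx, hq, hang⟩ := P.exists_lift hf hp
  obtain rfl : (fun z => P.quot (P.adaptedFun p (fibreCoord p (x z)))) = f := funext hq
  obtain ⟨m, hm⟩ := exists_period (e := (1, 0)) hx.continuous hang fun z => by
    have e : z + ((1, 0) : ℝ × ℝ) = (z.1 + 1, z.2) := by ext <;> simp
    rw [e]
    exact hf₁ z.1 z.2
  obtain ⟨n, hn⟩ := exists_period (e := (0, 1)) hx.continuous hang fun z => by
    have e : z + ((0, 1) : ℝ × ℝ) = (z.1, z.2 + 1) := by ext <;> simp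
    rw [e]
    exact hf₂ z.1 z.2
  have hd : ∀ z, DifferentiableAt ℝ x z := fun z => hx.differentiable (by simp) z
  have hda : ∀ a z d, fderiv ℝ (fun z => x z a) z d = fderiv ℝ x z d a := fun a z d => by
    rw [(hasFDerivAt_pi'.1 (hd z).hasFDerivAt a).fderiv]
    rfl
  have hint : ∀ z, (quotHyperkahler hA).ω₃ (P.quot (P.adaptedFun p (fibreCoord p (x z))))
      (mfderiv 𝓘(ℝ, ℝ × ℝ) 𝓘(ℝ, E).tangent
        (fun z => P.quot (P.adaptedFun p (fibreCoord p (x z)))) z ((1, 0) : ℝ × ℝ))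
      (mfderiv 𝓘(ℝ, ℝ × ℝ) 𝓘(ℝ, E).tangent
        (fun z => P.quot (P.adaptedFun p (fibreCoord p (x z)))) z ((0, 1) : ℝ × ℝ))
      = -(1 / (4 * Real.pi ^ 2)) * ∑ i, (fderiv ℝ (fun z => x z (.inl i)) z (1, 0)
        * fderiv ℝ (fun z => x z (.inr i)) z (0, 1) - fderiv ℝ (fun z => x z (.inl i)) z (0, 1)
        * fderiv ℝ (fun z => x z (.inr i)) z (1, 0)) := by
    intro z
    have h1 := P.mfderiv_quot_fibreCoord p (hd z) (1, 0)
    have h2 := P.mfderiv_quot_fibreCoord p (hd z) (0, 1)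
    refine (congrArg₂ (fun a b => (quotHyperkahler hA).ω₃
      (P.quot (P.adaptedFun p (fibreCoord p (x z)))) a b) h1 h2).trans ?_
    rw [quotHyperkahler_ω₃ hA, A.ω₃_vertical (P.fibreCoord_mem p _)]
    simp only [hda]
    congr 1
    exact Finset.sum_congr rfl fun i _ => by ring
  have hxa : ∀ a, ContDiff ℝ ∞ fun z => x z a := fun a => contDiff_pi.1 hx a
  have e₁ : ∀ a s t, x (s + 1, t) a = x (s, t) a + 2 * Real.pi * m a := fun a s t => by
    simpa using hm a (s, t)
  have e₂ : ∀ a s t, x (s, t + 1) a = x (s, t) a + 2 * Real.pi * n a := fun a s t => by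
    simpa using hn a (s, t)
  refine ⟨-∑ i, (m (.inl i) * n (.inr i) - n (.inl i) * m (.inr i)), ?_⟩
  simp only [hint, intervalIntegral.integral_const_mul]
  rw [integral_sum_wedge (fun i => hxa (.inl i)) (fun i => hxa (.inr i)) (fun i => e₁ (.inl i))
    (fun i => e₂ (.inl i)) (fun i => e₁ (.inr i)) (fun i => e₂ (.inr i))]
  push_cast
  rw [Finset.mul_sum, ← Finset.sum_neg_distrib]
  refine Finset.sum_congr rfl fun i _ => ?_
  have := Real.pi_ne_zero
  field_simp
  ring

/-- The algebraic integrable system on `X`, with the holomorphic symplectic form `ω₁ + i ω₂` and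
the polarizations represented by `ω₃`. -/
def integrableSystem (hA : A.IsCompatible) :
    AlgebraicIntegrableSystem 𝓘(ℝ, E).tangent E P.proj :=
  let S := quotHyperkahler hA
  { I := S.I₃
    complex := S.complex₃
    smooth_proj := P.contMDiff_proj
    submersion := fun x t => by
      obtain ⟨V, rfl⟩ := P.quot_surjective x
      obtain ⟨a, rfl⟩ := A.dproj_surjective V t
      exact ⟨P.quotDiff V a, P.mfderiv_proj V a⟩
    holomorphic := forall_tangent_iff.2 fun V a => by
      refine (congrArg (mfderiv 𝓘(ℝ, E).tangent 𝓘(ℝ, E) P.proj (P.quot V))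
        (quotHyperkahler_I₃ hA V a)).trans ?_
      refine (P.mfderiv_proj V _).trans ((A.dproj_I₃ V a).trans ?_)
      exact congrArg (cplx E V.proj) (P.mfderiv_proj V a).symm
    Ω := complexForm S.ω₁ S.ω₂
    Ω_smooth := S.ω₁_smooth.complexForm S.ω₂_smooth
    Ω_alt := fun x a => by rw [complexForm_apply, S.ω₁_self, S.ω₂_self]; simp
    Ω_type := fun x a b => by
      rw [complexForm_apply, complexForm_apply, S.ω₁_I₃, S.ω₂_I₃, mul_add, ← mul_assoc,
        Complex.I_mul_I]
      push_cast
      ring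
    Ω_closed := IsClosedTwoForm.complexForm S.ω₁_smooth S.ω₂_smooth S.closed₁ S.closed₂
    Ω_nondegenerate := fun x a h => S.eq_zero_of_ω₁ x fun b => by
      simpa using congrArg Complex.re (h b)
    fibre_compact := P.isCompact_fibre
    fibre_connected := P.isConnected_fibre
    fibre_lagrangian := forall_tangent_iff.2 fun V a => by
      rw [P.mem_vert_iff, A.dproj_eq_zero_iff_forall]
      constructor
      · intro h b hb
        obtain ⟨b, rfl⟩ := (P.quotDiff V).surjective b
        rw [P.mem_vert_iff] at hb
        rw [complexForm_apply, quotHyperkahler_ω₁, quotHyperkahler_ω₂, (h b hb).1, (h b hb).2]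
        simp
      · intro h b hb
        have h1 := h (P.quotDiff V b) ((P.mem_vert_iff V b).2 hb)
        rw [complexForm_apply, quotHyperkahler_ω₁, quotHyperkahler_ω₂] at h1
        exact ⟨by simpa using congrArg Complex.re h1, by simpa using congrArg Complex.im h1⟩
    ρ := S.ω₃
    ρ_smooth := S.ω₃_smooth
    ρ_alt := S.ω₃_self
    ρ_closed := fun U hU A B C hA hB hC _ _ _ => S.closed₃ U hU A B C hA hB hC
      (fun _ _ => trivial) (fun _ _ => trivial) (fun _ _ => trivial)
    ρ_type := fun x a _ b _ => S.ω₃_I₃ x a b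
    ρ_nondegenerate := forall_tangent_iff.2 fun V a ha h => by
      rw [P.mem_vert_iff] at ha
      rw [A.eq_zero_of_ω₃_vertical ha fun b hb => (quotHyperkahler_ω₃ hA V a b).symm.trans
        (h _ ((P.mem_vert_iff V b).2 hb)), map_zero]
    ρ_integral := isIntegralOnFibre_ω₃ hA }

/-- The polarization classes are represented by `ω₃` itself, so that the 1-form relating the two
representatives can be taken to be zero. -/
theorem integrableSystem_isCompatible (hA : A.IsCompatible) :
    (integrableSystem hA).IsCompatible (quotHyperkahler hA) where
  complex_eq _ _ := rfl
  symplectic_eq _ _ _ := rfl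
  polarization_eq p := by
    refine ⟨fun _ => 0, fun U hU A hA => contMDiffOn_const, ?_⟩
    intro U hU B C hB hC _ _ x hx _
    have h : ∀ a, dirDeriv 𝓘(ℝ, E).tangent (fun _ : P.X => (0 : ℝ)) x a = 0 := fun a =>
      congrArg (fun l : (E × E) →L[ℝ] ℝ => l a) mfderiv_const
    have h1 : extDerivOne 𝓘(ℝ, E).tangent
        (fun x : P.X => (0 : TangentSpace 𝓘(ℝ, E).tangent x →ₗ[ℝ] ℝ)) B C x = 0 := by
      unfold extDerivOne
      simp only [LinearMap.zero_apply]
      rw [h, h]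
      simp
    rw [h1]
    exact sub_self _

end SpecialJoyceStructure

end

end

end SpecialJoyce

theorem proposition5p1 {E : Type*} [NormedAddCommGroup E] [NormedSpace ℂ E]
    [FiniteDimensional ℂ E] {M : Type*} [TopologicalSpace M] [T2Space M]
    [SecondCountableTopology M] [ChartedSpace E M] [IsManifold 𝓘(ℂ, E) ω M]
    (P : SpecialJoyce.SpecialPeriodStructure E M) (A : SpecialJoyce.SpecialJoyceStructure P)
    (hA : A.IsCompatible) :
    T2Space P.X ∧ SecondCountableTopology P.X ∧
      ∃ S : SpecialJoyce.Hyperkahler 𝓘(ℝ, E).tangent P.X, A.Induces S ∧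
        ∃ L : SpecialJoyce.AlgebraicIntegrableSystem 𝓘(ℝ, E).tangent E P.proj,
          L.IsCompatible S :=
  ⟨P.t2Space_X, P.secondCountableTopology_X, _,
    SpecialJoyce.SpecialJoyceStructure.induces_quotHyperkahler hA, _,
    SpecialJoyce.SpecialJoyceStructure.integrableSystem_isCompatible hA⟩
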